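/- Let $f\colon[0,1]\to[0,1]$ be a $C^2$ unimodal map, that is: for some $c\in(0,1)$, $f$ is $C^2$ with $f'\ne0$ on $[0,1]\setminus\{c\}$, and there are real numbers $\ell_-,\ell_+\ge1$, a neighbourhood $U$ of $c$ and $C^2$ diffeomorphisms $\phi_\pm,\varphi_\pm$ of $\mathbb R$ with $\phi_\pm(c)=\varphi_\pm(f(c))=0$ such that $|\varphi_-(f(x))|=|\phi_-(x)|^{\ell_-}$ for $x\in U$, $x\le c$, and $|\varphi_+(f(x))|=|\phi_+(x)|^{\ell_+}$ for $x\in U$, $x\ge c$. Assume that $f$ has a local maximum at $c$, and put $c_1=f(c)$. A wandering interval of $f$ is a nondegenerate interval $J\subset[0,1]$ such that $J,f(J),f^2(J),\dots$ are pairwise disjoint and for no $x\in J$ is the $\omega$-limit set of $x$ a periodic orbit; it is maximal if it is not strictly contained in another wandering interval. Suppose that $f$ has a wandering interval. Then $\ell_-\ne\ell_+$. Moreover, let $Q$ be any maximal wandering interval with $c_1\notin\overline Q$ and put $Q_n=f^n(Q)$. Then there are infinitely many closest return moments, i.e. integers $n\ge1$ with $\operatorname{dist}(Q_n,c_1)<\operatorname{dist}(Q_k,c_1)$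 for all $0\le k<n$. Let $s(0)=0$, let $s(1)<s(2)<\cdots$ be all the closest return moments, let $a_k,b_k$ be the left and right endpoints of $Q_{s(k)}$, and let $\eta_k=|b_k-c_1|/|a_k-c_1|$. Then there is a constant $\alpha>0$ such that one of the following holds: 1. $\ell_-<\ell_+$; for all large $k$, $Q_{s(k)-1}$ lies to the right of $c$; and $\displaystyle\liminf_{k\to\infty}\frac{\eta_{k-1}^{\alpha}\,|a_k-c_1|}{|a_{k-1}-c_1|^{\ell_+}}>0$; 2. $\ell_+<\ell_-$; for all large $k$, $Q_{s(k)-1}$ lies to the left of $c$; and $\displaystyle\liminf_{k\to\infty}\frac{\eta_{k-1}^{\alpha}\,|a_k-c_1|}{|a_{k-1}-c_1|^{\ell_-}}>0$. (The lower limits may be $+\infty$.) -/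

import Mathlib

open Set Filter Topology
open scoped Manifold ContDiff

/-- The type of `C^r` diffeomorphisms of `ℝ`. -/
abbrev RealDiffeo (r : ℕ) : Type := Diffeomorph 𝓘(ℝ, ℝ) 𝓘(ℝ, ℝ) ℝ ℝ r

/-- `f : [0,1] → [0,1]` (given by a function on `ℝ`, of which only the values on `[0,1]` matter)
is a `C^r` unimodal map with critical point `c`, left critical order `ℓm` and right critical
order `ℓp`. -/
structure IsUnimodal (r : ℕ) (f : ℝ → ℝ) (c ℓm ℓp : ℝ) : Prop where
  mapsTo : MapsTo f (Icc 0 1) (Icc 0 1)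
  mem_Ioo : c ∈ Ioo (0 : ℝ) 1
  contDiffOn : ContDiffOn ℝ r f (Icc 0 1 \ {c})
  deriv_ne_zero : ∀ x ∈ Icc (0 : ℝ) 1 \ {c}, derivWithin f (Icc 0 1) x ≠ 0
  one_le_left : 1 ≤ ℓm
  one_le_right : 1 ≤ ℓp
  left_order : ∃ φ ψ : RealDiffeo r, φ c = 0 ∧ ψ (f c) = 0 ∧
    ∀ᶠ x in 𝓝 c, x ≤ c → |ψ (f x)| = |φ x| ^ ℓm
  right_order : ∃ φ ψ : RealDiffeo r, φ c = 0 ∧ ψ (f c) = 0 ∧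
    ∀ᶠ x in 𝓝 c, c ≤ x → |ψ (f x)| = |φ x| ^ ℓp

/-- The `ω`-limit set of the point `x` under iteration of `f`. -/
def omegaSet (f : ℝ → ℝ) (x : ℝ) : Set ℝ :=
  omegaLimit atTop (fun (n : ℕ) (y : ℝ) => f^[n] y) {x}

/-- `O` is the orbit of a periodic point of `f`. -/
def IsPeriodicOrbit (f : ℝ → ℝ) (O : Set ℝ) : Prop :=
  ∃ p ∈ Function.periodicPts f, O = range (fun n : ℕ => f^[n] p)

/-- `J ⊆ [0,1]` is a (nondegenerate) wandering interval of `f`. -/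
structure IsWanderingInterval (f : ℝ → ℝ) (J : Set ℝ) : Prop where
  subset_Icc : J ⊆ Icc 0 1
  ordConnected : J.OrdConnected
  nontrivial : J.Nontrivial
  disjoint_images : Pairwise fun m n : ℕ => Disjoint (f^[m] '' J) (f^[n] '' J)
  not_periodic : ∀ x ∈ J, ¬ IsPeriodicOrbit f (omegaSet f x)

/-- A wandering interval that is not strictly contained in another wandering interval. -/
def IsMaximalWanderingInterval (f : ℝ → ℝ) (Q : Set ℝ) : Prop :=
  IsWanderingInterval f Q ∧ ∀ J, IsWanderingInterval f J → ¬ Q ⊂ J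

/-- `n ≥ 1` is a closest return moment of `Q` to the critical value `f c`. -/
def IsClosestReturnMoment (f : ℝ → ℝ) (c : ℝ) (Q : Set ℝ) (n : ℕ) : Prop :=
  1 ≤ n ∧ ∀ k < n, Metric.infDist (f c) (f^[n] '' Q) < Metric.infDist (f c) (f^[k] '' Q)

/-- `s 0 = 0`, and `s 1 < s 2 < ⋯` are the closest return moments in increasing order
(`Nat.nth p k` is the `k`-th number with the property `p`, counted from `k = 0`). -/
noncomputable def closestMoment (f : ℝ → ℝ) (c : ℝ) (Q : Set ℝ) : ℕ → ℕ
  | 0 => 0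
  | k + 1 => Nat.nth (IsClosestReturnMoment f c Q) k

/-- The left endpoint `a k` of the `k`-th closest return. -/
noncomputable def leftEnd (f : ℝ → ℝ) (c : ℝ) (Q : Set ℝ) (k : ℕ) : ℝ :=
  sInf (f^[closestMoment f c Q k] '' Q)

/-- The right endpoint `b k` of the `k`-th closest return. -/
noncomputable def rightEnd (f : ℝ → ℝ) (c : ℝ) (Q : Set ℝ) (k : ℕ) : ℝ :=
  sSup (f^[closestMoment f c Q k] '' Q)

/-- `η k = |b k - f c| / |a k - f c|`. -/
noncomputable def returnRatio (f : ℝ → ℝ) (c : ℝ) (Q : Set ℝ) (k : ℕ) : ℝ :=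
  |rightEnd f c Q k - f c| / |leftEnd f c Q k - f c|

/-- The lower limit of `η (k-1) ^ α * |a k - f c| / |a (k-1) - f c| ^ ℓ`, in the extended reals
(so that a lower limit `+∞` is not sent to a default value). -/
noncomputable def returnLiminf (f : ℝ → ℝ) (c : ℝ) (Q : Set ℝ) (α ℓ : ℝ) : EReal :=
  liminf (fun k : ℕ => ((returnRatio f c Q (k - 1) ^ α * |leftEnd f c Q k - f c| /
    |leftEnd f c Q (k - 1) - f c| ^ ℓ : ℝ) : EReal)) atTop

/-! ### Cross-ratios and their distortion -/

/-- The cross-ratio `|T| |J| / (|L| |R|)` of four consecutive points. -/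
noncomputable def crossRatio (a b c d : ℝ) : ℝ := (|d - a| * |c - b|) / (|b - a| * |d - c|)

/-- The four points are strictly ordered, in one of the two directions. -/
def Ordered4 (a b c d : ℝ) : Prop := (a < b ∧ b < c ∧ c < d) ∨ (d < c ∧ c < b ∧ b < a)

lemma Ordered4.reverse {a b c d : ℝ} (h : Ordered4 a b c d) : Ordered4 d c b a := by
  rcases h with h | h
  · exact Or.inr ⟨h.1, h.2.1, h.2.2⟩
  · exact Or.inl ⟨h.1, h.2.1, h.2.2⟩

lemma crossRatio_reverse (a b c d : ℝ) : crossRatio d c b a = crossRatio a b c d := by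
  unfold crossRatio
  rw [abs_sub_comm a d, abs_sub_comm b c, abs_sub_comm c d, abs_sub_comm a b,
    mul_comm |d - c|]

lemma Ordered4.abs_add {a b c d : ℝ} (h : Ordered4 a b c d) :
    |d - a| = |b - a| + |c - b| + |d - c| ∧ |c - a| = |b - a| + |c - b| ∧
      0 < |b - a| ∧ 0 < |c - b| ∧ 0 < |d - c| := by
  rcases h with ⟨h1, h2, h3⟩ | ⟨h1, h2, h3⟩
  · rw [abs_of_pos (by linarith), abs_of_pos (by linarith), abs_of_pos (by linarith),
      abs_of_pos (by linarith), abs_of_pos (by linarith)]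
    refine ⟨?_, ?_, ?_, ?_, ?_⟩ <;> linarith
  · rw [abs_of_neg (by linarith), abs_of_neg (by linarith), abs_of_neg (by linarith),
      abs_of_neg (by linarith), abs_of_neg (by linarith)]
    refine ⟨?_, ?_, ?_, ?_, ?_⟩ <;> linarith

lemma Ordered4.crossRatio_pos {a b c d : ℝ} (h : Ordered4 a b c d) : 0 < crossRatio a b c d := by
  obtain ⟨h1, h2, h3, h4, h5⟩ := h.abs_add
  unfold crossRatio
  have : 0 < |d - a| := by linarith
  positivity

/-- Slopes of `g` over subintervals of `[u, v] ⊆ S` differ at most by the factor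
`exp (C (v - u))`. -/
def SlopeDistortion (g : ℝ → ℝ) (S : Set ℝ) (C : ℝ) : Prop :=
  ∀ u v, Icc u v ⊆ S → ∀ x ∈ Icc u v, ∀ y ∈ Icc u v, ∀ x' ∈ Icc u v, ∀ y' ∈ Icc u v,
    |g y - g x| * |y' - x'| ≤ Real.exp (C * (v - u)) * (|y - x| * |g y' - g x'|)

lemma crossRatio_le_of_slopes {L J R L' J' R' C : ℝ} (hL : 0 < L) (hJ : 0 < J) (hR : 0 < R)
    (hL' : 0 < L') (hJ' : 0 < J') (hR' : 0 < R')
    (h1 : L' * J ≤ Real.exp (C * (L + J)) * (L * J'))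
    (h2 : R' * (L + J) ≤ Real.exp (C * (L + J + R)) * (R * (L' + J'))) :
    Real.exp (-(2 * C * (L + J))) * ((L + J + R) * J / (L * R)) ≤
      (L' + J' + R') * J' / (L' * R') := by
  set T := L + J + R with hT
  have hTpos : 0 < T := by positivity
  set E := Real.exp (-(C * (L + J))) with hE
  have hEpos : 0 < E := Real.exp_pos _
  have e1 : Real.exp (C * (L + J)) * E = 1 := by rw [hE, ← Real.exp_add]; simp
  have e2 : Real.exp (-(2 * C * (L + J))) = E * E := by rw [hE, ← Real.exp_add]; ring_nf
  set F := Real.exp (-(C * T)) with hF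
  have e3 : Real.exp (C * T) * F = 1 := by rw [hF, ← Real.exp_add]; simp
  have hFpos : 0 < F := Real.exp_pos _
  have conv : E * T ≤ R + (L + J) * F := by
    have hsum : R / T + (L + J) / T = 1 := by field_simp; rw [hT]; ring
    have := convexOn_exp.2 (mem_univ (0 : ℝ)) (mem_univ (-(C * T)))
      (show 0 ≤ R / T by positivity) (show 0 ≤ (L + J) / T by positivity) hsum
    simp only [smul_eq_mul, mul_zero, zero_add, Real.exp_zero, mul_one] at this
    have e4 : (L + J) / T * -(C * T) = -(C * (L + J)) := by field_simp
    rw [e4] at this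
    calc E * T ≤ (R / T + (L + J) / T * F) * T := by gcongr
      _ = R + (L + J) * F := by field_simp
  have a1 : E * (L' * J) ≤ L * J' := by
    calc E * (L' * J) ≤ E * (Real.exp (C * (L + J)) * (L * J')) := by gcongr
      _ = (Real.exp (C * (L + J)) * E) * (L * J') := by ring
      _ = L * J' := by rw [e1, one_mul]
  have a2 : F * (R' * (L + J)) ≤ R * (L' + J') := by
    calc F * (R' * (L + J)) ≤ F * (Real.exp (C * T) * (R * (L' + J'))) := by gcongr
      _ = (Real.exp (C * T) * F) * (R * (L' + J')) := by ring
      _ = R * (L' + J') := by rw [e3, one_mul]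
  have a3 : E * (T * R') ≤ R * (L' + J' + R') := by
    calc E * (T * R') = (E * T) * R' := by ring
      _ ≤ (R + (L + J) * F) * R' := by gcongr
      _ = R * R' + F * (R' * (L + J)) := by ring
      _ ≤ R * R' + R * (L' + J') := by gcongr
      _ = _ := by ring
  rw [e2, mul_div_assoc', div_le_div_iff₀ (by positivity) (by positivity)]
  calc E * E * (T * J) * (L' * R') = (E * (L' * J)) * (E * (T * R')) := by ring
    _ ≤ (L * J') * (R * (L' + J' + R')) := by gcongr
    _ = _ := by ring

lemma SlopeDistortion.crossRatio_le {g : ℝ → ℝ} {S : Set ℝ} {C : ℝ}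
    (hg : SlopeDistortion g S C) (hS : S.OrdConnected) {x₁ x₂ x₃ x₄ : ℝ}
    (h : Ordered4 x₁ x₂ x₃ x₄) (h' : Ordered4 (g x₁) (g x₂) (g x₃) (g x₄))
    (h₁ : x₁ ∈ S) (h₄ : x₄ ∈ S) :
    Real.exp (-(2 * C * |x₃ - x₁|)) * crossRatio x₁ x₂ x₃ x₄ ≤
      crossRatio (g x₁) (g x₂) (g x₃) (g x₄) := by
  obtain ⟨a1, a2, a3, a4, a5⟩ := h.abs_add
  obtain ⟨b1, b2, b3, b4, b5⟩ := h'.abs_add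
  unfold crossRatio
  rw [a1, a2, b1]
  apply crossRatio_le_of_slopes a3 a4 a5 b3 b4 b5
  · rw [← a2]
    rcases h with ⟨h1, h2, h3⟩ | ⟨h1, h2, h3⟩
    · have := hg x₁ x₃ ((Icc_subset_Icc_right h3.le).trans (hS.out h₁ h₄)) x₁ ⟨le_rfl, by linarith⟩
        x₂ ⟨by linarith, by linarith⟩ x₂ ⟨by linarith, by linarith⟩ x₃ ⟨by linarith, by linarith⟩
      rwa [abs_of_pos (show 0 < x₃ - x₁ by linarith)]
    · have := hg x₃ x₁ ((Icc_subset_Icc_left h1.le).trans (hS.out h₄ h₁)) x₁ ⟨by linarith, by linarith⟩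
        x₂ ⟨by linarith, by linarith⟩ x₂ ⟨by linarith, by linarith⟩ x₃ ⟨by linarith, by linarith⟩
      rwa [abs_sub_comm x₃ x₁, abs_of_pos (show 0 < x₁ - x₃ by linarith)]
  · rw [← a1, ← a2, ← b2]
    rcases h with ⟨h1, h2, h3⟩ | ⟨h1, h2, h3⟩
    · have := hg x₁ x₄ (hS.out h₁ h₄) x₃ ⟨by linarith, by linarith⟩
        x₄ ⟨by linarith, by linarith⟩ x₁ ⟨by linarith, by linarith⟩ x₃ ⟨by linarith, by linarith⟩
      rwa [abs_of_pos (show 0 < x₄ - x₁ by linarith)]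
    · have := hg x₄ x₁ (hS.out h₄ h₁) x₃ ⟨by linarith, by linarith⟩
        x₄ ⟨by linarith, by linarith⟩ x₁ ⟨by linarith, by linarith⟩ x₃ ⟨by linarith, by linarith⟩
      rwa [abs_sub_comm x₄ x₁, abs_of_pos (show 0 < x₁ - x₄ by linarith)]

/-- `C²` maps with non-vanishing derivative on a compact interval have bounded slope distortion
and are bi-Lipschitz. -/
lemma exists_slopeDistortion {g : ℝ → ℝ} {a b : ℝ} (hab : a < b) (hg : ContDiffOn ℝ 2 g (Icc a b))
    (hd : ∀ x ∈ Icc a b, derivWithin g (Icc a b) x ≠ 0) :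
    ∃ C M : ℝ, 0 ≤ C ∧ 1 ≤ M ∧ SlopeDistortion g (Icc a b) C ∧
      ∀ x ∈ Icc a b, ∀ y ∈ Icc a b, |g y - g x| ≤ M * |y - x| ∧ |y - x| ≤ M * |g y - g x| := by
  set g' := derivWithin g (Icc a b) with hg'
  have hu : UniqueDiffOn ℝ (Icc a b) := uniqueDiffOn_Icc hab
  have hg'1 : ContDiffOn ℝ 1 g' (Icc a b) := hg.derivWithin hu (by norm_num)
  have hne : (Icc a b).Nonempty := ⟨a, le_rfl, hab.le⟩
  obtain ⟨x0, hx0, hmin⟩ := isCompact_Icc.exists_isMinOn hne hg'1.continuousOn.abs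
  obtain ⟨x1, hx1, hmax⟩ := isCompact_Icc.exists_isMaxOn hne hg'1.continuousOn.abs
  set μ := |g' x0| with hμ
  have hμpos : 0 < μ := abs_pos.2 (hd x0 hx0)
  have hg''c : ContinuousOn (derivWithin g' (Icc a b)) (Icc a b) :=
    (hg'1.continuousOn_derivWithin hu le_rfl)
  obtain ⟨x2, hx2, hmax2⟩ := isCompact_Icc.exists_isMaxOn hne hg''c.abs
  set K := |derivWithin g' (Icc a b) x2| with hK
  have hLip : ∀ x ∈ Icc a b, ∀ y ∈ Icc a b, |g' y - g' x| ≤ K * |y - x| := by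
    intro x hx y hy
    have := (convex_Icc a b).norm_image_sub_le_of_norm_derivWithin_le
      (f := g') (C := K) (hg'1.differentiableOn (by norm_num)) (fun z hz => hmax2 hz) hx hy
    simpa using this
  have mvt : ∀ x ∈ Icc a b, ∀ y ∈ Icc a b, x < y → ∃ ξ ∈ Icc x y, g y - g x = g' ξ * (y - x) := by
    intro x hx y hy hxy
    have hsub : Icc x y ⊆ Icc a b := Icc_subset_Icc hx.1 hy.2
    have hdiff : DifferentiableOn ℝ g (Icc a b) := hg.differentiableOn (by norm_num)
    have hnhds : ∀ z ∈ Ioo x y, Icc a b ∈ 𝓝 z := fun z hz =>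
      Icc_mem_nhds (by linarith [hz.1, hx.1]) (by linarith [hz.2, hy.2])
    obtain ⟨ξ, hξ, he⟩ := exists_deriv_eq_slope g hxy (hg.continuousOn.mono hsub)
      (fun z hz => ((hdiff z (hsub (Ioo_subset_Icc_self hz))).differentiableAt
        (hnhds z hz)).differentiableWithinAt)
    refine ⟨ξ, Ioo_subset_Icc_self hξ, ?_⟩
    rw [hg', derivWithin_of_mem_nhds (hnhds ξ hξ), he]
    have : y - x ≠ 0 := by linarith
    field_simp
  have mvt' : ∀ u v, Icc u v ⊆ Icc a b → ∀ x ∈ Icc u v, ∀ y ∈ Icc u v,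
      ∃ ξ ∈ Icc u v, |g y - g x| = |g' ξ| * |y - x| := by
    intro u v huv x hx y hy
    rcases lt_trichotomy x y with h | h | h
    · obtain ⟨ξ, hξ, he⟩ := mvt x (huv hx) y (huv hy) h
      exact ⟨ξ, ⟨hx.1.trans hξ.1, hξ.2.trans hy.2⟩, by rw [he, abs_mul]⟩
    · exact ⟨x, hx, by simp [h]⟩
    · obtain ⟨ξ, hξ, he⟩ := mvt y (huv hy) x (huv hx) h
      exact ⟨ξ, ⟨hy.1.trans hξ.1, hξ.2.trans hx.2⟩, by
        rw [abs_sub_comm, he, abs_mul, abs_sub_comm x y]⟩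
  refine ⟨K / μ, max 1 (max |g' x1| μ⁻¹), by positivity, le_max_left _ _, ?_, ?_⟩
  · intro u v huv x hx y hy x' hx' y' hy'
    obtain ⟨ξ, hξ, e⟩ := mvt' u v huv x hx y hy
    obtain ⟨ξ', hξ', e'⟩ := mvt' u v huv x' hx' y' hy'
    rw [e, e']
    have h1 : |g' ξ| ≤ Real.exp (K / μ * (v - u)) * |g' ξ'| := by
      have h2 := hLip ξ' (huv hξ') ξ (huv hξ)
      have h3 : |ξ - ξ'| ≤ v - u := abs_sub_le_iff.2 ⟨by linarith [hξ.2, hξ'.1], by linarith [hξ.1, hξ'.2]⟩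
      have h4 : μ ≤ |g' ξ'| := hmin (huv hξ')
      have h5 : |g' ξ| ≤ |g' ξ'| + K * (v - u) := by
        have := abs_sub_abs_le_abs_sub (g' ξ) (g' ξ')
        have h6 : K * |ξ - ξ'| ≤ K * (v - u) := by gcongr
        linarith
      have h7 : K * (v - u) ≤ K / μ * (v - u) * |g' ξ'| := by
        have h0 : 0 ≤ v - u := by linarith [hx.1, hx.2]
        calc K * (v - u) = K / μ * (v - u) * μ := by field_simp
          _ ≤ _ := by gcongr
      have h8 := Real.add_one_le_exp (K / μ * (v - u))
      calc |g' ξ| ≤ (K / μ * (v - u) + 1) * |g' ξ'| := by linarith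
        _ ≤ _ := by gcongr
    calc |g' ξ| * |y - x| * |y' - x'| ≤ Real.exp (K / μ * (v - u)) * |g' ξ'| * |y - x| * |y' - x'| := by
          gcongr
      _ = _ := by ring
  · intro x hx y hy
    obtain ⟨ξ, hξ, e⟩ := mvt' a b subset_rfl x hx y hy
    rw [e]
    constructor
    · have : |g' ξ| ≤ max 1 (max |g' x1| μ⁻¹) :=
        (show |g' ξ| ≤ |g' x1| from hmax hξ).trans ((le_max_left _ _).trans (le_max_right _ _))
      gcongr
    · have h4 : μ ≤ |g' ξ| := hmin hξ
      have h5 : μ⁻¹ ≤ max 1 (max |g' x1| μ⁻¹) := (le_max_right _ _).trans (le_max_right _ _)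
      calc |y - x| = μ⁻¹ * (μ * |y - x|) := by field_simp
        _ ≤ max 1 (max |g' x1| μ⁻¹) * (|g' ξ| * |y - x|) := by gcongr

/-! ### Power maps expand cross-ratios -/

lemma rpow_aux_nonneg {l a : ℝ} (hl : 1 ≤ l) (ha : 0 < a) (ha1 : a ≤ 1) :
    0 ≤ (l - 1) - (l + 1) * a + (l + 1) * a ^ l - (l - 1) * a ^ (l + 1) := by
  set h : ℝ → ℝ := fun a => (l - 1) - (l + 1) * a + (l + 1) * a ^ l - (l - 1) * a ^ (l + 1) with hh
  have hd : ∀ x : ℝ, 0 < x → HasDerivAt h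
      ((l + 1) * (-1 + l * x ^ (l - 1) - (l - 1) * x ^ l)) x := by
    intro x hx
    have d1 := Real.hasDerivAt_rpow_const (x := x) (p := l) (Or.inl hx.ne')
    have d2 := Real.hasDerivAt_rpow_const (x := x) (p := l + 1) (Or.inl hx.ne')
    rw [show l + 1 - 1 = l by ring] at d2
    exact (((((hasDerivAt_id x).const_mul (l + 1)).const_sub (l - 1)).add
      (d1.const_mul (l + 1))).sub (d2.const_mul (l - 1))).congr_deriv (by ring)
  have hanti : AntitoneOn h (Icc a 1) := by
    apply antitoneOn_of_deriv_nonpos (convex_Icc a 1)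
    · exact fun x hx => (hd x (ha.trans_le hx.1)).continuousAt.continuousWithinAt
    · intro x hx
      rw [interior_Icc] at hx
      exact (hd x (ha.trans hx.1)).differentiableAt.differentiableWithinAt
    · intro x hx
      rw [interior_Icc] at hx
      have hx0 : 0 < x := ha.trans hx.1
      rw [(hd x hx0).deriv]
      have hamgm := Real.geom_mean_le_arith_mean2_weighted (w₁ := 1 / l) (w₂ := (l - 1) / l)
        (p₁ := 1) (p₂ := x ^ l) (by positivity) (div_nonneg (by linarith) (by linarith)) zero_le_one
        (by positivity) (by field_simp; ring)
      rw [Real.one_rpow, one_mul, ← Real.rpow_mul hx0.le, mul_div_cancel₀ _ (by linarith)] at hamgm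
      have : l * x ^ (l - 1) ≤ 1 + (l - 1) * x ^ l := by
        calc l * x ^ (l - 1) ≤ l * (1 / l * 1 + (l - 1) / l * x ^ l) := by gcongr
          _ = _ := by field_simp
      apply mul_nonpos_of_nonneg_of_nonpos <;> linarith
  have := hanti (left_mem_Icc.2 ha1) (right_mem_Icc.2 ha1) ha1
  simp only [hh, Real.one_rpow] at this
  linarith

lemma one_div_one_sub_le {l a : ℝ} (hl : 1 ≤ l) (ha : 0 ≤ a) (ha1 : a < 1) :
    1 / (1 - a) + (l - 1) / 2 ≤ l / (1 - a ^ l) := by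
  rcases ha.eq_or_lt with rfl | ha
  · rw [Real.zero_rpow (by linarith)]; norm_num; linarith
  have h := rpow_aux_nonneg hl ha ha1.le
  have h1 : a ^ l < 1 := Real.rpow_lt_one ha.le ha1 (by linarith)
  rw [Real.rpow_add_one ha.ne'] at h
  rw [div_add_div _ _ (by linarith) two_ne_zero, div_le_div_iff₀ (by linarith) (by linarith)]
  nlinarith

lemma rpow_infinitesimal_crossRatio {l a y d : ℝ} (hl : 1 ≤ l) (ha : 0 ≤ a) (hay : a < y)
    (hyd : y < d) :
    1 / (y - a) + 1 / (d - y) ≤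
      l * y ^ (l - 1) / (y ^ l - a ^ l) + l * y ^ (l - 1) / (d ^ l - y ^ l) := by
  have hy : 0 < y := ha.trans_lt hay
  have hd : 0 < d := hy.trans hyd
  have h1 := one_div_one_sub_le hl (a := a / y) (by positivity) ((div_lt_one hy).2 hay)
  have h2 := one_div_one_sub_le hl (a := y / d) (by positivity) ((div_lt_one hd).2 hyd)
  rw [Real.div_rpow ha hy.le] at h1
  rw [Real.div_rpow hy.le hd.le] at h2
  have hyl : y ^ l = y ^ (l - 1) * y := by
    rw [← Real.rpow_add_one hy.ne']; ring_nf
  have p1 : a ^ l < y ^ l := Real.rpow_lt_rpow ha hay (by linarith)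
  have p2 : y ^ l < d ^ l := Real.rpow_lt_rpow hy.le hyd (by linarith)
  have hYl : 0 < y ^ l := by positivity
  have hYl' : 0 < y ^ (l - 1) := by positivity
  have hdl : 0 < d ^ l := by positivity
  have q1 : 1 / (1 - a / y) = y * (1 / (y - a)) := by
    have : y - a ≠ 0 := by linarith
    rw [one_sub_div hy.ne']; field_simp
  have q2 : l / (1 - a ^ l / y ^ l) = y * (l * y ^ (l - 1) / (y ^ l - a ^ l)) := by
    have : y ^ l - a ^ l ≠ 0 := by linarith
    rw [one_sub_div hYl.ne', div_div_eq_mul_div]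
    rw [mul_div_assoc', show y * (l * y ^ (l - 1)) = l * (y ^ (l - 1) * y) by ring, ← hyl]
  have q3 : 1 / (1 - y / d) = 1 + y * (1 / (d - y)) := by
    have : d - y ≠ 0 := by linarith
    rw [one_sub_div hd.ne']; field_simp; ring
  have q4 : l / (1 - y ^ l / d ^ l) = l + y * (l * y ^ (l - 1) / (d ^ l - y ^ l)) := by
    have : d ^ l - y ^ l ≠ 0 := by linarith
    rw [one_sub_div hdl.ne', div_div_eq_mul_div]
    rw [mul_div_assoc', show y * (l * y ^ (l - 1)) = l * (y ^ (l - 1) * y) by ring, ← hyl]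
    field_simp; ring
  rw [q1, q2] at h1
  rw [q3, q4] at h2
  have : y * (1 / (y - a) + 1 / (d - y)) ≤
    y * (l * y ^ (l - 1) / (y ^ l - a ^ l) + l * y ^ (l - 1) / (d ^ l - y ^ l)) := by
    rw [mul_add, mul_add]; linarith
  exact le_of_mul_le_mul_left this hy

lemma rpow_crossRatio_le {l a b c d : ℝ} (hl : 1 ≤ l) (ha : 0 ≤ a) (hab : a < b) (hbc : b < c)
    (hcd : c < d) :
    crossRatio a b c d ≤ crossRatio (a ^ l) (b ^ l) (c ^ l) (d ^ l) := by
  have hl0 : 0 < l := by linarith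
  have hb : 0 < b := ha.trans_lt hab
  have hc : 0 < c := hb.trans hbc
  set N : ℝ → ℝ := fun y => Real.log (y ^ l - a ^ l) - Real.log (y - a) + Real.log (d - y) -
    Real.log (d ^ l - y ^ l) with hN
  have hder : ∀ y, a < y → y < d → HasDerivAt N
      (l * y ^ (l - 1) / (y ^ l - a ^ l) - 1 / (y - a) + -1 / (d - y) -
        -(l * y ^ (l - 1)) / (d ^ l - y ^ l)) y := by
    intro y hay hyd
    have hy : 0 < y := ha.trans_lt hay
    have p1 : a ^ l < y ^ l := Real.rpow_lt_rpow ha hay hl0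
    have p2 : y ^ l < d ^ l := Real.rpow_lt_rpow hy.le hyd hl0
    have d1 := Real.hasDerivAt_rpow_const (x := y) (p := l) (Or.inl hy.ne')
    exact ((((d1.sub_const (a ^ l)).log (by linarith)).sub
      (((hasDerivAt_id y).sub_const a).log (by simp; linarith))).add
      (((hasDerivAt_id y).const_sub d).log (by simp; linarith))).sub
      ((d1.const_sub (d ^ l)).log (by linarith))
  have hmono : MonotoneOn N (Icc b c) := by
    apply monotoneOn_of_deriv_nonneg (convex_Icc b c)
    · exact fun x hx => (hder x (by linarith [hx.1]) (by linarith [hx.2])).continuousAt.continuousWithinAt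
    · intro x hx
      rw [interior_Icc] at hx
      exact (hder x (by linarith [hx.1]) (by linarith [hx.2])).differentiableAt.differentiableWithinAt
    · intro x hx
      rw [interior_Icc] at hx
      rw [(hder x (by linarith [hx.1]) (by linarith [hx.2])).deriv]
      have := rpow_infinitesimal_crossRatio hl ha (hab.trans hx.1) (hx.2.trans hcd)
      rw [neg_div, neg_div]
      linarith
  have key := hmono (left_mem_Icc.2 hbc.le) (right_mem_Icc.2 hbc.le) hbc.le
  have p1 : a ^ l < b ^ l := Real.rpow_lt_rpow ha hab hl0
  have p2 : b ^ l < c ^ l := Real.rpow_lt_rpow hb.le hbc hl0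
  have p3 : c ^ l < d ^ l := Real.rpow_lt_rpow hc.le hcd hl0
  have lg : ∀ y, a < y → y < d → a ^ l < y ^ l → y ^ l < d ^ l →
      N y = Real.log ((y ^ l - a ^ l) * (d - y) / ((y - a) * (d ^ l - y ^ l))) := by
    intro y h1 h2 h3 h4
    have z1 : y ^ l - a ^ l ≠ 0 := by linarith
    have z2 : d - y ≠ 0 := by linarith
    have z3 : y - a ≠ 0 := by linarith
    have z4 : d ^ l - y ^ l ≠ 0 := by linarith
    rw [Real.log_div (mul_ne_zero z1 z2) (mul_ne_zero z3 z4), Real.log_mul z1 z2, Real.log_mul z3 z4]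
    simp only [hN]; ring
  have y1 : 0 < b ^ l - a ^ l := by linarith
  have y2 : 0 < d - b := by linarith
  have y3 : 0 < b - a := by linarith
  have y4 : 0 < d ^ l - b ^ l := by linarith
  have y5 : 0 < c ^ l - a ^ l := by linarith
  have y6 : 0 < d - c := by linarith
  have y7 : 0 < c - a := by linarith
  have y8 : 0 < d ^ l - c ^ l := by linarith
  rw [lg b hab (hbc.trans hcd) p1 (p2.trans p3), lg c (hab.trans hbc) hcd (p1.trans p2) p3,
    Real.log_le_log_iff (by positivity) (by positivity),
    div_le_div_iff₀ (by positivity) (by positivity)] at key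
  unfold crossRatio
  rw [abs_of_pos (by linarith : 0 < d - a), abs_of_pos (by linarith : 0 < c - b),
    abs_of_pos y3, abs_of_pos y6, abs_of_pos (by linarith : 0 < d ^ l - a ^ l),
    abs_of_pos (by linarith : 0 < c ^ l - b ^ l), abs_of_pos y1, abs_of_pos y8,
    div_le_div_iff₀ (by positivity) (by positivity)]
  linear_combination key

/-! ### Disjoint intervals -/

lemma sum_length_le_one {ι : Type*} (s : Finset ι) (u v : ι → ℝ) (huv : ∀ i ∈ s, u i ≤ v i)
    (hsub : ∀ i ∈ s, Icc (u i) (v i) ⊆ Icc 0 1)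
    (hd : ∀ i ∈ s, ∀ j ∈ s, i ≠ j → Disjoint (Ioo (u i) (v i)) (Ioo (u j) (v j))) :
    ∑ i ∈ s, (v i - u i) ≤ 1 := by
  have h1 : MeasureTheory.volume (⋃ i ∈ s, Ioo (u i) (v i)) = ∑ i ∈ s, ENNReal.ofReal (v i - u i) := by
    rw [MeasureTheory.measure_biUnion_finset (fun i hi j hj hij => hd i hi j hj hij)
      (fun i _ => measurableSet_Ioo)]
    simp
  have h2 : MeasureTheory.volume (⋃ i ∈ s, Ioo (u i) (v i)) ≤ MeasureTheory.volume (Icc (0:ℝ) 1) :=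
    MeasureTheory.measure_mono (iUnion₂_subset fun i hi => Ioo_subset_Icc_self.trans (hsub i hi))
  rw [h1, ← ENNReal.ofReal_sum_of_nonneg (fun i hi => by linarith [huv i hi])] at h2
  simp only [Real.volume_Icc, sub_zero] at h2
  exact (ENNReal.ofReal_le_ofReal_iff zero_le_one).1 h2

/-! ### Injective maps on intervals -/

lemma strictMonoOn_or_strictAntiOn_uIcc {g : ℝ → ℝ} {a b : ℝ} (hc : ContinuousOn g (uIcc a b))
    (hi : InjOn g (uIcc a b)) : StrictMonoOn g (uIcc a b) ∨ StrictAntiOn g (uIcc a b) :=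
  hc.strictMonoOn_of_injOn_Icc' inf_le_sup hi

lemma Ordered4.mem {a b c d : ℝ} (h : Ordered4 a b c d) : b ∈ uIcc a d ∧ c ∈ uIcc a d := by
  rcases h with ⟨h1, h2, h3⟩ | ⟨h1, h2, h3⟩
  · rw [uIcc_of_le (by linarith)]
    exact ⟨⟨by linarith, by linarith⟩, ⟨by linarith, by linarith⟩⟩
  · rw [uIcc_of_ge (by linarith)]
    exact ⟨⟨by linarith, by linarith⟩, ⟨by linarith, by linarith⟩⟩

lemma Ordered4.image {g : ℝ → ℝ} {a b c d : ℝ} (h : Ordered4 a b c d)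
    (hc : ContinuousOn g (uIcc a d)) (hi : InjOn g (uIcc a d)) :
    Ordered4 (g a) (g b) (g c) (g d) := by
  have hb := h.mem.1
  have hc' := h.mem.2
  have ha : a ∈ uIcc a d := left_mem_uIcc
  have hd : d ∈ uIcc a d := right_mem_uIcc
  rcases strictMonoOn_or_strictAntiOn_uIcc hc hi with hm | hm <;>
    rcases h with ⟨h1, h2, h3⟩ | ⟨h1, h2, h3⟩
  · exact Or.inl ⟨hm ha hb h1, hm hb hc' h2, hm hc' hd h3⟩
  · exact Or.inr ⟨hm hd hc' h1, hm hc' hb h2, hm hb ha h3⟩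
  · exact Or.inr ⟨hm hc' hd h3, hm hb hc' h2, hm ha hb h1⟩
  · exact Or.inl ⟨hm hb ha h3, hm hc' hb h2, hm hd hc' h1⟩

/-! ### Diffeomorphisms of the line -/

lemma RealDiffeo.contDiff {r : ℕ} (φ : RealDiffeo r) : ContDiff ℝ r φ :=
  contMDiff_iff_contDiff.1 φ.contMDiff

lemma RealDiffeo.deriv_ne_zero (φ : RealDiffeo 2) (x : ℝ) : deriv φ x ≠ 0 := by
  intro h
  have h1 : HasDerivAt φ (deriv φ x) x := (φ.contDiff.differentiable (by norm_num) x).hasDerivAt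
  have h2 : HasDerivAt φ.symm (deriv φ.symm (φ x)) (φ x) :=
    ((RealDiffeo.contDiff φ.symm).differentiable (by norm_num) _).hasDerivAt
  have h3 := h2.comp x h1
  have h4 : (φ.symm ∘ φ : ℝ → ℝ) = id := by
    funext y; exact φ.symm_apply_apply y
  rw [h4, h, mul_zero] at h3
  exact one_ne_zero ((hasDerivAt_id x).unique h3)

lemma RealDiffeo.exists_sign (ψ : RealDiffeo 2) :
    ∃ s : ℝ, (s = 1 ∨ s = -1) ∧ ∀ y z, y < z → s * ψ z < s * ψ y := by
  rcases ψ.contDiff.continuous.strictMono_of_inj ψ.injective with h | h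
  · exact ⟨-1, Or.inr rfl, fun y z hyz => by have := h hyz; linarith⟩
  · exact ⟨1, Or.inl rfl, fun y z hyz => by have := h hyz; linarith⟩

/-! ### Elementary inequalities for powers -/

lemma rpow_sub_rpow_le {l X Y : ℝ} (hl : 1 ≤ l) (hX : 0 ≤ X) (hXY : X ≤ Y) :
    Y ^ l - X ^ l ≤ l * Y ^ (l - 1) * (Y - X) := by
  rcases (hX.trans hXY).eq_or_lt with h | hY
  · have : X = 0 := by linarith
    subst h; subst this; simp
  have hb := one_add_mul_self_le_rpow_one_add (s := (X - Y) / Y) (p := l)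
    (by rw [le_div_iff₀ hY]; linarith) hl
  rw [show 1 + (X - Y) / Y = X / Y by field_simp; ring, Real.div_rpow hX hY.le,
    le_div_iff₀ (by positivity)] at hb
  have hyl : Y ^ l = Y ^ (l - 1) * Y := by
    rw [← Real.rpow_add_one hY.ne']; ring_nf
  have : (1 + l * ((X - Y) / Y)) * Y ^ l = Y ^ l - l * Y ^ (l - 1) * (Y - X) := by
    rw [hyl]; field_simp; ring
  linarith

lemma le_rpow_sub_rpow {l X Y : ℝ} (hl : 1 ≤ l) (hX : 0 ≤ X) (hXY : X ≤ Y) :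
    Y ^ (l - 1) * (Y - X) ≤ Y ^ l - X ^ l := by
  rcases (hX.trans hXY).eq_or_lt with h | hY
  · have : X = 0 := by linarith
    subst h; subst this; simp
  have hyl : Y ^ l = Y ^ (l - 1) * Y := by
    rw [← Real.rpow_add_one hY.ne']; ring_nf
  have hxl : X ^ l ≤ Y ^ (l - 1) * X := by
    rcases hX.eq_or_lt with h | hX
    · subst h; rw [Real.zero_rpow (by linarith)]; simp
    · rw [show X ^ l = X ^ (l - 1) * X by rw [← Real.rpow_add_one hX.ne']; ring_nf]
      gcongr
  linarith

/-! ### Estimates on one branch of a unimodal map -/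

/-- The metric properties of one branch `S` of a unimodal map with critical order `l`. -/
structure BranchEstimates (f : ℝ → ℝ) (c l : ℝ) (S : Set ℝ) (K M ε : ℝ) : Prop where
  crossRatio_le : ∀ x₁ x₂ x₃ x₄, Ordered4 x₁ x₂ x₃ x₄ → x₁ ∈ S → x₄ ∈ S →
    Real.exp (-(K * (|x₃ - x₁| + |f x₃ - f x₁|))) * crossRatio x₁ x₂ x₃ x₄ ≤
      crossRatio (f x₁) (f x₂) (f x₃) (f x₄)
  upper : ∀ x ∈ S, f c - f x ≤ M * |x - c| ^ l
  lower : ∀ x ∈ S, |x - c| ^ l ≤ M * (f c - f x)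
  lipschitz : ∀ x ∈ S, ∀ y ∈ S, |f y - f x| ≤ M * |y - x|
  outer : ∀ p ∈ S, ∀ q ∈ S, ∀ α ∈ S, f α ≤ f q → f q ≤ f p → |α - q| ≤ ε * |q - p| →
    |f α - f q| ≤ 1 / 2 * |f q - f p|

lemma BranchEstimates.mono {f : ℝ → ℝ} {c l : ℝ} {S : Set ℝ} {K M ε K' M' ε' : ℝ}
    (h : BranchEstimates f c l S K M ε) (hK : K ≤ K') (hM : M ≤ M') (hε : ε' ≤ ε)
    (hmax : ∀ x ∈ S, f x ≤ f c) : BranchEstimates f c l S K' M' ε' where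
  crossRatio_le x₁ x₂ x₃ x₄ hx h₁ h₄ := by
    refine le_trans ?_ (h.crossRatio_le x₁ x₂ x₃ x₄ hx h₁ h₄)
    have := hx.crossRatio_pos.le
    gcongr
  upper x hx := (h.upper x hx).trans (by gcongr)
  lower x hx := (h.lower x hx).trans (by have := hmax x hx; gcongr)
  lipschitz x hx y hy := (h.lipschitz x hx y hy).trans (by gcongr)
  outer p hp q hq α hα h1 h2 h3 := h.outer p hp q hq α hα h1 h2 (h3.trans (by gcongr))

lemma crossRatio_const_mul {s : ℝ} (hs : s = 1 ∨ s = -1) (a b c d : ℝ) :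
    crossRatio (s * a) (s * b) (s * c) (s * d) = crossRatio a b c d := by
  have hs' : |s| = 1 := by rcases hs with rfl | rfl <;> simp
  unfold crossRatio
  simp only [← mul_sub, abs_mul, hs', one_mul]

lemma Ordered4.crossRatio_rpow_le {l a b c d : ℝ} (h : Ordered4 a b c d) (hl : 1 ≤ l)
    (ha : 0 ≤ a) (hd : 0 ≤ d) : crossRatio a b c d ≤ crossRatio (a ^ l) (b ^ l) (c ^ l) (d ^ l) := by
  rcases h with ⟨h1, h2, h3⟩ | ⟨h1, h2, h3⟩
  · exact rpow_crossRatio_le hl ha h1 h2 h3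
  · rw [← crossRatio_reverse a b c d, ← crossRatio_reverse (a ^ l)]
    exact rpow_crossRatio_le hl hd h1 h2 h3

lemma branchEstimates_of_factorization {f v : ℝ → ℝ} {a b c l s : ℝ} (hab : a < b)
    (hcS : c ∈ Icc a b) (hl : 1 ≤ l)
    (ψ : RealDiffeo 2) (hs : s = 1 ∨ s = -1) (hsψ : ∀ y z, y < z → s * ψ z < s * ψ y)
    (hψ : ψ (f c) = 0) (hv : ContDiffOn ℝ 2 v (Icc a b))
    (hv' : ∀ x ∈ Icc a b, derivWithin v (Icc a b) x ≠ 0)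
    (hv0 : v c = 0) (hvpos : ∀ x ∈ Icc a b, 0 ≤ v x)
    (hfv : ∀ x ∈ Icc a b, s * ψ (f x) = v x ^ l) :
    ∃ K M ε, 0 ≤ K ∧ 1 ≤ M ∧ 0 < ε ∧ BranchEstimates f c l (Icc a b) K M ε := by
  have hl0 : 0 < l := by linarith
  have hss : s * s = 1 := by rcases hs with rfl | rfl <;> norm_num
  have habs : |s| = 1 := by rcases hs with rfl | rfl <;> norm_num
  obtain ⟨C, M, hC, hM, hdist, hlip⟩ := exists_slopeDistortion hab hv hv'
  have hne : (Icc a b).Nonempty := ⟨c, hcS⟩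
  obtain ⟨xm, hxm, hxmax⟩ := isCompact_Icc.exists_isMaxOn hne hv.continuousOn
  set V := 1 + v xm with hV
  have hV1 : 1 ≤ V := by have := hvpos xm hxm; linarith
  have hvV : ∀ x ∈ Icc a b, v x ≤ V := fun x hx => by
    have : v x ≤ v xm := hxmax hx
    linarith
  set R := V ^ l with hR
  have hR0 : 0 < R := by positivity
  set θ : ℝ → ℝ := fun y => ψ.symm y with hθ
  have hθψ : ∀ y, θ (ψ y) = y := fun y => ψ.symm_apply_apply y
  obtain ⟨C', M', hC', hM', hdist', hlip'⟩ := exists_slopeDistortion (g := θ) (a := -R) (b := R)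
    (by linarith) (RealDiffeo.contDiff ψ.symm).contDiffOn (fun x hx => by
      rw [((RealDiffeo.contDiff ψ.symm).differentiable (by norm_num) x).derivWithin
        (uniqueDiffOn_Icc (by linarith) x hx)]
      exact RealDiffeo.deriv_ne_zero ψ.symm x)
  have hψv : ∀ x ∈ Icc a b, ψ (f x) = s * v x ^ l := fun x hx => by
    rw [← hfv x hx, ← mul_assoc, hss, one_mul]
  have hψR : ∀ x ∈ Icc a b, ψ (f x) ∈ Icc (-R) R := fun x hx => by
    rw [mem_Icc, ← abs_le, hψv x hx, abs_mul, habs, one_mul, abs_of_nonneg (by have := hvpos x hx; positivity)]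
    exact Real.rpow_le_rpow (hvpos x hx) (hvV x hx) hl0.le
  have hfl : ∀ x ∈ Icc a b, ∀ y ∈ Icc a b, |f y - f x| ≤ M' * |v y ^ l - v x ^ l| ∧
      |v y ^ l - v x ^ l| ≤ M' * |f y - f x| := by
    intro x hx y hy
    have := hlip' _ (hψR x hx) _ (hψR y hy)
    rw [hθψ, hθψ, hψv x hx, hψv y hy, ← mul_sub, abs_mul, habs, one_mul] at this
    exact this
  have hvc : ∀ x ∈ Icc a b, v x ≤ M * |x - c| ∧ |x - c| ≤ M * v x := by
    intro x hx
    have := hlip c hcS x hx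
    rwa [hv0, sub_zero, abs_of_nonneg (hvpos x hx)] at this
  have hfc : ∀ x ∈ Icc a b, f x ≤ f c := by
    intro x hx
    by_contra! hcon
    have h1 := hsψ _ _ hcon
    rw [hψ, mul_zero, hfv x hx] at h1
    have := hvpos x hx
    have : 0 ≤ v x ^ l := by positivity
    linarith
  have hfc' : ∀ x ∈ Icc a b, |f c - f x| = f c - f x := fun x hx =>
    abs_of_nonneg (by have := hfc x hx; linarith)
  have hvmono : ∀ x ∈ Icc a b, ∀ y ∈ Icc a b, f x ≤ f y → v y ≤ v x := by
    intro x hx y hy hxy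
    by_contra! hcon
    have h1 := Real.rpow_lt_rpow (hvpos x hx) hcon hl0
    rw [← hfv x hx, ← hfv y hy] at h1
    rcases hxy.eq_or_lt with h | h
    · rw [h] at h1; exact lt_irrefl _ h1
    · have := hsψ _ _ h; linarith
  have hpowlip : ∀ x ∈ Icc a b, ∀ y ∈ Icc a b, |v y ^ l - v x ^ l| ≤ l * V ^ (l - 1) * |v y - v x| := by
    have key : ∀ x ∈ Icc a b, ∀ y ∈ Icc a b, v x ≤ v y →
        |v y ^ l - v x ^ l| ≤ l * V ^ (l - 1) * |v y - v x| := by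
      intro x hx y hy h
      have h0 := Real.rpow_le_rpow (hvpos x hx) h hl0.le
      rw [abs_of_nonneg (by linarith), abs_of_nonneg (by linarith)]
      refine (rpow_sub_rpow_le hl (hvpos x hx) h).trans ?_
      have h1 : v y ^ (l - 1) ≤ V ^ (l - 1) :=
        Real.rpow_le_rpow (hvpos y hy) (hvV y hy) (by linarith)
      have : 0 ≤ v y - v x := by linarith
      gcongr
    intro x hx y hy
    rcases le_total (v x) (v y) with h | h
    · exact key x hx y hy h
    · rw [abs_sub_comm, abs_sub_comm (v y)]; exact key y hy x hx h
  have hinj : InjOn v (Icc a b) := by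
    intro x hx y hy hxy
    have := (hlip x hx y hy).2
    rw [hxy, sub_self, abs_zero, mul_zero] at this
    have := abs_nonpos_iff.1 this
    linarith
  have hinjf : InjOn f (Icc a b) := by
    intro x hx y hy hxy
    exact hinj hx hy (le_antisymm (hvmono y hy x hx hxy.ge) (hvmono x hx y hy hxy.le))
  have hcf : ContinuousOn f (Icc a b) := by
    have : ContinuousOn (fun x => θ (s * v x ^ l)) (Icc a b) :=
      (RealDiffeo.contDiff ψ.symm).continuous.comp_continuousOn
        (continuousOn_const.mul (hv.continuousOn.rpow_const fun x _ => Or.inr hl0.le))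
    refine this.congr fun x hx => ?_
    simp only [← hψv x hx, hθψ]
  set D := M' * (l * V ^ (l - 1) * M) with hD
  set E := M' * M ^ l with hE
  have hMl : 1 ≤ M ^ l := Real.one_le_rpow hM hl0.le
  set G := M' * M' * (l * 2 ^ (l - 1) * (M * M)) with hG
  have hG0 : 0 < G := by positivity
  have hD0 : 0 ≤ D := by positivity
  refine ⟨2 * C + 2 * C' * M', E + D, min (1 / (M * M)) (1 / (2 * G)), by positivity, ?_,
    by positivity, ?_, ?_, ?_, ?_, ?_⟩
  · have : (1 : ℝ) * 1 ≤ E := by rw [hE]; gcongr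
    linarith
  · intro x₁ x₂ x₃ x₄ hx h₁ h₄
    have hsub : uIcc x₁ x₄ ⊆ Icc a b := ordConnected_Icc.uIcc_subset h₁ h₄
    have h₂ := hsub hx.mem.1
    have h₃ := hsub hx.mem.2
    have o1 : Ordered4 (v x₁) (v x₂) (v x₃) (v x₄) :=
      hx.image (hv.continuousOn.mono hsub) (hinj.mono hsub)
    have o2 : Ordered4 (f x₁) (f x₂) (f x₃) (f x₄) := hx.image (hcf.mono hsub) (hinjf.mono hsub)
    have o3 : Ordered4 (ψ (f x₁)) (ψ (f x₂)) (ψ (f x₃)) (ψ (f x₄)) :=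
      o2.image ψ.contDiff.continuous.continuousOn ψ.injective.injOn
    have c1 := hdist.crossRatio_le ordConnected_Icc hx o1 h₁ h₄
    have c2 := o1.crossRatio_rpow_le hl (hvpos _ h₁) (hvpos _ h₄)
    have c3 := hdist'.crossRatio_le ordConnected_Icc o3 (by simpa only [hθψ] using o2)
      (hψR _ h₁) (hψR _ h₄)
    simp only [hθψ] at c3
    rw [hψv x₁ h₁, hψv x₂ h₂, hψv x₃ h₃, hψv x₄ h₄, crossRatio_const_mul hs, ← mul_sub, abs_mul,
      habs, one_mul] at c3
    have c4 := (hfl x₁ h₁ x₃ h₃).2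
    refine le_trans ?_ c3
    have hp := hx.crossRatio_pos.le
    calc _ ≤ Real.exp (-(2 * C' * |v x₃ ^ l - v x₁ ^ l|)) *
          (Real.exp (-(2 * C * |x₃ - x₁|)) * crossRatio x₁ x₂ x₃ x₄) := by
          rw [← mul_assoc, ← Real.exp_add]
          gcongr
          have e1 : 0 ≤ 2 * C * |f x₃ - f x₁| := by positivity
          have e2 : 0 ≤ 2 * C' * M' * |x₃ - x₁| := by positivity
          have e3 : 2 * C' * |v x₃ ^ l - v x₁ ^ l| ≤ 2 * C' * (M' * |f x₃ - f x₁|) := by gcongr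
          linarith
      _ ≤ _ := by gcongr; exact c1.trans c2
  · intro x hx
    rw [← hfc' x hx]
    have h1 := (hfl x hx c hcS).1
    rw [hv0, Real.zero_rpow hl0.ne', zero_sub, abs_neg,
      abs_of_nonneg (a := v x ^ l) (by have := hvpos x hx; positivity)] at h1
    have h2 : v x ^ l ≤ (M * |x - c|) ^ l := Real.rpow_le_rpow (hvpos x hx) (hvc x hx).1 hl0.le
    rw [Real.mul_rpow (by positivity) (by positivity)] at h2
    calc |f c - f x| ≤ M' * (M ^ l * |x - c| ^ l) := h1.trans (by gcongr)
      _ = E * |x - c| ^ l := by rw [hE]; ring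
      _ ≤ _ := by gcongr; linarith
  · intro x hx
    rw [← hfc' x hx]
    have h1 := (hfl x hx c hcS).2
    rw [hv0, Real.zero_rpow hl0.ne', zero_sub, abs_neg,
      abs_of_nonneg (a := v x ^ l) (by have := hvpos x hx; positivity)] at h1
    have h2 : |x - c| ^ l ≤ (M * v x) ^ l := Real.rpow_le_rpow (abs_nonneg _) (hvc x hx).2 hl0.le
    rw [Real.mul_rpow (by positivity) (hvpos x hx)] at h2
    calc |x - c| ^ l ≤ M ^ l * (M' * |f c - f x|) := h2.trans (by gcongr)
      _ = E * |f c - f x| := by rw [hE]; ring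
      _ ≤ _ := by gcongr; linarith
  · intro x hx y hy
    calc |f y - f x| ≤ M' * (l * V ^ (l - 1) * (M * |y - x|)) := by
          refine (hfl x hx y hy).1.trans ?_
          gcongr
          refine (hpowlip x hx y hy).trans ?_
          gcongr
          exact (hlip x hx y hy).1
      _ = D * |y - x| := by rw [hD]; ring
      _ ≤ _ := by gcongr; have : 0 ≤ E := by positivity
                  linarith
  · intro p hp q hq α hα h1 h2 h3
    have v1 := hvmono α hα q hq h1
    have v2 := hvmono q hq p hp h2
    have k1 : v α - v q ≤ min (1 / (M * M)) (1 / (2 * G)) * (M * M * (v q - v p)) := by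
      have e1 := (hlip q hq α hα).1
      have e2 := (hlip p hp q hq).2
      rw [abs_of_nonneg (by linarith)] at e1
      rw [abs_of_nonneg (a := v q - v p) (by linarith)] at e2
      calc v α - v q ≤ M * |α - q| := e1
        _ ≤ M * (min (1 / (M * M)) (1 / (2 * G)) * (M * (v q - v p))) := by
            gcongr; exact h3.trans (by gcongr)
        _ = _ := by ring
    have hqp : 0 ≤ v q - v p := by linarith
    have k2 : v α ≤ 2 * v q := by
      have : min (1 / (M * M)) (1 / (2 * G)) * (M * M * (v q - v p)) ≤
          1 / (M * M) * (M * M * (v q - v p)) := by gcongr; exact min_le_left _ _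
      have e : 1 / (M * M) * (M * M * (v q - v p)) = v q - v p := by field_simp
      have := hvpos p hp
      linarith
    have k3 : v α - v q ≤ 1 / (2 * G) * (M * M * (v q - v p)) :=
      k1.trans (by gcongr; exact min_le_right _ _)
    have k4 := rpow_sub_rpow_le hl (hvpos q hq) v1
    have k5 := le_rpow_sub_rpow hl (hvpos p hp) v2
    have k6 : v α ^ (l - 1) ≤ 2 ^ (l - 1) * v q ^ (l - 1) := by
      rw [← Real.mul_rpow (by norm_num) (hvpos q hq)]
      exact Real.rpow_le_rpow (hvpos α hα) k2 (by linarith)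
    have m1 := (hfl q hq α hα).1
    have m2 := (hfl p hp q hq).2
    rw [abs_of_nonneg (a := v α ^ l - v q ^ l) (by have := Real.rpow_le_rpow (hvpos q hq) v1 hl0.le; linarith)] at m1
    rw [abs_of_nonneg (a := v q ^ l - v p ^ l) (by have := Real.rpow_le_rpow (hvpos p hp) v2 hl0.le; linarith)] at m2
    have hq1 : 0 ≤ v q ^ (l - 1) := Real.rpow_nonneg (hvpos q hq) _
    calc |f α - f q| ≤ M' * (l * v α ^ (l - 1) * (v α - v q)) := m1.trans (by gcongr)
      _ ≤ M' * (l * (2 ^ (l - 1) * v q ^ (l - 1)) * (1 / (2 * G) * (M * M * (v q - v p)))) := by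
          gcongr
      _ = M' * (l * 2 ^ (l - 1) * (M * M)) * (1 / (2 * G)) * (v q ^ (l - 1) * (v q - v p)) := by ring
      _ ≤ M' * (l * 2 ^ (l - 1) * (M * M)) * (1 / (2 * G)) * (M' * |f q - f p|) := by
          exact mul_le_mul_of_nonneg_left (k5.trans m2) (by positivity)
      _ = G * (1 / (2 * G)) * |f q - f p| := by rw [hG]; ring
      _ = 1 / 2 * |f q - f p| := by field_simp

/-! ### Unimodal maps with a maximum at the critical point -/

/-- The topological part of the definition of a unimodal map with a maximum at `c`. -/
structure IsTent (f : ℝ → ℝ) (c : ℝ) : Prop where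
  mapsTo : MapsTo f (Icc 0 1) (Icc 0 1)
  mem_Ioo : c ∈ Ioo (0 : ℝ) 1
  continuousOn : ContinuousOn f (Icc 0 1)
  strictMonoOn : StrictMonoOn f (Icc 0 c)
  strictAntiOn : StrictAntiOn f (Icc c 1)

lemma IsTent.lt {f : ℝ → ℝ} {c : ℝ} (h : IsTent f c) {x : ℝ} (hx : x ∈ Icc (0 : ℝ) 1) (hxc : x ≠ c) :
    f x < f c := by
  rcases lt_or_gt_of_ne hxc with h1 | h1
  · exact h.strictMonoOn ⟨hx.1, h1.le⟩ ⟨h.mem_Ioo.1.le, le_rfl⟩ h1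
  · exact h.strictAntiOn ⟨le_rfl, h.mem_Ioo.2.le⟩ ⟨h1.le, hx.2⟩ h1

lemma IsTent.le {f : ℝ → ℝ} {c : ℝ} (h : IsTent f c) {x : ℝ} (hx : x ∈ Icc (0 : ℝ) 1) :
    f x ≤ f c := by
  rcases eq_or_ne x c with rfl | hxc
  · exact le_rfl
  · exact (h.lt hx hxc).le

lemma eq_of_abs_eq_rpow {f : ℝ → ℝ} {c l : ℝ} {S : Set ℝ} (hl : 1 ≤ l) {φ ψ : RealDiffeo 2}
    (hφ : φ c = 0) (hψ : ψ (f c) = 0) (h : ∀ᶠ x in 𝓝[S] c, |ψ (f x)| = |φ x| ^ l) :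
    ContinuousWithinAt f S c := by
  have hl0 : 0 < l := by linarith
  have h1 : Tendsto (fun x => |φ x| ^ l) (𝓝[S] c) (𝓝 0) := by
    have : Continuous fun x => |φ x| ^ l :=
      (φ.contDiff.continuous.abs).rpow_const fun x => Or.inr hl0.le
    have h2 := (this.tendsto c).mono_left (nhdsWithin_le_nhds (s := S))
    simpa [hφ, Real.zero_rpow hl0.ne'] using h2
  have h2 : Tendsto (fun x => ψ (f x)) (𝓝[S] c) (𝓝 0) := by
    rw [tendsto_zero_iff_abs_tendsto_zero]
    exact h1.congr' (h.mono fun x hx => hx.symm)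
  have h3 := ((RealDiffeo.contDiff ψ.symm).continuous.tendsto 0).comp h2
  have h4 : (fun y => ψ.symm y) ∘ (fun x => ψ (f x)) = f := by
    funext x; exact ψ.symm_apply_apply _
  have h5 : ψ.symm 0 = f c := by rw [← hψ]; exact ψ.symm_apply_apply _
  unfold ContinuousWithinAt
  rw [← h5]
  exact h3.congr fun x => ψ.symm_apply_apply _

namespace IsUnimodal

variable {f : ℝ → ℝ} {c ℓm ℓp : ℝ}

lemma contDiffWithinAt (hf : IsUnimodal 2 f c ℓm ℓp) {x : ℝ} (hx : x ∈ Icc (0 : ℝ) 1) (hxc : x ≠ c) :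
    ContDiffWithinAt ℝ 2 f (Icc 0 1) x :=
  (contDiffWithinAt_inter (isOpen_compl_singleton.mem_nhds hxc)).1
    (hf.contDiffOn x ⟨hx, hxc⟩)

lemma hasDerivWithinAt (hf : IsUnimodal 2 f c ℓm ℓp) {x : ℝ} (hx : x ∈ Icc (0 : ℝ) 1) (hxc : x ≠ c) :
    HasDerivWithinAt f (derivWithin f (Icc 0 1) x) (Icc 0 1) x :=
  ((hf.contDiffWithinAt hx hxc).differentiableWithinAt (by norm_num)).hasDerivWithinAt

lemma isTent (hf : IsUnimodal 2 f c ℓm ℓp) (hmax : IsLocalMax f c) : IsTent f c := by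
  have hc0 := hf.mem_Ioo.1
  have hc1 := hf.mem_Ioo.2
  have hcc : ContinuousAt f c := by
    rw [continuousAt_iff_continuous_left_right]
    constructor
    · obtain ⟨φ, ψ, h1, h2, h3⟩ := hf.left_order
      exact eq_of_abs_eq_rpow hf.one_le_left h1 h2
        ((eventually_nhdsWithin_iff).2 (h3.mono fun x hx hxc => hx hxc))
    · obtain ⟨φ, ψ, h1, h2, h3⟩ := hf.right_order
      exact eq_of_abs_eq_rpow hf.one_le_right h1 h2
        ((eventually_nhdsWithin_iff).2 (h3.mono fun x hx hxc => hx hxc))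
  have hcont : ContinuousOn f (Icc 0 1) := by
    intro x hx
    rcases eq_or_ne x c with rfl | hxc
    · exact hcc.continuousWithinAt
    · exact (hf.contDiffWithinAt hx hxc).continuousWithinAt
  have hder : ∀ x ∈ Ioo (0 : ℝ) 1, x ≠ c → deriv f x = derivWithin f (Icc 0 1) x := fun x hx hxc =>
    (derivWithin_of_mem_nhds (Icc_mem_nhds hx.1 hx.2)).symm
  refine ⟨hf.mapsTo, hf.mem_Ioo, hcont, ?_, ?_⟩
  · have hsub : Ico 0 c ⊆ Icc (0 : ℝ) 1 := fun x hx => ⟨hx.1, by linarith [hx.2]⟩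
    have hcont' : ContinuousOn f (Icc 0 c) := hcont.mono (Icc_subset_Icc_right hc1.le)
    rcases hasDerivWithinAt_forall_lt_or_forall_gt_of_forall_ne (convex_Ico 0 c)
      (fun x hx => (hf.hasDerivWithinAt (hsub hx) hx.2.ne).mono hsub) (m := 0)
      (fun x hx => hf.deriv_ne_zero x ⟨hsub hx, hx.2.ne⟩) with h | h
    · exfalso
      have hanti : StrictAntiOn f (Icc 0 c) := by
        apply strictAntiOn_of_deriv_neg (convex_Icc 0 c) hcont'
        intro x hx
        rw [interior_Icc] at hx
        rw [hder x ⟨hx.1, hx.2.trans hc1⟩ hx.2.ne]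
        exact h x ⟨hx.1.le, hx.2⟩
      obtain ⟨x, hx1, hx2⟩ := ((hmax.filter_mono nhdsWithin_le_nhds).and
        (Ioo_mem_nhdsLT hc0)).exists
      exact absurd (hanti ⟨hx2.1.le, hx2.2.le⟩ ⟨hc0.le, le_rfl⟩ hx2.2) (not_lt.2 hx1)
    · apply strictMonoOn_of_deriv_pos (convex_Icc 0 c) hcont'
      intro x hx
      rw [interior_Icc] at hx
      rw [hder x ⟨hx.1, hx.2.trans hc1⟩ hx.2.ne]
      exact h x ⟨hx.1.le, hx.2⟩
  · have hsub : Ioc c 1 ⊆ Icc (0 : ℝ) 1 := fun x hx => ⟨by linarith [hx.1], hx.2⟩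
    have hcont' : ContinuousOn f (Icc c 1) := hcont.mono (Icc_subset_Icc_left hc0.le)
    rcases hasDerivWithinAt_forall_lt_or_forall_gt_of_forall_ne (convex_Ioc c 1)
      (fun x hx => (hf.hasDerivWithinAt (hsub hx) hx.1.ne').mono hsub) (m := 0)
      (fun x hx => hf.deriv_ne_zero x ⟨hsub hx, hx.1.ne'⟩) with h | h
    · apply strictAntiOn_of_deriv_neg (convex_Icc c 1) hcont'
      intro x hx
      rw [interior_Icc] at hx
      rw [hder x ⟨hc0.trans hx.1, hx.2⟩ hx.1.ne']
      exact h x ⟨hx.1, hx.2.le⟩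
    · exfalso
      have hmono : StrictMonoOn f (Icc c 1) := by
        apply strictMonoOn_of_deriv_pos (convex_Icc c 1) hcont'
        intro x hx
        rw [interior_Icc] at hx
        rw [hder x ⟨hc0.trans hx.1, hx.2⟩ hx.1.ne']
        exact h x ⟨hx.1, hx.2.le⟩
      obtain ⟨x, hx1, hx2⟩ := ((hmax.filter_mono nhdsWithin_le_nhds).and
        (Ioo_mem_nhdsGT hc1)).exists
      exact absurd (hmono ⟨le_rfl, hc1.le⟩ ⟨hx2.1.le, hx2.2.le⟩ hx2.1) (not_lt.2 hx1)

lemma exists_branchEstimates_aux (hf : IsUnimodal 2 f c ℓm ℓp) (ht : IsTent f c) {a b l : ℝ}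
    (hab : a < b) (hsub : Icc a b ⊆ Icc 0 1) (hcS : c ∈ Icc a b) (hl : 1 ≤ l)
    (hside : Icc a b ⊆ Iic c ∨ Icc a b ⊆ Ici c)
    {φ ψ : RealDiffeo 2} (hφ : φ c = 0) (hψ : ψ (f c) = 0)
    (h : ∀ᶠ x in 𝓝[Icc a b] c, |ψ (f x)| = |φ x| ^ l) :
    ∃ K M ε, 0 ≤ K ∧ 1 ≤ M ∧ 0 < ε ∧ BranchEstimates f c l (Icc a b) K M ε := by
  have hl0 : 0 < l := by linarith
  obtain ⟨s, hs, hsψ⟩ := ψ.exists_sign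
  have hs0 : s ≠ 0 := by rcases hs with rfl | rfl <;> norm_num
  have hpos : ∀ x ∈ Icc a b, x ≠ c → 0 < s * ψ (f x) := fun x hx hxc => by
    have := hsψ _ _ (ht.lt (hsub hx) hxc)
    rwa [hψ, mul_zero] at this
  have hnn : ∀ x ∈ Icc a b, 0 ≤ s * ψ (f x) := fun x hx => by
    rcases eq_or_ne x c with rfl | hxc
    · rw [hψ, mul_zero]
    · exact (hpos x hx hxc).le
  have habs : ∀ x ∈ Icc a b, s * ψ (f x) = |ψ (f x)| := fun x hx => by
    rw [← abs_of_nonneg (hnn x hx), abs_mul]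
    rcases hs with rfl | rfl <;> simp
  set v : ℝ → ℝ := fun x => (s * ψ (f x)) ^ (1 / l) with hv
  -- near the critical point `v = ± φ`
  obtain ⟨s', hs', hs'φ⟩ : ∃ s' : ℝ, (s' = 1 ∨ s' = -1) ∧ ∀ x ∈ Icc a b, |φ x| = s' * φ x := by
    obtain ⟨s', hs', hs'φ⟩ := φ.exists_sign
    rcases hside with hS | hS
    · refine ⟨s', hs', fun x hx => ?_⟩
      have h0 : 0 ≤ s' * φ x := by
        rcases (show x ≤ c from hS hx).eq_or_lt with h | h
        · rw [h, hφ, mul_zero]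
        · have := hs'φ x c h; rw [hφ, mul_zero] at this; exact this.le
      rw [← abs_of_nonneg h0, abs_mul]
      rcases hs' with rfl | rfl <;> simp
    · refine ⟨-s', by rcases hs' with rfl | rfl <;> simp, fun x hx => ?_⟩
      have h0 : 0 ≤ -s' * φ x := by
        rcases (show c ≤ x from hS hx).eq_or_lt with h | h
        · rw [← h, hφ, mul_zero]
        · have := hs'φ c x h; rw [hφ, mul_zero] at this; linarith
      rw [← abs_of_nonneg h0, abs_mul]
      rcases hs' with rfl | rfl <;> simp
  have hs'0 : s' ≠ 0 := by rcases hs' with rfl | rfl <;> norm_num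
  have hvφ : v =ᶠ[𝓝[Icc a b] c] fun x => s' * φ x := by
    filter_upwards [h, self_mem_nhdsWithin] with x hx hxS
    simp only [hv]
    rw [habs x hxS, hx, ← Real.rpow_mul (abs_nonneg _), mul_one_div_cancel hl0.ne', Real.rpow_one,
      hs'φ x hxS]
  have hv0 : v c = 0 := by
    simp only [hv, hψ, mul_zero]
    exact Real.zero_rpow (by positivity)
  have hu := uniqueDiffOn_Icc hab
  have hCD : ContDiffOn ℝ 2 v (Icc a b) := by
    intro x hx
    rcases eq_or_ne x c with rfl | hxc
    · exact ContDiffWithinAt.congr_of_eventuallyEq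
        (contDiff_const.mul φ.contDiff).contDiffWithinAt hvφ (by rw [hv0, hφ, mul_zero])
    · refine ContDiffWithinAt.rpow_const_of_ne ?_ (hpos x hx hxc).ne'
      exact contDiffWithinAt_const.mul
        (ψ.contDiff.contDiffAt.comp_contDiffWithinAt x ((hf.contDiffWithinAt (hsub hx) hxc).mono hsub))
  have hD : ∀ x ∈ Icc a b, derivWithin v (Icc a b) x ≠ 0 := by
    intro x hx
    rcases eq_or_ne x c with rfl | hxc
    · have d1 : HasDerivWithinAt (fun x => s' * φ x) (s' * deriv φ x) (Icc a b) x :=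
        ((φ.contDiff.differentiable (by norm_num) x).hasDerivAt.const_mul s').hasDerivWithinAt
      rw [(d1.congr_of_eventuallyEq hvφ (by rw [hv0, hφ, mul_zero])).derivWithin (hu x hx)]
      exact mul_ne_zero hs'0 (φ.deriv_ne_zero x)
    · have d1 := (hf.hasDerivWithinAt (hsub hx) hxc).mono hsub
      have d2 : HasDerivAt ψ (deriv ψ (f x)) (f x) :=
        (ψ.contDiff.differentiable (by norm_num) _).hasDerivAt
      have d3 := ((d2.comp_hasDerivWithinAt x d1).const_mul s).rpow_const (p := 1 / l)
        (Or.inl (hpos x hx hxc).ne')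
      have d4 : HasDerivWithinAt v _ (Icc a b) x := d3
      rw [d4.derivWithin (hu x hx)]
      have p1 := hf.deriv_ne_zero x ⟨hsub hx, hxc⟩
      have p2 := ψ.deriv_ne_zero (f x)
      have p3 : (s * ψ (f x)) ^ (1 / l - 1) ≠ 0 := (Real.rpow_pos_of_pos (hpos x hx hxc) _).ne'
      have p4 : 1 / l ≠ 0 := by positivity
      exact mul_ne_zero (mul_ne_zero (mul_ne_zero hs0 (mul_ne_zero p2 p1)) p4) p3
  refine branchEstimates_of_factorization hab hcS hl ψ hs hsψ hψ hCD hD hv0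
    (fun x hx => Real.rpow_nonneg (hnn x hx) _) fun x hx => ?_
  simp only [hv]
  rw [← Real.rpow_mul (hnn x hx), one_div_mul_cancel hl0.ne', Real.rpow_one]

lemma exists_branchEstimates (hf : IsUnimodal 2 f c ℓm ℓp) (hmax : IsLocalMax f c) :
    ∃ K M ε, 0 ≤ K ∧ 1 ≤ M ∧ 0 < ε ∧ BranchEstimates f c ℓm (Icc 0 c) K M ε ∧
      BranchEstimates f c ℓp (Icc c 1) K M ε := by
  have ht := hf.isTent hmax
  have hc := hf.mem_Ioo
  obtain ⟨φ, ψ, h1, h2, h3⟩ := hf.left_order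
  obtain ⟨φ', ψ', h1', h2', h3'⟩ := hf.right_order
  obtain ⟨K, M, ε, hK, hM, hε, hB⟩ := hf.exists_branchEstimates_aux ht hc.1
    (Icc_subset_Icc_right hc.2.le) ⟨hc.1.le, le_rfl⟩ hf.one_le_left (Or.inl fun x hx => hx.2) h1 h2
    (eventually_nhdsWithin_iff.2 (h3.mono fun x hx hxS => hx hxS.2))
  obtain ⟨K', M', ε', hK', hM', hε', hB'⟩ := hf.exists_branchEstimates_aux ht hc.2
    (Icc_subset_Icc_left hc.1.le) ⟨le_rfl, hc.2.le⟩ hf.one_le_right (Or.inr fun x hx => hx.1) h1' h2'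
    (eventually_nhdsWithin_iff.2 (h3'.mono fun x hx hxS => hx hxS.1))
  exact ⟨max K K', max M M', min ε ε', hK.trans (le_max_left _ _), hM.trans (le_max_left _ _),
    lt_min hε hε',
    hB.mono (le_max_left _ _) (le_max_left _ _) (min_le_left _ _)
      fun x hx => ht.le ⟨hx.1, hx.2.trans hc.2.le⟩,
    hB'.mono (le_max_right _ _) (le_max_right _ _) (min_le_right _ _)
      fun x hx => ht.le ⟨hc.1.le.trans hx.1, hx.2⟩⟩

/-- Away from the critical point, `f` has bounded slope distortion. -/
lemma exists_slopeDistortion (hf : IsUnimodal 2 f c ℓm ℓp) {a b : ℝ} (hab : a < b)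
    (hsub : Icc a b ⊆ Icc 0 1) (hc : c ∉ Icc a b) : ∃ C, 0 ≤ C ∧ SlopeDistortion f (Icc a b) C := by
  have hne : ∀ x ∈ Icc a b, x ≠ c := fun x hx h => hc (h ▸ hx)
  obtain ⟨C, M, hC, -, h, -⟩ := _root_.exists_slopeDistortion hab
    (fun x hx => (hf.contDiffWithinAt (hsub hx) (hne x hx)).mono hsub) (fun x hx => by
      rw [((hf.hasDerivWithinAt (hsub hx) (hne x hx)).mono hsub).derivWithin
        (uniqueDiffOn_Icc hab x hx)]
      exact hf.deriv_ne_zero x ⟨hsub hx, hne x hx⟩)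
  exact ⟨C, hC, h⟩

end IsUnimodal

/-! ### Topological dynamics of unimodal maps -/

lemma image_uIcc_of_injOn {g : ℝ → ℝ} {a b : ℝ} (hc : ContinuousOn g (uIcc a b))
    (hi : InjOn g (uIcc a b)) : g '' uIcc a b = uIcc (g a) (g b) := by
  refine Subset.antisymm ?_ (intermediate_value_uIcc hc)
  rintro _ ⟨x, hx, rfl⟩
  have ha : a ∈ uIcc a b := left_mem_uIcc
  have hb : b ∈ uIcc a b := right_mem_uIcc
  rcases strictMonoOn_or_strictAntiOn_uIcc hc hi with h | h
  · have hm := h.monotoneOn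
    rcases le_total a b with hab | hab
    · rw [uIcc_of_le hab] at hx hm ha hb
      exact mem_uIcc.2 (Or.inl ⟨hm ha hx hx.1, hm hx hb hx.2⟩)
    · rw [uIcc_of_ge hab] at hx hm ha hb
      exact mem_uIcc.2 (Or.inr ⟨hm hb hx hx.1, hm hx ha hx.2⟩)
  · have hm := h.antitoneOn
    rcases le_total a b with hab | hab
    · rw [uIcc_of_le hab] at hx hm ha hb
      exact mem_uIcc.2 (Or.inr ⟨hm hx hb hx.2, hm ha hx hx.1⟩)
    · rw [uIcc_of_ge hab] at hx hm ha hb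
      exact mem_uIcc.2 (Or.inl ⟨hm hx ha hx.2, hm hb hx hx.1⟩)

lemma strictMonoOn_or_strictAntiOn_of_ordConnected {g : ℝ → ℝ} {Z : Set ℝ} (hZ : Z.OrdConnected)
    (hc : ContinuousOn g Z) (hi : InjOn g Z) : StrictMonoOn g Z ∨ StrictAntiOn g Z := by
  by_contra! hcon
  simp only [StrictMonoOn, StrictAntiOn, not_forall, not_lt] at hcon
  obtain ⟨⟨a, ha, b, hb, hab, h1⟩, ⟨a', ha', b', hb', hab', h2⟩⟩ := hcon
  have hsub : Icc (min a a') (max b b') ⊆ Z :=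
    hZ.out (by rcases min_choice a a' with h | h <;> rwa [h])
      (by rcases max_choice b b' with h | h <;> rwa [h])
  have hle : min a a' ≤ max b b' := (min_le_left _ _).trans (hab.le.trans (le_max_left _ _))
  have ma : a ∈ Icc (min a a') (max b b') := ⟨min_le_left _ _, hab.le.trans (le_max_left _ _)⟩
  have mb : b ∈ Icc (min a a') (max b b') := ⟨(min_le_left _ _).trans hab.le, le_max_left _ _⟩
  have ma' : a' ∈ Icc (min a a') (max b b') := ⟨min_le_right _ _, hab'.le.trans (le_max_right _ _)⟩
  have mb' : b' ∈ Icc (min a a') (max b b') := ⟨(min_le_right _ _).trans hab'.le, le_max_right _ _⟩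
  rcases (hc.mono hsub).strictMonoOn_of_injOn_Icc' hle (hi.mono hsub) with h | h
  · exact absurd (h ma mb hab) (not_lt.2 h1)
  · exact absurd (h ma' mb' hab') (not_lt.2 h2)

lemma mem_omegaSet {f : ℝ → ℝ} {x y : ℝ} :
    y ∈ omegaSet f x ↔ ∀ ε > 0, ∃ᶠ n in atTop, |f^[n] x - y| < ε := by
  rw [omegaSet, mem_omegaLimit_singleton_iff_mapClusterPt, mapClusterPt_iff_frequently]
  constructor
  · intro h ε hε
    exact h _ (Metric.ball_mem_nhds y hε)
  · intro h s hs
    obtain ⟨ε, hε, hb⟩ := Metric.mem_nhds_iff.1 hs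
    exact (h ε hε).mono fun n hn => hb hn

lemma omegaSet_eq_of_asymptotic {f : ℝ → ℝ} {x z : ℝ}
    (h : Tendsto (fun n => f^[n] x - f^[n] z) atTop (𝓝 0)) : omegaSet f x = omegaSet f z := by
  have key : ∀ x z : ℝ, Tendsto (fun n => f^[n] x - f^[n] z) atTop (𝓝 0) →
      omegaSet f x ⊆ omegaSet f z := by
    intro x z h y hy
    rw [mem_omegaSet] at hy ⊢
    intro ε hε
    have h1 : ∀ᶠ n in atTop, |f^[n] x - f^[n] z| < ε / 2 := by
      have := (tendsto_zero_iff_abs_tendsto_zero _).1 h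
      exact this.eventually_lt_const (by positivity)
    refine ((hy (ε / 2) (by positivity)).and_eventually h1).mono fun n hn => ?_
    have : f^[n] z - y = (f^[n] x - y) - (f^[n] x - f^[n] z) := by ring
    rw [this]
    exact (abs_sub _ _).trans_lt (by linarith [hn.1, hn.2])
  refine Subset.antisymm (key x z h) (key z x ?_)
  simpa using h.neg

lemma omegaSet_iterate (f : ℝ → ℝ) (x : ℝ) (m : ℕ) : omegaSet f (f^[m] x) = omegaSet f x := by
  ext y
  rw [mem_omegaSet, mem_omegaSet]
  refine forall₂_congr fun ε _ => ?_
  rw [frequently_atTop, frequently_atTop]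
  constructor
  · intro h a
    obtain ⟨b, hb, h'⟩ := h a
    exact ⟨b + m, by omega, by rwa [Function.iterate_add_apply]⟩
  · intro h a
    obtain ⟨b, hb, h'⟩ := h (a + m)
    refine ⟨b - m, by omega, ?_⟩
    rwa [← Function.iterate_add_apply, Nat.sub_add_cancel (by omega)]

lemma omegaSet_of_isPeriodicPt {f : ℝ → ℝ} {z : ℝ} {P : ℕ} (hP : 0 < P) (hz : f^[P] z = z) :
    omegaSet f z = range (fun n : ℕ => f^[n] z) := by
  have hper : Function.IsPeriodicPt f P z := hz
  have hmod : ∀ n, f^[n] z = f^[n % P] z := fun n => (hper.iterate_mod_apply n).symm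
  have hfin : (range (fun n : ℕ => f^[n] z)).Finite := by
    refine ((Finset.range P).finite_toSet.image (fun n => f^[n] z)).subset ?_
    rintro _ ⟨n, rfl⟩
    exact ⟨n % P, by simp [Nat.mod_lt _ hP], (hmod n).symm⟩
  ext y
  rw [mem_omegaSet]
  constructor
  · intro h
    rw [← hfin.isClosed.closure_eq, Metric.mem_closure_iff]
    intro ε hε
    obtain ⟨n, hn⟩ := (h ε hε).exists
    exact ⟨_, ⟨n, rfl⟩, by rwa [dist_comm]⟩
  · rintro ⟨n, rfl⟩ ε hε
    rw [frequently_atTop]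
    intro a
    refine ⟨n + P * a, ?_, ?_⟩
    · nlinarith
    · simp only [hmod (n + P * a), Nat.add_mul_mod_self_left]
      rw [hmod n, sub_self, abs_zero]
      exact hε

namespace IsTent

variable {f : ℝ → ℝ} {c : ℝ}

lemma iterate_mapsTo (h : IsTent f c) (n : ℕ) : MapsTo f^[n] (Icc 0 1) (Icc 0 1) :=
  h.mapsTo.iterate n

lemma iterate_continuousOn (h : IsTent f c) (n : ℕ) : ContinuousOn f^[n] (Icc 0 1) :=
  h.continuousOn.iterate h.mapsTo n

lemma uIcc_subset {a b : ℝ} (ha : a ∈ Icc (0 : ℝ) 1) (hb : b ∈ Icc (0 : ℝ) 1) :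
    uIcc a b ⊆ Icc 0 1 :=
  ordConnected_Icc.uIcc_subset ha hb

lemma image_iterate_uIcc (h : IsTent f c) {a b : ℝ} {n : ℕ} (ha : a ∈ Icc (0 : ℝ) 1)
    (hb : b ∈ Icc (0 : ℝ) 1) (hi : InjOn f^[n] (uIcc a b)) :
    f^[n] '' uIcc a b = uIcc (f^[n] a) (f^[n] b) :=
  image_uIcc_of_injOn ((h.iterate_continuousOn n).mono (uIcc_subset ha hb)) hi

lemma injOn_of_subset (h : IsTent f c) {S : Set ℝ} (hS : S ⊆ Icc 0 c ∨ S ⊆ Icc c 1) : InjOn f S := by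
  rcases hS with hS | hS
  · exact h.strictMonoOn.injOn.mono hS
  · exact h.strictAntiOn.injOn.mono hS

lemma subset_of_notMem {S : Set ℝ} (hS : S.OrdConnected) (hS1 : S ⊆ Icc 0 1)
    (hc : c ∉ S) : S ⊆ Icc 0 c ∨ S ⊆ Icc c 1 := by
  by_contra! hcon
  simp only [not_subset] at hcon
  obtain ⟨⟨x, hx, hx'⟩, ⟨y, hy, hy'⟩⟩ := hcon
  have h1 : c < x := by
    by_contra! h1; exact hx' ⟨(hS1 hx).1, h1⟩
  have h2 : y < c := by
    by_contra! h2; exact hy' ⟨h2, (hS1 hy).2⟩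
  exact hc (hS.out hy hx ⟨h2.le, h1.le⟩)

lemma subset_of_injOn (h : IsTent f c) {S : Set ℝ} (hS : S.OrdConnected) (hS1 : S ⊆ Icc 0 1)
    (hi : InjOn f S) : S ⊆ Icc 0 c ∨ S ⊆ Icc c 1 := by
  by_contra! hcon
  simp only [not_subset] at hcon
  obtain ⟨⟨y, hy, hy'⟩, ⟨x, hx, hx'⟩⟩ := hcon
  have h1 : c < y := by
    by_contra! h1; exact hy' ⟨(hS1 hy).1, h1⟩
  have h2 : x < c := by
    by_contra! h2; exact hx' ⟨h2, (hS1 hx).2⟩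
  have hfx := h.lt (hS1 hx) h2.ne
  have hfy := h.lt (hS1 hy) h1.ne'
  have hxy : Icc x y ⊆ S := hS.out hx hy
  obtain ⟨x', hx'1, hx'2⟩ := intermediate_value_Icc h2.le
    (h.continuousOn.mono ((Icc_subset_Icc_right h1.le).trans (hxy.trans hS1)))
    ⟨le_max_left (f x) (f y), max_le hfx.le hfy.le⟩
  obtain ⟨y', hy'1, hy'2⟩ := intermediate_value_Icc' h1.le
    (h.continuousOn.mono ((Icc_subset_Icc_left h2.le).trans (hxy.trans hS1)))
    ⟨le_max_right (f x) (f y), max_le hfx.le hfy.le⟩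
  have he := hi (hxy ⟨hx'1.1, hx'1.2.trans h1.le⟩) (hxy ⟨h2.le.trans hy'1.1, hy'1.2⟩)
    (hx'2.trans hy'2.symm)
  have : x' = c := le_antisymm hx'1.2 (he ▸ hy'1.1)
  rw [this] at hx'2
  rcases max_choice (f x) (f y) with h | h <;> rw [h] at hx'2 <;> linarith

/-- A monotone self-map of an interval by an iterate: all points are attracted to periodic
orbits. -/
theorem isPeriodicOrbit_of_mapsTo (h : IsTent f c) {Z : Set ℝ} (hZ : Z.OrdConnected)
    (hZ1 : Z ⊆ Icc 0 1) {p : ℕ} (hp : 1 ≤ p) (hi : InjOn f^[p] Z) (hm : MapsTo f^[p] Z Z) {x : ℝ}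
    (hx : x ∈ Z) : IsPeriodicOrbit f (omegaSet f x) := by
  obtain ⟨P, hP, hPm, hPZ⟩ : ∃ P : ℕ, 1 ≤ P ∧ MonotoneOn f^[P] Z ∧ MapsTo f^[P] Z Z := by
    rcases strictMonoOn_or_strictAntiOn_of_ordConnected hZ ((h.iterate_continuousOn p).mono hZ1) hi
      with h1 | h1
    · exact ⟨p, hp, h1.monotoneOn, hm⟩
    · refine ⟨p + p, by omega, ?_, ?_⟩
      · rw [Function.iterate_add]
        exact (h1.comp h1 hm).monotoneOn
      · rw [Function.iterate_add]; exact hm.comp hm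
  set y : ℕ → ℝ := fun k => (f^[P])^[k] x with hy
  have hyZ : ∀ k, y k ∈ Z := fun k => hPZ.iterate k hx
  have hysucc : ∀ k, y (k + 1) = f^[P] (y k) := fun k => Function.iterate_succ_apply' _ _ _
  have hlim : ∃ z, Tendsto y atTop (𝓝 z) := by
    rcases le_total (y 0) (y 1) with h01 | h01
    · have hmono : Monotone y := monotone_nat_of_le_succ fun n => by
        induction n with
        | zero => exact h01
        | succ n ih => rw [hysucc n, hysucc (n + 1)]; exact hPm (hyZ _) (hyZ _) ih
      exact ⟨_, tendsto_atTop_ciSup hmono ⟨1, by rintro _ ⟨k, rfl⟩; exact (hZ1 (hyZ k)).2⟩⟩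
    · have hanti : Antitone y := antitone_nat_of_succ_le fun n => by
        induction n with
        | zero => exact h01
        | succ n ih => rw [hysucc n, hysucc (n + 1)]; exact hPm (hyZ _) (hyZ _) ih
      exact ⟨_, tendsto_atTop_ciInf hanti ⟨0, by rintro _ ⟨k, rfl⟩; exact (hZ1 (hyZ k)).1⟩⟩
  obtain ⟨z, hz⟩ := hlim
  have hz1 : z ∈ Icc (0 : ℝ) 1 := isClosed_Icc.mem_of_tendsto hz (Eventually.of_forall fun k => hZ1 (hyZ k))
  have hyw : Tendsto y atTop (𝓝[Icc 0 1] z) :=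
    tendsto_nhdsWithin_iff.2 ⟨hz, Eventually.of_forall fun k => hZ1 (hyZ k)⟩
  have hit : ∀ r : ℕ, Tendsto (fun k => f^[r] (y k)) atTop (𝓝 (f^[r] z)) := fun r =>
    ((h.iterate_continuousOn r) z hz1).tendsto.comp hyw
  have hfix : f^[P] z = z := by
    refine tendsto_nhds_unique (hit P) ?_
    simpa only [hysucc] using (tendsto_add_atTop_iff_nat 1).2 hz
  have hyk : ∀ k, y k = f^[P * k] x := fun k => by
    simp only [hy, ← Function.iterate_mul]
  have hper : Function.IsPeriodicPt f P z := hfix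
  have hasym : Tendsto (fun n => f^[n] x - f^[n] z) atTop (𝓝 0) := by
    rw [Metric.tendsto_atTop]
    intro ε hε
    have h1 : ∀ᶠ k in atTop, ∀ r ∈ Finset.range P, |f^[r] (y k) - f^[r] z| < ε := by
      rw [eventually_all_finset]
      intro r _
      have := (hit r).eventually (Metric.ball_mem_nhds _ hε)
      exact this
    obtain ⟨k0, hk0⟩ := eventually_atTop.1 h1
    refine ⟨P * k0, fun n hn => ?_⟩
    have hk : k0 ≤ n / P := (Nat.le_div_iff_mul_le (by omega)).2 (by rwa [mul_comm])
    have := hk0 (n / P) hk (n % P) (Finset.mem_range.2 (Nat.mod_lt _ (by omega)))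
    rw [hyk, ← Function.iterate_add_apply, Nat.mod_add_div, hper.iterate_mod_apply] at this
    simpa [Real.dist_eq] using this
  rw [omegaSet_eq_of_asymptotic hasym, omegaSet_of_isPeriodicPt (by omega) hfix]
  exact ⟨z, Function.mk_mem_periodicPts (by omega) hper, rfl⟩

lemma injOn_iterate_of_notMem (h : IsTent f c) {S : Set ℝ} (hS : S.OrdConnected) (hS1 : S ⊆ Icc 0 1)
    (n : ℕ) (hc : ∀ i < n, c ∉ f^[i] '' S) : InjOn f^[n] S := by
  induction n with
  | zero => exact Function.injective_id.injOn
  | succ n ih =>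
    rw [Function.iterate_succ']
    refine InjOn.comp (t := f^[n] '' S) ?_ (ih fun i hi => hc i (by omega)) (mapsTo_image _ _)
    have h1 : (f^[n] '' S).OrdConnected :=
      (hS.isPreconnected.image _ ((h.iterate_continuousOn n).mono hS1)).ordConnected
    exact h.injOn_of_subset (subset_of_notMem h1 ((h.iterate_mapsTo n).mono_left hS1).image_subset
      (hc n (by omega)))

lemma injOn_iterate_of_le {S : Set ℝ} {m n : ℕ} (hmn : m ≤ n) (hi : InjOn f^[n] S) :
    InjOn f^[m] S := by
  obtain ⟨k, rfl⟩ := Nat.exists_eq_add_of_le hmn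
  rw [add_comm, Function.iterate_add] at hi
  exact hi.of_comp

lemma injOn_image_iterate {S : Set ℝ} {m n : ℕ} (hi : InjOn f^[m + n] S) :
    InjOn f^[n] (f^[m] '' S) := by
  rw [add_comm, Function.iterate_add] at hi
  exact hi.image_of_comp

lemma notMem_image_Ioo (h : IsTent f c) {u v : ℝ} (hsub : Ioo u v ⊆ Icc 0 1) {k : ℕ}
    (hi : InjOn f^[k + 1] (Ioo u v)) : c ∉ f^[k] '' Ioo u v := by
  rintro ⟨x, hx, hxc⟩
  have hik : InjOn f^[k] (Ioo u v) := injOn_iterate_of_le (Nat.le_succ k) hi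
  have hcont := (h.iterate_continuousOn k).mono hsub
  have h1 : (f^[k] '' Ioo u v).OrdConnected := (isPreconnected_Ioo.image _ hcont).ordConnected
  have h2 := h.subset_of_injOn h1 ((h.iterate_mapsTo k).mono_left hsub).image_subset
    (by simpa using injOn_image_iterate (n := 1) hi)
  obtain ⟨x1, hx1⟩ := exists_between hx.1
  obtain ⟨x2, hx2⟩ := exists_between hx.2
  have m1 : x1 ∈ Ioo u v := ⟨hx1.1, hx1.2.trans hx.2⟩
  have m2 : x2 ∈ Ioo u v := ⟨hx.1.trans hx2.1, hx2.2⟩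
  rcases strictMonoOn_or_strictAntiOn_of_ordConnected ordConnected_Ioo hcont hik with hm | hm
  · have e1 := hm m1 hx hx1.2
    have e2 := hm hx m2 hx2.1
    rw [hxc] at e1 e2
    rcases h2 with h2 | h2
    · exact absurd (h2 ⟨x2, m2, rfl⟩).2 (not_le.2 e2)
    · exact absurd (h2 ⟨x1, m1, rfl⟩).1 (not_le.2 e1)
  · have e1 := hm m1 hx hx1.2
    have e2 := hm hx m2 hx2.1
    rw [hxc] at e1 e2
    rcases h2 with h2 | h2
    · exact absurd (h2 ⟨x1, m1, rfl⟩).2 (not_le.2 e1)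
    · exact absurd (h2 ⟨x2, m2, rfl⟩).1 (not_le.2 e2)

/-- An open interval on which all iterates are injective and which contains a point that is not
attracted to a periodic orbit has pairwise disjoint images. -/
theorem disjoint_images_of_injOn (h : IsTent f c) {u v : ℝ} (hsub : Ioo u v ⊆ Icc 0 1)
    (hi : ∀ n, InjOn f^[n] (Ioo u v)) {q : ℝ} (hq : q ∈ Ioo u v)
    (hqp : ¬ IsPeriodicOrbit f (omegaSet f q)) {m n : ℕ} (hmn : m ≠ n) :
    Disjoint (f^[m] '' Ioo u v) (f^[n] '' Ioo u v) := by
  wlog hlt : m < n generalizing m n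
  · exact (this hmn.symm (by omega)).symm
  by_contra hnd
  rw [not_disjoint_iff_nonempty_inter] at hnd
  obtain ⟨p, rfl⟩ := Nat.exists_eq_add_of_lt hlt
  set s : ℕ → Set ℝ := fun j => f^[m + j * (p + 1)] '' Ioo u v with hs
  have hs1 : ∀ j, s j ⊆ Icc 0 1 := fun j => ((h.iterate_mapsTo _).mono_left hsub).image_subset
  set Z := ⋃ j, s j with hZ
  have hZ1 : Z ⊆ Icc 0 1 := iUnion_subset hs1
  have hsucc : ∀ j, f^[p + 1] '' s j = s (j + 1) := fun j => by
    rw [hs, ← image_comp, ← Function.iterate_add]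
    congr 2; ring
  have hchain : ∀ j, (s j ∩ s (j + 1)).Nonempty := by
    intro j
    induction j with
    | zero => simpa [hs, add_assoc] using hnd
    | succ j ih =>
      obtain ⟨x, hx1, hx2⟩ := ih
      exact ⟨f^[p + 1] x, hsucc j ▸ mem_image_of_mem _ hx1, hsucc (j + 1) ▸ mem_image_of_mem _ hx2⟩
  have hpre : IsPreconnected Z := IsPreconnected.iUnion_of_chain
    (fun j => isPreconnected_Ioo.image _ ((h.iterate_continuousOn _).mono hsub)) hchain
  have hZc : ∀ i, c ∉ f^[i] '' Z := by
    rintro i ⟨x, hx, hxc⟩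
    obtain ⟨j, hj⟩ := mem_iUnion.1 hx
    obtain ⟨w, hw, rfl⟩ := hj
    rw [← Function.iterate_add_apply] at hxc
    exact h.notMem_image_Ioo hsub (hi _) ⟨w, hw, hxc⟩
  have hZi := h.injOn_iterate_of_notMem hpre.ordConnected hZ1 (p + 1) fun i _ => hZc i
  have hZm : MapsTo f^[p + 1] Z Z := by
    intro x hx
    obtain ⟨j, hj⟩ := mem_iUnion.1 hx
    exact mem_iUnion.2 ⟨j + 1, hsucc j ▸ mem_image_of_mem _ hj⟩
  have hqZ : f^[m] q ∈ Z := mem_iUnion.2 ⟨0, by simpa [hs] using mem_image_of_mem _ hq⟩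
  have := h.isPeriodicOrbit_of_mapsTo hpre.ordConnected hZ1 (by omega) hZi hZm hqZ
  rw [omegaSet_iterate] at this
  exact hqp this

lemma image_iterate_Ioo (h : IsTent f c) {u v : ℝ} (huv : u < v) (hu : u ∈ Icc (0 : ℝ) 1)
    (hv : v ∈ Icc (0 : ℝ) 1) {n : ℕ} (hi : InjOn f^[n] (Icc u v)) :
    f^[n] '' Ioo u v = Ioo (min (f^[n] u) (f^[n] v)) (max (f^[n] u) (f^[n] v)) := by
  have hd : Ioo u v = uIcc u v \ {u, v} := by
    rw [uIcc_of_le huv.le, Icc_sdiff_both]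
  have hi' : InjOn f^[n] (uIcc u v) := by rwa [uIcc_of_le huv.le]
  have hsub : ({u, v} : Set ℝ) ⊆ uIcc u v := by
    rintro x (rfl | rfl)
    · exact left_mem_uIcc
    · exact right_mem_uIcc
  rw [hd, hi'.image_sdiff_subset hsub, h.image_iterate_uIcc hu hv hi', image_pair, uIcc]
  rcases le_total (f^[n] u) (f^[n] v) with h1 | h1
  · simp [h1]
  · simp only [h1, inf_of_le_right, sup_of_le_left]
    rw [pair_comm, Icc_sdiff_both]

/-- Two points of a wandering open interval have asymptotic orbits. -/
lemma tendsto_sub_of_disjoint (h : IsTent f c) {u v : ℝ} (hsub : Ioo u v ⊆ Icc 0 1)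
    (hi : ∀ n, InjOn f^[n] (Ioo u v))
    (hd : ∀ m n, m ≠ n → Disjoint (f^[m] '' Ioo u v) (f^[n] '' Ioo u v)) {x y : ℝ}
    (hx : x ∈ Ioo u v) (hy : y ∈ Ioo u v) :
    Tendsto (fun n => f^[n] x - f^[n] y) atTop (𝓝 0) := by
  wlog hxy : x < y generalizing x y
  · rcases (not_lt.1 hxy).eq_or_lt with rfl | h'
    · simp
    · simpa using (this hy hx h').neg
  have hxI : Icc x y ⊆ Ioo u v := Icc_subset_Ioo hx.1 hy.2
  have hx1 := hsub hx
  have hy1 := hsub hy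
  have himg : ∀ n, Ioo (min (f^[n] x) (f^[n] y)) (max (f^[n] x) (f^[n] y)) ⊆ f^[n] '' Ioo u v := by
    intro n
    rw [← h.image_iterate_Ioo hxy hx1 hy1 ((hi n).mono hxI)]
    exact image_mono (Ioo_subset_Icc_self.trans hxI)
  have hsum : Summable fun n => max (f^[n] x) (f^[n] y) - min (f^[n] x) (f^[n] y) := by
    refine summable_of_sum_le (c := 1) (fun n => sub_nonneg.2 min_le_max) fun s => ?_
    apply sum_length_le_one
    · exact fun i _ => min_le_max
    · intro i _
      have := uIcc_subset (h.iterate_mapsTo i hx1) (h.iterate_mapsTo i hy1)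
      exact this
    · intro i _ j _ hij
      exact (hd i j hij).mono (himg i) (himg j)
  rw [tendsto_zero_iff_abs_tendsto_zero]
  refine hsum.tendsto_atTop_zero.congr fun n => ?_
  simp only [Function.comp, max_sub_min_eq_abs']

end IsTent

/-! ### Intervals -/

lemma Set.OrdConnected.ends {J : Set ℝ} (hJ : J.OrdConnected) (hn : J.Nontrivial)
    (hs : J ⊆ Icc 0 1) : sInf J < sSup J ∧ Ioo (sInf J) (sSup J) ⊆ J ∧ J ⊆ Icc (sInf J) (sSup J) ∧
      sInf J ∈ Icc (0 : ℝ) 1 ∧ sSup J ∈ Icc (0 : ℝ) 1 := by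
  have hb : BddBelow J := ⟨0, fun x hx => (hs hx).1⟩
  have ha : BddAbove J := ⟨1, fun x hx => (hs hx).2⟩
  obtain ⟨x, hx, y, hy, hxy⟩ := hn.exists_lt
  have h1 := csInf_le hb hx
  have h2 := le_csSup ha hy
  refine ⟨by linarith, ?_, fun z hz => ⟨csInf_le hb hz, le_csSup ha hz⟩, ?_, ?_⟩
  · intro z hz
    obtain ⟨p, hp, hpz⟩ := exists_lt_of_csInf_lt hn.nonempty hz.1
    obtain ⟨q, hq, hqz⟩ := exists_lt_of_lt_csSup hn.nonempty hz.2
    exact hJ.out hp hq ⟨hpz.le, hqz.le⟩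
  · exact ⟨le_csInf hn.nonempty fun z hz => (hs hz).1, h1.trans (hs hx).2⟩
  · exact ⟨(hs hy).1.trans h2, csSup_le hn.nonempty fun z hz => (hs hz).2⟩

lemma mem_Ioo_ends_of_mem_nhds {S : Set ℝ} (hS : S ⊆ Icc 0 1) {m : ℝ} (hm : S ∈ 𝓝 m) :
    m ∈ Ioo (sInf S) (sSup S) := by
  have hb : BddBelow S := ⟨0, fun x hx => (hS hx).1⟩
  have ha : BddAbove S := ⟨1, fun x hx => (hS hx).2⟩
  obtain ⟨l, u, hlu, hsub⟩ := mem_nhds_iff_exists_Ioo_subset.1 hm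
  obtain ⟨x, hx⟩ := exists_between hlu.1
  obtain ⟨y, hy⟩ := exists_between hlu.2
  exact ⟨(csInf_le hb (hsub ⟨hx.1, hx.2.trans hlu.2⟩)).trans_lt hx.2,
    hy.1.trans_le (le_csSup ha (hsub ⟨hlu.1.trans hy.1, hy.2⟩))⟩

lemma SlopeDistortion.of_uIcc {g : ℝ → ℝ} {S : Set ℝ} {C : ℝ} (h : SlopeDistortion g S C) {a b : ℝ}
    (hS : uIcc a b ⊆ S) {x y x' y' : ℝ} (hx : x ∈ uIcc a b) (hy : y ∈ uIcc a b) (hx' : x' ∈ uIcc a b)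
    (hy' : y' ∈ uIcc a b) :
    |g y - g x| * |y' - x'| ≤ Real.exp (C * |b - a|) * (|y - x| * |g y' - g x'|) := by
  have := h (min a b) (max a b) hS x hx y hy x' hx' y' hy'
  rwa [max_sub_min_eq_abs] at this

lemma abs_sub_add_of_mem_uIcc {a b c : ℝ} (h : b ∈ uIcc a c) : |c - a| = |b - a| + |c - b| := by
  rcases mem_uIcc.1 h with ⟨h1, h2⟩ | ⟨h1, h2⟩
  · rw [abs_of_nonneg (by linarith), abs_of_nonneg (by linarith), abs_of_nonneg (by linarith)]; ring
  · rw [abs_of_nonpos (by linarith), abs_of_nonpos (by linarith), abs_of_nonpos (by linarith)]; ring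

namespace IsTent

variable {f : ℝ → ℝ} {c : ℝ}

lemma image_nontrivial (h : IsTent f c) {J : Set ℝ} (hJ : J.OrdConnected) (hn : J.Nontrivial)
    (hs : J ⊆ Icc 0 1) : (f '' J).Nontrivial := by
  obtain ⟨x, hx, y, hy, hxy⟩ := hn.exists_lt
  by_cases hcJ : c ∈ J
  · rcases eq_or_ne x c with rfl | hxc
    · exact ⟨f x, ⟨x, hx, rfl⟩, f y, ⟨y, hy, rfl⟩, (h.lt (hs hy) hxy.ne').ne'⟩
    · exact ⟨f c, ⟨c, hcJ, rfl⟩, f x, ⟨x, hx, rfl⟩, (h.lt (hs hx) hxc).ne'⟩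
  · exact ⟨f x, ⟨x, hx, rfl⟩, f y, ⟨y, hy, rfl⟩, fun he =>
      hxy.ne (h.injOn_of_subset (subset_of_notMem hJ hs hcJ) hx hy he)⟩

lemma isWanderingInterval_image (h : IsTent f c) {J : Set ℝ} (hJ : IsWanderingInterval f J) :
    IsWanderingInterval f (f '' J) where
  subset_Icc := (h.mapsTo.mono_left hJ.subset_Icc).image_subset
  ordConnected := (hJ.ordConnected.isPreconnected.image _
    (h.continuousOn.mono hJ.subset_Icc)).ordConnected
  nontrivial := h.image_nontrivial hJ.ordConnected hJ.nontrivial hJ.subset_Icc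
  disjoint_images := by
    intro m n hmn
    have := hJ.disjoint_images (i := m + 1) (j := n + 1) (by omega)
    simpa only [Function.onFun, Function.iterate_succ, image_comp] using this
  not_periodic := by
    rintro _ ⟨x, hx, rfl⟩
    have := hJ.not_periodic x hx
    rwa [← omegaSet_iterate f x 1] at this

lemma isWanderingInterval_iterate (h : IsTent f c) {J : Set ℝ} (hJ : IsWanderingInterval f J) (n : ℕ) :
    IsWanderingInterval f (f^[n] '' J) := by
  induction n with
  | zero => simpa using hJ
  | succ n ih =>
    rw [Function.iterate_succ', image_comp]
    exact h.isWanderingInterval_image ih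

end IsTent

lemma exists_maximal_wanderingInterval {f : ℝ → ℝ} {J : Set ℝ} (hJ : IsWanderingInterval f J) :
    ∃ Q, J ⊆ Q ∧ IsMaximalWanderingInterval f Q := by
  obtain ⟨Q, hJQ, hQ⟩ := zorn_subset_nonempty {W | IsWanderingInterval f W} (by
    intro C hC hchain hne
    have hpair : ∀ x ∈ ⋃₀ C, ∀ y ∈ ⋃₀ C, ∃ W ∈ C, x ∈ W ∧ y ∈ W := by
      rintro x ⟨U, hU, hx⟩ y ⟨V, hV, hy⟩
      rcases hchain.total hU hV with h | h
      · exact ⟨V, hV, h hx, hy⟩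
      · exact ⟨U, hU, hx, h hy⟩
    obtain ⟨W0, hW0⟩ := hne
    refine ⟨⋃₀ C, ⟨sUnion_subset fun W hW => (hC hW).subset_Icc, ⟨?_⟩,
      (hC hW0).nontrivial.mono (subset_sUnion_of_mem hW0), ?_, ?_⟩, fun W hW => subset_sUnion_of_mem hW⟩
    · intro x hx y hy
      obtain ⟨W, hW, hxW, hyW⟩ := hpair x hx y hy
      exact ((hC hW).ordConnected.out hxW hyW).trans (subset_sUnion_of_mem hW)
    · intro m n hmn
      refine disjoint_left.2 ?_
      rintro z ⟨x, hx, rfl⟩ ⟨y, hy, hxy⟩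
      obtain ⟨W, hW, hxW, hyW⟩ := hpair x hx y hy
      exact disjoint_left.1 ((hC hW).disjoint_images hmn) ⟨x, hxW, rfl⟩ ⟨y, hyW, hxy⟩
    · rintro x ⟨U, hU, hx⟩
      exact (hC hU).not_periodic x hx) J hJ
  exact ⟨Q, hJQ, hQ.prop, fun W hW hQW => hQW.2 (hQ.le_of_ge hW hQW.1)⟩

/-! ### Orbits of wandering intervals accumulate at the critical point -/

/-- If the orbit of an interval stays away from the critical point and has finite total length,
then so does the orbit of a slightly larger interval. -/
lemma IsTent.exists_extension {f : ℝ → ℝ} {c δ C : ℝ} (h : IsTent f c) (hδ : 0 < δ) (hC : 0 ≤ C)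
    (hl : SlopeDistortion f (Icc 0 (c - δ)) C) (hr : SlopeDistortion f (Icc (c + δ) 1) C)
    {e₁ e₂ : ℝ} (he₁ : e₁ ∈ Icc (0 : ℝ) 1) (he : e₁ ≠ e₂)
    (hav : ∀ r, ∀ x ∈ uIcc e₁ e₂, 2 * δ ≤ |f^[r] x - c|)
    (hsum : ∀ R, ∑ r ∈ Finset.range R, |f^[r] e₂ - f^[r] e₁| ≤ 1) :
    ∃ κ > 0, ∀ e₃ ∈ Icc (0 : ℝ) 1, e₂ ∈ uIcc e₁ e₃ → |e₃ - e₂| ≤ κ →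
      ∀ r, c ∉ f^[r] '' uIcc e₁ e₃ := by
  set κ := min 1 δ * Real.exp (-(2 * C)) with hκ
  have hκ0 : 0 < κ := mul_pos (lt_min one_pos hδ) (Real.exp_pos _)
  set w : ℕ → ℝ := fun r => |f^[r] e₂ - f^[r] e₁| with hw
  have hw1 : ∀ r, w r ≤ 1 := fun r =>
    (Finset.single_le_sum (f := w) (fun i _ => abs_nonneg _) (Finset.self_mem_range_succ r)).trans
      (hsum (r + 1))
  refine ⟨κ * |e₂ - e₁|, mul_pos hκ0 (abs_pos.2 (sub_ne_zero.2 he.symm)), ?_⟩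
  intro e₃ he₃ he₂ hρ
  have hU1 : uIcc e₁ e₃ ⊆ Icc 0 1 := IsTent.uIcc_subset he₁ he₃
  have he₂1 := hU1 he₂
  have main : ∀ r, (∀ i < r, c ∉ f^[i] '' uIcc e₁ e₃) ∧ |f^[r] e₃ - f^[r] e₂| ≤
      κ * Real.exp (2 * C * ∑ i ∈ Finset.range r, w i) * w r := by
    intro r
    induction r with
    | zero => exact ⟨fun i hi => absurd hi (by omega), by simpa [hw] using hρ⟩
    | succ r ih =>
      obtain ⟨ih1, ih2⟩ := ih
      have hinj := h.injOn_iterate_of_notMem ordConnected_uIcc hU1 r ih1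
      have himg := h.image_iterate_uIcc he₁ he₃ hinj
      have hsub12 : uIcc e₁ e₂ ⊆ uIcc e₁ e₃ := uIcc_subset_uIcc_left he₂
      have himg12 := h.image_iterate_uIcc he₁ he₂1 (hinj.mono hsub12)
      have hm1 := h.iterate_mapsTo r he₁
      have hm2 := h.iterate_mapsTo r he₂1
      have hm3 := h.iterate_mapsTo r he₃
      have hmid : f^[r] e₂ ∈ uIcc (f^[r] e₁) (f^[r] e₃) := himg ▸ mem_image_of_mem _ he₂
      have hρr : |f^[r] e₃ - f^[r] e₂| ≤ min 1 δ * w r := by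
        refine ih2.trans ?_
        have : 0 ≤ w r := abs_nonneg _
        gcongr
        rw [hκ, mul_assoc, ← Real.exp_add]
        have : Real.exp (-(2 * C) + 2 * C * ∑ i ∈ Finset.range r, w i) ≤ 1 := by
          rw [← Real.exp_zero]
          gcongr
          have : 2 * C * ∑ i ∈ Finset.range r, w i ≤ 2 * C * 1 := by gcongr; exact hsum r
          linarith
        exact mul_le_of_le_one_right (le_min zero_le_one hδ.le) this
      have hfar : ∀ y ∈ uIcc (f^[r] e₁) (f^[r] e₃), δ ≤ |y - c| := by
        intro y hy
        rcases uIcc_subset_uIcc_union_uIcc (b := f^[r] e₂) hy with hy | hy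
        · rw [← himg12] at hy
          obtain ⟨x, hx, rfl⟩ := hy
          have := hav r x hx
          linarith
        · have h1 : |y - f^[r] e₂| ≤ δ := by
            have h2 : |y - f^[r] e₂| ≤ |f^[r] e₃ - f^[r] e₂| := abs_sub_left_of_mem_uIcc hy
            calc _ ≤ min 1 δ * w r := h2.trans hρr
              _ ≤ δ * 1 := by
                have := hw1 r
                have : 0 ≤ w r := abs_nonneg _
                gcongr
                exact min_le_right _ _
              _ = δ := mul_one _
          have h2 := hav r e₂ right_mem_uIcc
          have h3 : |f^[r] e₂ - c| ≤ |y - c| + |y - f^[r] e₂| := by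
            have : f^[r] e₂ - c = (y - c) - (y - f^[r] e₂) := by ring
            rw [this]; exact abs_sub _ _
          linarith
      have hcn : c ∉ f^[r] '' uIcc e₁ e₃ := by
        rw [himg]
        intro hc
        have := hfar c hc
        simp at this
        linarith
      refine ⟨fun i hi => ?_, ?_⟩
      · rcases Nat.lt_succ_iff_lt_or_eq.1 hi with hi | rfl
        · exact ih1 i hi
        · exact hcn
      · have hsubS : uIcc (f^[r] e₁) (f^[r] e₃) ⊆ Icc 0 (c - δ) ∨
            uIcc (f^[r] e₁) (f^[r] e₃) ⊆ Icc (c + δ) 1 := by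
          rw [himg] at hcn
          rcases IsTent.subset_of_notMem ordConnected_uIcc (IsTent.uIcc_subset hm1 hm3) hcn with h1 | h1
          · left
            intro y hy
            have h2 := hfar y hy
            rw [abs_of_nonpos (by linarith [(h1 hy).2])] at h2
            exact ⟨(h1 hy).1, by linarith⟩
          · right
            intro y hy
            have h2 := hfar y hy
            rw [abs_of_nonneg (by linarith [(h1 hy).1])] at h2
            exact ⟨by linarith, (h1 hy).2⟩
        have hSD : |f (f^[r] e₃) - f (f^[r] e₂)| * |f^[r] e₂ - f^[r] e₁| ≤
            Real.exp (C * |f^[r] e₃ - f^[r] e₁|) *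
              (|f^[r] e₃ - f^[r] e₂| * |f (f^[r] e₂) - f (f^[r] e₁)|) := by
          rcases hsubS with h1 | h1
          · exact hl.of_uIcc h1 hmid right_mem_uIcc left_mem_uIcc hmid
          · exact hr.of_uIcc h1 hmid right_mem_uIcc left_mem_uIcc hmid
        rw [← Function.iterate_succ_apply' f, ← Function.iterate_succ_apply' f,
          ← Function.iterate_succ_apply' f] at hSD
        have hwpos : 0 < w r := by
          refine abs_pos.2 (sub_ne_zero.2 fun h' => he ?_)
          exact (hinj he₂ left_mem_uIcc h').symm
        have hlen : |f^[r] e₃ - f^[r] e₁| ≤ 2 * w r := by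
          rw [abs_sub_add_of_mem_uIcc hmid]
          have : min 1 δ * w r ≤ 1 * w r := by gcongr; exact min_le_left _ _
          have h3 : |f^[r] e₂ - f^[r] e₁| = w r := rfl
          linarith
        have : |f^[r + 1] e₃ - f^[r + 1] e₂| * w r ≤
            κ * Real.exp (2 * C * ∑ i ∈ Finset.range (r + 1), w i) * w (r + 1) * w r := by
          calc _ ≤ Real.exp (C * |f^[r] e₃ - f^[r] e₁|) *
              (|f^[r] e₃ - f^[r] e₂| * |f^[r + 1] e₂ - f^[r + 1] e₁|) := hSD
            _ ≤ Real.exp (C * (2 * w r)) *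
              (κ * Real.exp (2 * C * ∑ i ∈ Finset.range r, w i) * w r * w (r + 1)) := by
                gcongr
            _ = κ * (Real.exp (2 * C * ∑ i ∈ Finset.range r, w i) * Real.exp (C * (2 * w r))) *
                  w (r + 1) * w r := by ring
            _ = _ := by
                rw [← Real.exp_add, Finset.sum_range_succ]
                ring_nf
        exact le_of_mul_le_mul_right this hwpos
  exact fun r => (main (r + 1)).1 r (Nat.lt_succ_self r)

/-- The set of points `x` such that no iterate of the segment between `x` and `m` contains `c`. -/
def criticalFreeHull (f : ℝ → ℝ) (c m : ℝ) : Set ℝ :=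
  {x | x ∈ Icc (0 : ℝ) 1 ∧ ∀ r, c ∉ f^[r] '' uIcc x m}

lemma criticalFreeHull_subset {f : ℝ → ℝ} {c m : ℝ} : criticalFreeHull f c m ⊆ Icc 0 1 :=
  fun _ hx => hx.1

lemma criticalFreeHull_trans {f : ℝ → ℝ} {c m m' x : ℝ} (hm : m' ∈ criticalFreeHull f c m)
    (hx : x ∈ criticalFreeHull f c m') : x ∈ criticalFreeHull f c m := by
  refine ⟨hx.1, fun r hc => ?_⟩
  obtain ⟨y, hy, hyc⟩ := hc
  rcases uIcc_subset_uIcc_union_uIcc (b := m') hy with hy | hy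
  · exact hx.2 r ⟨y, hy, hyc⟩
  · exact hm.2 r ⟨y, hy, hyc⟩

lemma criticalFreeHull_symm {f : ℝ → ℝ} {c m m' : ℝ} (hm1 : m ∈ Icc (0 : ℝ) 1)
    (hm : m' ∈ criticalFreeHull f c m) : m ∈ criticalFreeHull f c m' :=
  ⟨hm1, fun r => by rw [uIcc_comm]; exact hm.2 r⟩

lemma criticalFreeHull_ordConnected {f : ℝ → ℝ} {c m : ℝ} :
    (criticalFreeHull f c m).OrdConnected := by
  refine ⟨fun x hx y hy z hz => ⟨ordConnected_Icc.out hx.1 hy.1 hz, fun r => ?_⟩⟩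
  rintro ⟨t, ht, htc⟩
  have hz' : z ∈ uIcc x y := Icc_subset_uIcc hz
  have : t ∈ uIcc x m ∪ uIcc y m := by
    rcases mem_uIcc.1 ht with ⟨h1, h2⟩ | ⟨h1, h2⟩
    · exact Or.inl (mem_uIcc.2 (Or.inl ⟨hz.1.trans h1, h2⟩))
    · exact Or.inr (mem_uIcc.2 (Or.inr ⟨h1, h2.trans hz.2⟩))
  rcases this with h | h
  · exact hx.2 r ⟨t, h, htc⟩
  · exact hy.2 r ⟨t, h, htc⟩

lemma notMem_image_criticalFreeHull {f : ℝ → ℝ} {c m : ℝ} (r : ℕ) :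
    c ∉ f^[r] '' criticalFreeHull f c m := by
  rintro ⟨x, hx, hxc⟩
  exact hx.2 r ⟨x, left_mem_uIcc, hxc⟩

lemma IsTent.mapsTo_criticalFreeHull {f : ℝ → ℝ} {c m : ℝ} (h : IsTent f c) (hm : m ∈ Icc (0 : ℝ) 1)
    (r : ℕ) : MapsTo f^[r] (criticalFreeHull f c m) (criticalFreeHull f c (f^[r] m)) := by
  intro x hx
  refine ⟨h.iterate_mapsTo r hx.1, fun i => ?_⟩
  have hinj := h.injOn_iterate_of_notMem ordConnected_uIcc (IsTent.uIcc_subset hx.1 hm) r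
    fun i _ => hx.2 i
  rw [← h.image_iterate_uIcc hx.1 hm hinj, ← image_comp, ← Function.iterate_add]
  exact hx.2 _

lemma abs_sub_le_of_mem_Icc {a b x y : ℝ} (hx : x ∈ Icc a b) (hy : y ∈ Icc a b) : |x - y| ≤ b - a :=
  abs_sub_le_iff.2 ⟨by linarith [hx.2, hy.1], by linarith [hx.1, hy.2]⟩

theorem IsUnimodal.not_avoids {f : ℝ → ℝ} {c ℓm ℓp : ℝ} (hf : IsUnimodal 2 f c ℓm ℓp)
    (hmax : IsLocalMax f c) {J : Set ℝ} (hJ : IsWanderingInterval f J) {ε : ℝ} (hε : 0 < ε) :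
    ∃ j, ∃ x ∈ f^[j] '' J, |x - c| < ε := by
  have h := hf.isTent hmax
  by_contra! hcon
  obtain ⟨hAB, hsub, -, -, -⟩ := hJ.ordConnected.ends hJ.nontrivial hJ.subset_Icc
  obtain ⟨m0, hm0⟩ := exists_between hAB
  have hm0' : m0 ∈ Ioo (sInf J) (sSup J) := hm0
  have hm01 : m0 ∈ Icc (0 : ℝ) 1 := hJ.subset_Icc (hsub hm0)
  set m : ℕ → ℝ := fun i => f^[i] m0 with hm
  have hm1 : ∀ i, m i ∈ Icc (0 : ℝ) 1 := fun i => h.iterate_mapsTo i hm01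
  set S : ℕ → Set ℝ := fun i => criticalFreeHull f c (m i) with hS
  have hS1 : ∀ i, S i ⊆ Icc 0 1 := fun i => criticalFreeHull_subset
  have hSo : ∀ i, (S i).OrdConnected := fun i => criticalFreeHull_ordConnected
  have hJc : ∀ i, c ∉ f^[i] '' J := fun i hc => by
    have := hcon i c hc
    simp at this; linarith
  have hJinj : ∀ i, InjOn f^[i] J := fun i =>
    h.injOn_iterate_of_notMem hJ.ordConnected hJ.subset_Icc i fun k _ => hJc k
  have hJS : J ⊆ S 0 := by
    intro x hx
    refine ⟨hJ.subset_Icc hx, fun r hc => hJc r ?_⟩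
    exact image_mono (hJ.ordConnected.uIcc_subset hx (hsub hm0)) hc
  have hSn : ∀ i, S i ∈ 𝓝 (m i) := by
    intro i
    obtain ⟨u, hu⟩ := exists_between hm0.1
    obtain ⟨v, hv⟩ := exists_between hm0.2
    have hIJ : Icc u v ⊆ J := (Icc_subset_Ioo hu.1 hv.2).trans hsub
    have huv : u < v := hu.2.trans hv.1
    have himg := h.image_iterate_Ioo (n := i) huv (hJ.subset_Icc (hIJ ⟨le_rfl, huv.le⟩))
      (hJ.subset_Icc (hIJ ⟨huv.le, le_rfl⟩)) ((hJinj i).mono hIJ)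
    have h1 : f^[i] '' Ioo u v ∈ 𝓝 (m i) := by
      rw [himg]
      refine isOpen_Ioo.mem_nhds ?_
      rw [← himg]
      exact mem_image_of_mem _ ⟨hu.2, hv.1⟩
    refine mem_of_superset h1 ?_
    rintro _ ⟨x, hx, rfl⟩
    have := h.mapsTo_criticalFreeHull (hm1 0) i (hJS (hIJ (Ioo_subset_Icc_self hx)))
    simpa [hS, hm] using this
  set u : ℕ → ℝ := fun i => sInf (S i) with hu
  set v : ℕ → ℝ := fun i => sSup (S i) with hv
  have hends := fun i => (hSo i).ends (infinite_of_mem_nhds (m i) (hSn i)).nontrivial (hS1 i)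
  have hmuv : ∀ i, m i ∈ Ioo (u i) (v i) := fun i => mem_Ioo_ends_of_mem_nhds (hS1 i) (hSn i)
  have hinjS : ∀ i n, InjOn f^[n] (Ioo (u i) (v i)) := fun i n =>
    (h.injOn_iterate_of_notMem (hSo i) (hS1 i) n fun k _ =>
      notMem_image_criticalFreeHull k).mono (hends i).2.1
  have hnp : ∀ i, ¬ IsPeriodicOrbit f (omegaSet f (m i)) := fun i => by
    rw [hm, omegaSet_iterate]
    exact hJ.not_periodic m0 (hsub hm0)
  have hHL : ∀ i m' n, m' ≠ n → Disjoint (f^[m'] '' Ioo (u i) (v i)) (f^[n] '' Ioo (u i) (v i)) :=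
    fun i m' n hmn => h.disjoint_images_of_injOn ((hends i).2.1.trans (hS1 i)) (hinjS i) (hmuv i)
      (hnp i) hmn
  have hdisj : ∀ i j, i < j → Disjoint (S i) (S j) := by
    intro i j hij
    rw [disjoint_left]
    intro z hzi hzj
    have h1 : m j ∈ S i := criticalFreeHull_trans hzi (criticalFreeHull_symm (hm1 j) hzj)
    have h2 : S j ⊆ S i := fun x hx => criticalFreeHull_trans h1 hx
    have h3 : m j ∈ Ioo (u i) (v i) :=
      mem_Ioo_ends_of_mem_nhds (hS1 i) (mem_of_superset (hSn j) h2)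
    have h4 : m j = f^[j - i] (m i) := by
      simp only [hm]
      rw [← Function.iterate_add_apply]
      congr 1; omega
    exact disjoint_left.1 (hHL i 0 (j - i) (by omega)) (by simpa using h3)
      ⟨m i, hmuv i, h4.symm⟩
  have hsum : Summable fun i => v i - u i := by
    refine summable_of_sum_le (c := 1) (fun i => by have := (hends i).1.le; simp only [Pi.zero_apply]; linarith) fun s => ?_
    apply sum_length_le_one
    · exact fun i _ => (hends i).1.le
    · exact fun i _ => Icc_subset_Icc (hends i).2.2.2.1.1 (hends i).2.2.2.2.2
    · intro i _ j _ hij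
      rcases lt_or_gt_of_ne hij with hij | hij
      · exact (hdisj i j hij).mono (hends i).2.1 (hends j).2.1
      · exact ((hdisj j i hij).mono (hends j).2.1 (hends i).2.1).symm
  obtain ⟨hc0, hc1⟩ := hf.mem_Ioo
  set δ := min ε (min c (1 - c)) / 4 with hδ
  have hε' : 0 < min ε (min c (1 - c)) := lt_min hε (lt_min hc0 (by linarith))
  have hδ0 : 0 < δ := by positivity
  have hδε : 4 * δ ≤ ε := by rw [hδ]; linarith [min_le_left ε (min c (1 - c))]
  have hδc : 4 * δ ≤ c := by
    rw [hδ]; linarith [(min_le_right ε (min c (1 - c))).trans (min_le_left _ _)]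
  have hδc' : 4 * δ ≤ 1 - c := by
    rw [hδ]; linarith [(min_le_right ε (min c (1 - c))).trans (min_le_right _ _)]
  obtain ⟨i0, hi0⟩ := eventually_atTop.1
    (hsum.tendsto_atTop_zero.eventually (gt_mem_nhds (show (0 : ℝ) < 2 * δ by positivity)))
  have hfar : ∀ i ≥ i0, ∀ x ∈ S i, 2 * δ ≤ |x - c| := by
    intro i hi x hx
    have h1 : |m i - x| ≤ v i - u i :=
      abs_sub_le_of_mem_Icc ((hends i).2.2.1 (mem_of_mem_nhds (hSn i))) ((hends i).2.2.1 hx)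
    have h2 := hi0 i hi
    have h3 : ε ≤ |m i - c| := hcon i (m i) ⟨m0, hsub hm0, rfl⟩
    have h4 : |m i - c| ≤ |m i - x| + |x - c| := abs_sub_le _ _ _
    linarith
  have hfar' : ∀ r, ∀ x ∈ Icc (u i0) (v i0), 2 * δ ≤ |f^[r] x - c| := by
    intro r x hx
    have hcl : closure (Ioo (u i0) (v i0)) = Icc (u i0) (v i0) := closure_Ioo (hends i0).1.ne
    have hsub' : Icc (u i0) (v i0) ⊆ Icc 0 1 :=
      Icc_subset_Icc (hends i0).2.2.2.1.1 (hends i0).2.2.2.2.2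
    refine le_on_closure (s := Ioo (u i0) (v i0)) (f := fun _ => 2 * δ) (g := fun x => |f^[r] x - c|)
      (fun y hy => ?_) continuousOn_const ?_ (by rwa [hcl])
    · have h1 := h.mapsTo_criticalFreeHull (hm1 i0) r ((hends i0).2.1 hy)
      have h2 : f^[r] (m i0) = m (i0 + r) := by
        simp only [hm]; rw [← Function.iterate_add_apply, add_comm]
      rw [h2] at h1
      exact hfar (i0 + r) (by omega) _ h1
    · rw [hcl]
      exact (((h.iterate_continuousOn r).mono hsub').sub continuousOn_const).abs
  have hucc : c ∉ Icc (u i0) (v i0) := fun hc => by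
    have := hfar' 0 c hc
    simp at this; linarith
  obtain ⟨C1, hC1, hSD1⟩ := hf.exists_slopeDistortion (a := 0) (b := c - δ) (by linarith)
    (Icc_subset_Icc_right (by linarith)) (fun hc => by linarith [hc.2])
  obtain ⟨C2, hC2, hSD2⟩ := hf.exists_slopeDistortion (a := c + δ) (b := 1) (by linarith)
    (Icc_subset_Icc_left (by linarith)) (fun hc => by linarith [hc.1])
  have hSDmono : ∀ {S : Set ℝ} {C C' : ℝ}, C ≤ C' → SlopeDistortion f S C → SlopeDistortion f S C' := by
    intro S C C' hCC hS u v huv x hx y hy x' hx' y' hy'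
    refine (hS u v huv x hx y hy x' hx' y' hy').trans ?_
    have : 0 ≤ v - u := by linarith [hx.1, hx.2]
    gcongr
  have hsumr : ∀ R, ∑ r ∈ Finset.range R, |f^[r] (v i0) - f^[r] (u i0)| ≤ 1 := by
    intro R
    have hinjI : ∀ n, InjOn f^[n] (Icc (u i0) (v i0)) := fun n =>
      h.injOn_iterate_of_notMem ordConnected_Icc
        (Icc_subset_Icc (hends i0).2.2.2.1.1 (hends i0).2.2.2.2.2) n fun k _ hc => by
          obtain ⟨x, hx, hxc⟩ := hc
          have := hfar' k x hx
          rw [hxc] at this; simp at this; linarith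
    have himg := fun n => h.image_iterate_Ioo (n := n) (hends i0).1 (hends i0).2.2.2.1
      (hends i0).2.2.2.2 (hinjI n)
    have := sum_length_le_one (Finset.range R) (fun r => min (f^[r] (u i0)) (f^[r] (v i0)))
      (fun r => max (f^[r] (u i0)) (f^[r] (v i0))) (fun i _ => min_le_max)
      (fun i _ => IsTent.uIcc_subset (h.iterate_mapsTo i (hends i0).2.2.2.1)
        (h.iterate_mapsTo i (hends i0).2.2.2.2))
      (fun i _ j _ hij => by
        have := hHL i0 i j hij
        rwa [himg i, himg j] at this)
    simpa only [max_sub_min_eq_abs] using this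
  have hm_mem := hmuv i0
  rcases le_or_gt c (u i0) with hcu | hcu
  · obtain ⟨κ, hκ, hext⟩ := h.exists_extension hδ0 (hC1.trans (le_max_left C1 C2))
      (hSDmono (le_max_left C1 C2) hSD1) (hSDmono (le_max_right C1 C2) hSD2)
      (e₁ := v i0) (e₂ := u i0) (hends i0).2.2.2.2 (hends i0).1.ne'
      (by rw [uIcc_of_ge (hends i0).1.le]; exact hfar')
      (fun R => by simpa only [abs_sub_comm] using hsumr R)
    have hu0 : 0 < u i0 := by linarith
    set e := u i0 - min κ (u i0) with he
    have hmin : 0 < min κ (u i0) := lt_min hκ hu0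
    have he1 : e ∈ Icc (0 : ℝ) 1 :=
      ⟨by linarith [min_le_right κ (u i0)], by linarith [(hends i0).2.2.2.1.2]⟩
    have hc' := hext e he1 (mem_uIcc.2 (Or.inr ⟨by linarith, (hends i0).1.le⟩))
      (by rw [abs_of_nonpos (by linarith)]; linarith [min_le_left κ (u i0)])
    have heS : e ∈ S i0 := ⟨he1, fun r hc => hc' r (image_mono (by
      rw [uIcc_of_le (by linarith [hm_mem.1]), uIcc_of_ge (by linarith [(hends i0).1])]
      exact Icc_subset_Icc_right hm_mem.2.le) hc)⟩
    linarith [((hends i0).2.2.1 heS).1]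
  · have hvc : v i0 < c := by
      by_contra! h'
      exact hucc ⟨hcu.le, h'⟩
    obtain ⟨κ, hκ, hext⟩ := h.exists_extension hδ0 (hC1.trans (le_max_left C1 C2))
      (hSDmono (le_max_left C1 C2) hSD1) (hSDmono (le_max_right C1 C2) hSD2)
      (e₁ := u i0) (e₂ := v i0) (hends i0).2.2.2.1 (hends i0).1.ne
      (by rw [uIcc_of_le (hends i0).1.le]; exact hfar') hsumr
    set e := v i0 + min κ (1 - v i0) with he
    have hmin : 0 < min κ (1 - v i0) := lt_min hκ (by linarith)
    have he1 : e ∈ Icc (0 : ℝ) 1 :=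
      ⟨by linarith [(hends i0).2.2.2.2.1], by linarith [min_le_right κ (1 - v i0)]⟩
    have hc' := hext e he1 (mem_uIcc.2 (Or.inl ⟨(hends i0).1.le, by linarith⟩))
      (by rw [abs_of_nonneg (by linarith)]; linarith [min_le_left κ (1 - v i0)])
    have heS : e ∈ S i0 := ⟨he1, fun r hc => hc' r (image_mono (by
      rw [uIcc_of_ge (by linarith [hm_mem.2]), uIcc_of_le (by linarith [(hends i0).1])]
      exact Icc_subset_Icc_left hm_mem.1.le) hc)⟩
    linarith [((hends i0).2.2.1 heS).2]

/-! ### The sequence of images of a maximal wandering interval -/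

lemma csInf_csSup_of_Ioo_subset {S : Set ℝ} {a b : ℝ} (hab : a < b) (h1 : Ioo a b ⊆ S)
    (h2 : S ⊆ Icc a b) : sInf S = a ∧ sSup S = b := by
  have hne : (Ioo a b).Nonempty := nonempty_Ioo.2 hab
  constructor
  · apply le_antisymm
    · rw [← csInf_Ioo hab]
      exact csInf_le_csInf ⟨a, fun x hx => (h2 hx).1⟩ hne h1
    · exact le_csInf (hne.mono h1) fun x hx => (h2 hx).1
  · apply le_antisymm
    · exact csSup_le (hne.mono h1) fun x hx => (h2 hx).2
    · rw [← csSup_Ioo hab]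
      exact csSup_le_csSup ⟨b, fun x hx => (h2 hx).2⟩ hne h1

/-- Images `[A j, B j]` of an interval under the iterates of a unimodal map, as they arise from a
maximal wandering interval. -/
structure WanderingSequence (f : ℝ → ℝ) (c : ℝ) (A B : ℕ → ℝ) : Prop where
  lt : ∀ j, A j < B j
  left_mem : ∀ j, A j ∈ Icc (0 : ℝ) 1
  right_mem : ∀ j, B j ∈ Icc (0 : ℝ) 1
  lt_value : ∀ j, B j < f c
  notMem : ∀ j, c ∉ Icc (A j) (B j)
  image : ∀ j, f '' Icc (A j) (B j) = Icc (A (j + 1)) (B (j + 1))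
  disjoint : ∀ i j, i ≠ j → Disjoint (Ioo (A i) (B i)) (Ioo (A j) (B j))
  no_selfMap : ∀ u v p j, 1 ≤ p → Icc u v ⊆ Icc 0 1 → InjOn f^[p] (Icc u v) →
    MapsTo f^[p] (Icc u v) (Icc u v) → Disjoint (Ioo (A j) (B j)) (Icc u v)
  approach : ∀ ε > 0, ∃ j, f c - ε < B j
  left_free : ∃ N, ¬ InjOn f^[N] (Icc 0 (B 0))
  right_free : ∃ N, ¬ InjOn f^[N] (Icc (A 0) 1)
  side : (∀ δ > 0, ∃ N, ¬ InjOn f^[N] (Icc (A 0) (min 1 (B 0 + δ)))) ∨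
    (∀ δ > 0, ∃ N, ¬ InjOn f^[N] (Icc (max 0 (A 0 - δ)) (B 0)))

section

variable {f : ℝ → ℝ} {c ℓm ℓp : ℝ} {Q : Set ℝ}

lemma IsUnimodal.accumulates (hf : IsUnimodal 2 f c ℓm ℓp) (hmax : IsLocalMax f c)
    (hQ : IsWanderingInterval f Q) (N : ℕ) {ε : ℝ} (hε : 0 < ε) :
    ∃ j ≥ N, ∃ x ∈ f^[j] '' Q, |x - c| < ε ∧ x ≠ c := by
  have h := hf.isTent hmax
  have hQN := h.isWanderingInterval_iterate hQ N
  obtain ⟨j, x, hx, hxc⟩ := hf.not_avoids hmax hQN hε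
  rw [← image_comp, ← Function.iterate_add] at hx
  refine ⟨j + N, by omega, ?_⟩
  rcases eq_or_ne x c with rfl | hne
  · have hQj := h.isWanderingInterval_iterate hQ (j + N)
    obtain ⟨y, hy, hyx⟩ := hQj.nontrivial.exists_ne x
    set t := min (ε / 2) |y - x| with ht
    have ht0 : 0 < t := lt_min (by positivity) (abs_pos.2 (sub_ne_zero.2 hyx))
    have ht1 : t < ε := (min_le_left _ _).trans_lt (by linarith)
    have ht2 : t ≤ |y - x| := min_le_right _ _
    rcases lt_or_gt_of_ne hyx with hlt | hlt
    · rw [abs_of_neg (by linarith)] at ht2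
      refine ⟨x - t, hQj.ordConnected.out hy hx ⟨by linarith, by linarith⟩, ?_, by linarith⟩
      rw [abs_of_neg (by linarith)]; linarith
    · rw [abs_of_pos (by linarith)] at ht2
      refine ⟨x + t, hQj.ordConnected.out hx hy ⟨by linarith, by linarith⟩, ?_, by linarith⟩
      rw [abs_of_pos (by linarith)]; linarith
  · exact ⟨x, hx, hxc, hne⟩

lemma IsUnimodal.critical_notMem_closure (hf : IsUnimodal 2 f c ℓm ℓp) (hmax : IsLocalMax f c)
    (hQ : IsWanderingInterval f Q) (n : ℕ) : c ∉ closure (f^[n] '' Q) := by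
  intro hc
  have h := hf.isTent hmax
  have hQn := h.isWanderingInterval_iterate hQ n
  obtain ⟨x, hx, hxc⟩ := hQn.nontrivial.exists_ne c
  have hx1 := hQn.subset_Icc hx
  have hfx := h.lt hx1 hxc
  have hc1 : c ∈ Icc (0 : ℝ) 1 := Ioo_subset_Icc_self hf.mem_Ioo
  -- all values slightly below the maximum are taken on the image of the interval
  have hval : ∀ z, f x < z → z < f c → z ∈ f^[n + 1] '' Q := by
    intro z hz1 hz2
    obtain ⟨y, hy, hyz⟩ := intermediate_value_uIcc (h.continuousOn.mono (IsTent.uIcc_subset hx1 hc1))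
      (mem_uIcc.2 (Or.inl ⟨hz1.le, hz2.le⟩))
    have hyc : y ≠ c := by rintro rfl; linarith
    rw [Function.iterate_succ', image_comp]
    refine ⟨y, ?_, hyz⟩
    rw [Metric.mem_closure_iff] at hc
    obtain ⟨w, hw, hwy⟩ := hc |y - c| (abs_pos.2 (sub_ne_zero.2 hyc))
    rw [Real.dist_eq] at hwy
    rcases mem_uIcc.1 hy with ⟨h1, h2⟩ | ⟨h1, h2⟩
    · have h2' : y < c := lt_of_le_of_ne h2 hyc
      rw [abs_of_neg (a := y - c) (by linarith)] at hwy
      exact hQn.ordConnected.out hx hw ⟨h1, by linarith [(abs_lt.1 hwy).2]⟩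
    · have h2' : c < y := lt_of_le_of_ne h1 hyc.symm
      rw [abs_of_pos (a := y - c) (by linarith)] at hwy
      exact hQn.ordConnected.out hw hx ⟨by linarith [(abs_lt.1 hwy).1], h2⟩
  have hev : ∀ᶠ y in 𝓝[Icc 0 1] c, f x < f y := (h.continuousOn c hc1).eventually (lt_mem_nhds hfx)
  obtain ⟨ε, hε, hball⟩ := Metric.mem_nhdsWithin_iff.1 hev
  obtain ⟨j, hj, y, hy, hyc, hyc'⟩ := hf.accumulates hmax hQ (n + 1) hε
  have hy1 := (h.isWanderingInterval_iterate hQ j).subset_Icc hy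
  have h1 : f y ∈ f^[n + 1] '' Q := hval _ (hball ⟨hyc, hy1⟩) (h.lt hy1 hyc')
  have h2 : f y ∈ f^[j + 1] '' Q := by
    rw [Function.iterate_succ', image_comp]; exact ⟨y, hy, rfl⟩
  exact disjoint_left.1 (hQ.disjoint_images (i := n + 1) (j := j + 1) (by omega)) h1 h2

/-- The closed interval with the same endpoints as a wandering interval. -/
lemma IsUnimodal.iterate_ends (hf : IsUnimodal 2 f c ℓm ℓp) (hmax : IsLocalMax f c)
    (hQ : IsWanderingInterval f Q) (n : ℕ) :
    InjOn f^[n] (Icc (sInf Q) (sSup Q)) ∧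
    sInf (f^[n] '' Q) = min (f^[n] (sInf Q)) (f^[n] (sSup Q)) ∧
    sSup (f^[n] '' Q) = max (f^[n] (sInf Q)) (f^[n] (sSup Q)) ∧
    f^[n] '' Icc (sInf Q) (sSup Q) = Icc (sInf (f^[n] '' Q)) (sSup (f^[n] '' Q)) ∧
    c ∉ Icc (sInf (f^[n] '' Q)) (sSup (f^[n] '' Q)) := by
  have h := hf.isTent hmax
  obtain ⟨h1, h2, h3, h4, h5⟩ := hQ.ordConnected.ends hQ.nontrivial hQ.subset_Icc
  have hcl : ∀ n, c ∉ Icc (sInf (f^[n] '' Q)) (sSup (f^[n] '' Q)) := by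
    intro n hc
    have hQn := h.isWanderingInterval_iterate hQ n
    obtain ⟨g1, g2, -⟩ := hQn.ordConnected.ends hQn.nontrivial hQn.subset_Icc
    rw [← closure_Ioo g1.ne] at hc
    exact hf.critical_notMem_closure hmax hQ n (closure_mono g2 hc)
  have key : ∀ n, InjOn f^[n] (Icc (sInf Q) (sSup Q)) → 
      sInf (f^[n] '' Q) = min (f^[n] (sInf Q)) (f^[n] (sSup Q)) ∧
      sSup (f^[n] '' Q) = max (f^[n] (sInf Q)) (f^[n] (sSup Q)) ∧
      f^[n] '' Icc (sInf Q) (sSup Q) = Icc (sInf (f^[n] '' Q)) (sSup (f^[n] '' Q)) := by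
    intro n hinj
    have i1 := h.image_iterate_Ioo h1 h4 h5 hinj
    have i2 := h.image_iterate_uIcc h4 h5 (by rwa [uIcc_of_le h1.le] : InjOn f^[n] (uIcc _ _))
    rw [uIcc_of_le h1.le] at i2
    have hne : f^[n] (sInf Q) ≠ f^[n] (sSup Q) := fun he =>
      h1.ne (hinj ⟨le_rfl, h1.le⟩ ⟨h1.le, le_rfl⟩ he)
    obtain ⟨e1, e2⟩ := csInf_csSup_of_Ioo_subset (min_lt_max.2 hne)
      (i1 ▸ image_mono h2 : Ioo _ _ ⊆ f^[n] '' Q) (by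
        have := image_mono (f := f^[n]) h3
        rw [i2] at this; exact this)
    exact ⟨e1, e2, by rw [e1, e2, i2]; rfl⟩
  have hinj : ∀ n, InjOn f^[n] (Icc (sInf Q) (sSup Q)) := by
    intro n
    induction n with
    | zero => exact Function.injective_id.injOn
    | succ n ih =>
      rw [Function.iterate_succ']
      refine InjOn.comp (t := f^[n] '' Icc (sInf Q) (sSup Q)) ?_ ih (mapsTo_image _ _)
      have hQn := h.isWanderingInterval_iterate hQ n
      obtain ⟨-, -, -, g4, g5⟩ := hQn.ordConnected.ends hQn.nontrivial hQn.subset_Icc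
      rw [(key n ih).2.2]
      exact h.injOn_of_subset (IsTent.subset_of_notMem ordConnected_Icc
        (Icc_subset_Icc g4.1 g5.2) (hcl n))
  exact ⟨hinj n, (key n (hinj n)).1, (key n (hinj n)).2.1, (key n (hinj n)).2.2, hcl n⟩

lemma IsTent.image_Ioo_mem_nhds (h : IsTent f c) {u v : ℝ} (hsub : Ioo u v ⊆ Icc 0 1) {n : ℕ}
    (hi : InjOn f^[n] (Ioo u v)) {x : ℝ} (hx : x ∈ Ioo u v) : f^[n] '' Ioo u v ∈ 𝓝 (f^[n] x) := by
  obtain ⟨u', hu⟩ := exists_between hx.1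
  obtain ⟨v', hv⟩ := exists_between hx.2
  have hI : Icc u' v' ⊆ Ioo u v := Icc_subset_Ioo hu.1 hv.2
  have huv : u' < v' := hu.2.trans hv.1
  have himg := h.image_iterate_Ioo (n := n) huv (hsub (hI ⟨le_rfl, huv.le⟩))
    (hsub (hI ⟨huv.le, le_rfl⟩)) (hi.mono hI)
  have : f^[n] '' Ioo u' v' ∈ 𝓝 (f^[n] x) := by
    rw [himg]
    refine isOpen_Ioo.mem_nhds ?_
    rw [← himg]
    exact mem_image_of_mem _ ⟨hu.2, hv.1⟩
  exact mem_of_superset this (image_mono (Ioo_subset_Icc_self.trans hI))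

/-- A maximal wandering interval cannot be enlarged to an interval on which all iterates are
injective. -/
lemma IsUnimodal.not_injOn_of_maximal (hf : IsUnimodal 2 f c ℓm ℓp) (hmax : IsLocalMax f c)
    (hQ : IsMaximalWanderingInterval f Q) {u v : ℝ} (hu : 0 ≤ u) (hv : v ≤ 1) (hu' : u ≤ sInf Q)
    (hv' : sSup Q ≤ v) (hne : u < sInf Q ∨ sSup Q < v) : ∃ n, ¬ InjOn f^[n] (Icc u v) := by
  have h := hf.isTent hmax
  by_contra! hcon
  have hW := hQ.1
  obtain ⟨h1, h2, h3, h4, h5⟩ := hW.ordConnected.ends hW.nontrivial hW.subset_Icc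
  have huv : u < v := by linarith
  have hsub : Ioo u v ⊆ Icc 0 1 := Ioo_subset_Icc_self.trans (Icc_subset_Icc hu hv)
  have hi : ∀ n, InjOn f^[n] (Ioo u v) := fun n => (hcon n).mono Ioo_subset_Icc_self
  obtain ⟨q, hq⟩ := exists_between h1
  have hqQ : q ∈ Q := h2 hq
  have hqW : q ∈ Ioo u v := ⟨by linarith [hq.1], by linarith [hq.2]⟩
  have hHL : ∀ m n, m ≠ n → Disjoint (f^[m] '' Ioo u v) (f^[n] '' Ioo u v) := fun m n hmn =>
    h.disjoint_images_of_injOn hsub hi hqW (hW.not_periodic q hqQ) hmn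
  have hmixed : ∀ m n, m ≠ n → ∀ x ∈ Icc u v, ∀ y ∈ Ioo u v, f^[m] x ≠ f^[n] y := by
    intro m n hmn x hx y hy hxy
    have hnh := h.image_Ioo_mem_nhds hsub (hi n) hy
    rw [← hxy] at hnh
    have hcl : x ∈ closure (Ioo u v) := by rwa [closure_Ioo huv.ne]
    have hx1 : x ∈ Icc (0 : ℝ) 1 := Icc_subset_Icc hu hv hx
    have ht := ((h.iterate_continuousOn m) x hx1).mono hsub hnh
    have : (𝓝[Ioo u v] x).NeBot := mem_closure_iff_nhdsWithin_neBot.1 hcl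
    have ht' : f^[m] ⁻¹' (f^[n] '' Ioo u v) ∈ 𝓝[Ioo u v] x := ht
    obtain ⟨z, hz, hz'⟩ := Filter.nonempty_of_mem (inter_mem ht' self_mem_nhdsWithin)
    exact disjoint_left.1 (hHL m n hmn) ⟨z, hz', rfl⟩ hz
  have hQuv : Q ⊆ Icc u v := h3.trans (Icc_subset_Icc hu' hv')
  refine hQ.2 (Q ∪ Ioo u v) ⟨union_subset hW.subset_Icc hsub, ?_, hW.nontrivial.mono subset_union_left,
    ?_, ?_⟩ ⟨subset_union_left, fun hss => ?_⟩
  · exact (IsPreconnected.union q hqQ hqW hW.ordConnected.isPreconnected isPreconnected_Ioo).ordConnected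
  · intro m n hmn
    refine disjoint_left.2 ?_
    rintro _ ⟨x, hx, rfl⟩ ⟨y, hy, hxy⟩
    rcases hx with hx | hx
    · rcases hy with hy | hy
      · exact disjoint_left.1 (hW.disjoint_images hmn) ⟨x, hx, rfl⟩ ⟨y, hy, hxy⟩
      · exact hmixed m n hmn x (hQuv hx) y hy hxy.symm
    · have hy' : y ∈ Icc u v := by
        rcases hy with hy | hy
        · exact hQuv hy
        · exact Ioo_subset_Icc_self hy
      exact hmixed n m hmn.symm y hy' x hx hxy
  · rintro x (hx | hx)
    · exact hW.not_periodic x hx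
    · rw [omegaSet_eq_of_asymptotic (h.tendsto_sub_of_disjoint hsub hi hHL hx hqW)]
      exact hW.not_periodic q hqQ
  · rcases hne with hne | hne
    · obtain ⟨x, hx⟩ := exists_between hne
      have := h3 (hss (Or.inr ⟨hx.1, by linarith⟩))
      linarith [this.1]
    · obtain ⟨x, hx⟩ := exists_between hne
      have := h3 (hss (Or.inr ⟨by linarith, hx.2⟩))
      linarith [this.2]

lemma IsUnimodal.eventually_boundary_free (hf : IsUnimodal 2 f c ℓm ℓp) (hmax : IsLocalMax f c)
    (hQ : IsWanderingInterval f Q) :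
    ∃ M, ∀ m ≥ M, (∃ N, ¬ InjOn f^[N] (Icc 0 (sSup (f^[m] '' Q)))) ∧
      ∃ N, ¬ InjOn f^[N] (Icc (sInf (f^[m] '' Q)) 1) := by
  have h := hf.isTent hmax
  have hends := fun m => (h.isWanderingInterval_iterate hQ m).ordConnected.ends
    (h.isWanderingInterval_iterate hQ m).nontrivial (h.isWanderingInterval_iterate hQ m).subset_Icc
  have key : ∀ m m' u v, m < m' → Ioo u v ⊆ Icc 0 1 → (∀ N, InjOn f^[N] (Ioo u v)) →
      Ioo (sInf (f^[m] '' Q)) (sSup (f^[m] '' Q)) ⊆ Ioo u v →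
      Ioo (sInf (f^[m'] '' Q)) (sSup (f^[m'] '' Q)) ⊆ Ioo u v → False := by
    intro m m' u v hmm hsub hi hm hm'
    obtain ⟨q, hq⟩ := exists_between (hends m).1
    have hqQ := (hends m).2.1 hq
    have hd := h.disjoint_images_of_injOn hsub hi (hm hq)
      ((h.isWanderingInterval_iterate hQ m).not_periodic q hqQ) (m := 0) (n := m' - m) (by omega)
    have hnh := h.image_Ioo_mem_nhds (Ioo_subset_Icc_self.trans
      (Icc_subset_Icc (hends m).2.2.2.1.1 (hends m).2.2.2.2.2)) ((hi (m' - m)).mono hm) hq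
    have hq' : f^[m' - m] q ∈ Ioo (sInf (f^[m'] '' Q)) (sSup (f^[m'] '' Q)) := by
      apply mem_Ioo_ends_of_mem_nhds (h.isWanderingInterval_iterate hQ m').subset_Icc
      refine mem_of_superset hnh ?_
      refine (image_mono (hends m).2.1).trans ?_
      rw [← image_comp, ← Function.iterate_add, Nat.sub_add_cancel hmm.le]
    exact disjoint_left.1 hd (by simpa using hm' hq') ⟨q, hm hq, rfl⟩
  have hL : ∀ m m', m < m' → (∀ N, InjOn f^[N] (Icc 0 (sSup (f^[m] '' Q)))) →
      (∀ N, InjOn f^[N] (Icc 0 (sSup (f^[m'] '' Q)))) → False := by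
    intro m m' hmm h1 h2
    rcases le_total (sSup (f^[m] '' Q)) (sSup (f^[m'] '' Q)) with hle | hle
    · exact key m m' 0 (sSup (f^[m'] '' Q)) hmm
        (Ioo_subset_Icc_self.trans (Icc_subset_Icc_right (hends m').2.2.2.2.2))
        (fun N => (h2 N).mono Ioo_subset_Icc_self) (Ioo_subset_Ioo (hends m).2.2.2.1.1 hle)
        (Ioo_subset_Ioo_left (hends m').2.2.2.1.1)
    · exact key m m' 0 (sSup (f^[m] '' Q)) hmm
        (Ioo_subset_Icc_self.trans (Icc_subset_Icc_right (hends m).2.2.2.2.2))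
        (fun N => (h1 N).mono Ioo_subset_Icc_self) (Ioo_subset_Ioo_left (hends m).2.2.2.1.1)
        (Ioo_subset_Ioo (hends m').2.2.2.1.1 hle)
  have hR : ∀ m m', m < m' → (∀ N, InjOn f^[N] (Icc (sInf (f^[m] '' Q)) 1)) →
      (∀ N, InjOn f^[N] (Icc (sInf (f^[m'] '' Q)) 1)) → False := by
    intro m m' hmm h1 h2
    rcases le_total (sInf (f^[m] '' Q)) (sInf (f^[m'] '' Q)) with hle | hle
    · exact key m m' (sInf (f^[m] '' Q)) 1 hmm
        (Ioo_subset_Icc_self.trans (Icc_subset_Icc_left (hends m).2.2.2.1.1))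
        (fun N => (h1 N).mono Ioo_subset_Icc_self) (Ioo_subset_Ioo_right (hends m).2.2.2.2.2)
        (Ioo_subset_Ioo hle (hends m').2.2.2.2.2)
    · exact key m m' (sInf (f^[m'] '' Q)) 1 hmm
        (Ioo_subset_Icc_self.trans (Icc_subset_Icc_left (hends m').2.2.2.1.1))
        (fun N => (h2 N).mono Ioo_subset_Icc_self) (Ioo_subset_Ioo hle (hends m).2.2.2.2.2)
        (Ioo_subset_Ioo_right (hends m').2.2.2.2.2)
  have hev : ∀ P : ℕ → Prop, (∀ m m', m < m' → P m → P m' → False) → ∃ M, ∀ m ≥ M, ¬ P m := by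
    intro P hP
    by_cases hex : ∃ m, P m
    · obtain ⟨m, hm⟩ := hex
      exact ⟨m + 1, fun m' hm' hp => hP m m' (by omega) hm hp⟩
    · exact ⟨0, fun m _ hm => hex ⟨m, hm⟩⟩
  obtain ⟨M1, hM1⟩ := hev _ hL
  obtain ⟨M2, hM2⟩ := hev _ hR
  exact ⟨max M1 M2, fun m hm => ⟨not_forall.1 (hM1 m (le_of_max_le_left hm)),
    not_forall.1 (hM2 m (le_of_max_le_right hm))⟩⟩

lemma IsUnimodal.exists_side (hf : IsUnimodal 2 f c ℓm ℓp) (hmax : IsLocalMax f c)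
    (hQ : IsMaximalWanderingInterval f Q) (m : ℕ) :
    (∀ δ > 0, ∃ N, ¬ InjOn f^[N] (Icc (sInf (f^[m] '' Q)) (min 1 (sSup (f^[m] '' Q) + δ)))) ∨
    (∀ δ > 0, ∃ N, ¬ InjOn f^[N] (Icc (max 0 (sInf (f^[m] '' Q) - δ)) (sSup (f^[m] '' Q)))) := by
  have h := hf.isTent hmax
  by_contra! hcon
  obtain ⟨⟨δ₁, hδ₁, hi₁⟩, ⟨δ₂, hδ₂, hi₂⟩⟩ := hcon
  have hW := hQ.1
  obtain ⟨h1, -, -, h4, h5⟩ := hW.ordConnected.ends hW.nontrivial hW.subset_Icc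
  have hcn := (hf.iterate_ends hmax hW 0).2.2.2.2
  simp only [Function.iterate_zero, image_id] at hcn
  have hc := hf.mem_Ioo
  obtain ⟨hinj, e1, e2, e3, -⟩ := hf.iterate_ends hmax hW m
  have key : ∀ p q : ℝ, ((p = sInf Q ∧ q = sSup Q) ∨ (p = sSup Q ∧ q = sInf Q)) → q ∈ Ioo (0 : ℝ) 1 →
      False := by
    intro p q hpq hq
    have hpqne : q - p ≠ 0 := by
      rcases hpq with ⟨rfl, rfl⟩ | ⟨rfl, rfl⟩ <;> [(have := h1; intro h0; linarith);
        (have := h1; intro h0; linarith)]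
    have hpI : p ∈ Icc (0 : ℝ) 1 := by rcases hpq with ⟨rfl, rfl⟩ | ⟨rfl, rfl⟩ <;> assumption
    have hqI : q ∈ Icc (0 : ℝ) 1 := Ioo_subset_Icc_self hq
    have hpqI : uIcc p q = Icc (sInf Q) (sSup Q) := by
      rcases hpq with ⟨rfl, rfl⟩ | ⟨rfl, rfl⟩
      · exact uIcc_of_le h1.le
      · exact uIcc_of_ge h1.le
    have hmpq : uIcc (f^[m] p) (f^[m] q) = Icc (sInf (f^[m] '' Q)) (sSup (f^[m] '' Q)) := by
      rw [e1, e2]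
      rcases hpq with ⟨rfl, rfl⟩ | ⟨rfl, rfl⟩
      · rfl
      · rw [uIcc_comm]; rfl
    -- choose a small extension beyond `q`
    have hev : ∀ᶠ x in 𝓝[Icc 0 1] q, (∀ i ∈ Finset.range m, f^[i] x ≠ c) ∧
        |f^[m] x - f^[m] q| < min δ₁ δ₂ := by
      refine Eventually.and ?_ ?_
      · rw [eventually_all_finset]
        intro i _
        refine ((h.iterate_continuousOn i) q hqI).eventually_ne ?_
        intro hqc
        refine (hf.iterate_ends hmax hW i).2.2.2.2 ?_
        rw [← (hf.iterate_ends hmax hW i).2.2.2.1, ← hqc]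
        exact mem_image_of_mem _ (hpqI ▸ right_mem_uIcc)
      · exact ((h.iterate_continuousOn m) q hqI).eventually
          (Metric.ball_mem_nhds _ (lt_min hδ₁ hδ₂))
    obtain ⟨η, hη, hball⟩ := Metric.mem_nhdsWithin_iff.1 hev
    obtain ⟨t, ht0, ht1, ht2⟩ : ∃ t : ℝ, 0 < t ∧ t * |q - p| < η ∧ q + t * (q - p) ∈ Icc (0 : ℝ) 1 := by
      have c1 : ∀ᶠ t : ℝ in 𝓝 0, t * |q - p| < η :=
        (Continuous.tendsto' (by fun_prop) 0 0 (by simp)).eventually (gt_mem_nhds hη)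
      have c2 : ∀ᶠ t : ℝ in 𝓝 0, q + t * (q - p) ∈ Icc (0 : ℝ) 1 :=
        (Continuous.tendsto' (by fun_prop) 0 q (by simp)).eventually (Icc_mem_nhds hq.1 hq.2)
      obtain ⟨t, ⟨g1, g2⟩, g3⟩ := (((c1.and c2).filter_mono nhdsWithin_le_nhds).and
        (self_mem_nhdsWithin (s := Ioi (0 : ℝ)))).exists
      exact ⟨t, g3, g1, g2⟩
    set e := q + t * (q - p) with he
    have hqe : q ∈ uIcc p e := by
      rw [mem_uIcc]
      rcases lt_or_gt_of_ne hpqne with h0 | h0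
      · right
        have : t * (q - p) < 0 := mul_neg_of_pos_of_neg ht0 h0
        exact ⟨by linarith, by linarith⟩
      · left
        have : 0 < t * (q - p) := mul_pos ht0 h0
        exact ⟨by linarith, by linarith⟩
    have hsm : ∀ x ∈ uIcc q e, (∀ i ∈ Finset.range m, f^[i] x ≠ c) ∧
        |f^[m] x - f^[m] q| < min δ₁ δ₂ := by
      intro x hx
      refine hball ⟨?_, IsTent.uIcc_subset hqI ht2 hx⟩
      have : |x - q| ≤ |e - q| := abs_sub_left_of_mem_uIcc hx
      rw [Metric.mem_ball, Real.dist_eq]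
      refine this.trans_lt ?_
      rw [he, add_sub_cancel_left, abs_mul, abs_of_pos ht0]
      exact ht1
    have hinje : InjOn f^[m] (uIcc p e) := by
      refine h.injOn_iterate_of_notMem ordConnected_uIcc (IsTent.uIcc_subset hpI ht2) m ?_
      rintro i hi ⟨x, hx, hxc⟩
      rcases uIcc_subset_uIcc_union_uIcc (b := q) hx with hx | hx
      · refine (hf.iterate_ends hmax hW i).2.2.2.2 ?_
        rw [← (hf.iterate_ends hmax hW i).2.2.2.1, ← hxc]
        exact mem_image_of_mem _ (hpqI ▸ hx)
      · exact (hsm x hx).1 i (Finset.mem_range.2 hi) hxc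
    have himg := h.image_iterate_uIcc hpI ht2 hinje
    have hmid : f^[m] q ∈ uIcc (f^[m] p) (f^[m] e) := himg ▸ mem_image_of_mem _ hqe
    have hclose := (hsm e right_mem_uIcc).2
    have heI := h.iterate_mapsTo m ht2
    have hall : ∀ N, InjOn f^[N] (uIcc (f^[m] p) (f^[m] e)) := by
      intro N
      have b1 := hclose.trans_le (min_le_left _ _)
      have b2 := hclose.trans_le (min_le_right _ _)
      rw [abs_lt] at b1 b2
      have bA : sInf (f^[m] '' Q) = min (f^[m] p) (f^[m] q) := by
        rcases hpq with ⟨rfl, rfl⟩ | ⟨rfl, rfl⟩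
        · exact e1
        · rw [e1, min_comm]
      have bB : sSup (f^[m] '' Q) = max (f^[m] p) (f^[m] q) := by
        rcases hpq with ⟨rfl, rfl⟩ | ⟨rfl, rfl⟩
        · exact e2
        · rw [e2, max_comm]
      rcases mem_uIcc.1 hmid with ⟨g1, g2⟩ | ⟨g1, g2⟩
      · refine (hi₁ N).mono ?_
        rw [uIcc_of_le (g1.trans g2), bA, bB, min_eq_left g1, max_eq_right g1]
        exact Icc_subset_Icc_right (le_min heI.2 (by linarith))
      · refine (hi₂ N).mono ?_
        rw [uIcc_of_ge (g1.trans g2), bA, bB, min_eq_right g2, max_eq_left g2]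
        exact Icc_subset_Icc_left (max_le heI.1 (by linarith))
    have hall' : ∀ n, InjOn f^[n] (uIcc p e) := by
      intro n
      refine IsTent.injOn_iterate_of_le (n := n + m) (by omega) ?_
      rw [Function.iterate_add]
      refine InjOn.comp (t := f^[m] '' uIcc p e) ?_ hinje (mapsTo_image _ _)
      rw [himg]; exact hall n
    rcases hpq with ⟨rfl, rfl⟩ | ⟨rfl, rfl⟩
    · have hlt : sSup Q < e := by
        have : 0 < t * (sSup Q - sInf Q) := mul_pos ht0 (by linarith)
        linarith
      rw [uIcc_of_le (by linarith)] at hall'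
      obtain ⟨n, hn⟩ := hf.not_injOn_of_maximal hmax hQ h4.1 ht2.2 le_rfl hlt.le (Or.inr hlt)
      exact hn (hall' n)
    · have hlt : e < sInf Q := by
        have : 0 < t * (sSup Q - sInf Q) := mul_pos ht0 (by linarith)
        linarith
      rw [uIcc_of_ge (by linarith)] at hall'
      obtain ⟨n, hn⟩ := hf.not_injOn_of_maximal hmax hQ ht2.1 h5.2 hlt.le le_rfl (Or.inl hlt)
      exact hn (hall' n)
  rcases lt_or_ge (sSup Q) c with hB | hB
  · exact key _ _ (Or.inl ⟨rfl, rfl⟩) ⟨by linarith [h4.1], by linarith [hc.2]⟩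
  · have hA : c < sInf Q := by
      by_contra! h'
      exact hcn ⟨h', hB⟩
    exact key _ _ (Or.inr ⟨rfl, rfl⟩) ⟨by linarith [hc.1], by linarith [h5.2]⟩

lemma IsUnimodal.sSup_lt_value (hf : IsUnimodal 2 f c ℓm ℓp) (hmax : IsLocalMax f c)
    (hQ : IsWanderingInterval f Q) (n : ℕ) : sSup (f^[n + 1] '' Q) < f c := by
  have h := hf.isTent hmax
  have hQn := h.isWanderingInterval_iterate hQ n
  obtain ⟨h1, -, -, h4, h5⟩ := hQn.ordConnected.ends hQn.nontrivial hQn.subset_Icc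
  have hcn := (hf.iterate_ends hmax hQ n).2.2.2.2
  have := (hf.iterate_ends hmax hQn 1).2.2.1
  rw [← image_comp, ← Function.iterate_add, add_comm 1 n] at this
  rw [this]
  refine max_lt (h.lt h4 ?_) (h.lt h5 ?_)
  · intro he; exact hcn ⟨he.le, he ▸ h1.le⟩
  · intro he; exact hcn ⟨he ▸ h1.le, he.ge⟩

lemma IsUnimodal.exists_approach (hf : IsUnimodal 2 f c ℓm ℓp) (hmax : IsLocalMax f c)
    (hQ : IsWanderingInterval f Q) (m : ℕ) {ε : ℝ} (hε : 0 < ε) :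
    ∃ j ≥ m, f c - ε < sSup (f^[j] '' Q) := by
  have h := hf.isTent hmax
  have hc1 : c ∈ Icc (0 : ℝ) 1 := Ioo_subset_Icc_self hf.mem_Ioo
  have hev : ∀ᶠ y in 𝓝[Icc 0 1] c, f c - ε < f y :=
    (h.continuousOn c hc1).eventually (lt_mem_nhds (by linarith))
  obtain ⟨η, hη, hball⟩ := Metric.mem_nhdsWithin_iff.1 hev
  obtain ⟨j, hj, y, hy, hyc, -⟩ := hf.accumulates hmax hQ m hη
  have hy1 := (h.isWanderingInterval_iterate hQ j).subset_Icc hy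
  refine ⟨j + 1, by omega, (hball ⟨hyc, hy1⟩).trans_le ?_⟩
  refine le_csSup ⟨1, fun x hx => ((h.isWanderingInterval_iterate hQ (j + 1)).subset_Icc hx).2⟩ ?_
  rw [Function.iterate_succ', image_comp]
  exact ⟨y, hy, rfl⟩

theorem IsUnimodal.exists_wanderingSequence (hf : IsUnimodal 2 f c ℓm ℓp) (hmax : IsLocalMax f c)
    (hQ : IsMaximalWanderingInterval f Q) :
    ∃ m, 1 ≤ m ∧ WanderingSequence f c (fun j => sInf (f^[m + j] '' Q))
      (fun j => sSup (f^[m + j] '' Q)) := by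
  have h := hf.isTent hmax
  have hW := hQ.1
  obtain ⟨M, hM⟩ := hf.eventually_boundary_free hmax hW
  refine ⟨M + 1, by omega, ?_⟩
  have hWn := fun n => h.isWanderingInterval_iterate hW n
  have hends := fun n => (hWn n).ordConnected.ends (hWn n).nontrivial (hWn n).subset_Icc
  exact {
    lt := fun j => (hends _).1
    left_mem := fun j => (hends _).2.2.2.1
    right_mem := fun j => (hends _).2.2.2.2
    lt_value := fun j => by
      have := hf.sSup_lt_value hmax hW (M + j)
      rwa [show M + 1 + j = M + j + 1 by omega]
    notMem := fun j => (hf.iterate_ends hmax hW _).2.2.2.2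
    image := fun j => by
      have := (hf.iterate_ends hmax (hWn (M + 1 + j)) 1).2.2.2.1
      rw [← image_comp, ← Function.iterate_add, add_comm 1 (M + 1 + j)] at this
      exact this
    disjoint := fun i j hij =>
      (hW.disjoint_images (i := M + 1 + i) (j := M + 1 + j) (by omega)).mono
        (hends _).2.1 (hends _).2.1
    no_selfMap := fun u v p j hp hsub hinj hmaps => by
      rw [disjoint_left]
      intro x hx hxI
      exact (hWn _).not_periodic x ((hends _).2.1 hx)
        (h.isPeriodicOrbit_of_mapsTo ordConnected_Icc hsub hp hinj hmaps hxI)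
    approach := fun ε hε => by
      obtain ⟨j, hj, hj'⟩ := hf.exists_approach hmax hW (M + 1) hε
      exact ⟨j - (M + 1), by rwa [Nat.add_sub_cancel' hj]⟩
    left_free := (hM (M + 1) (by omega)).1
    right_free := (hM (M + 1) (by omega)).2
    side := hf.exists_side hmax hQ (M + 1) }

end

/-! ### Closest return moments -/

section

variable {f : ℝ → ℝ} {c ℓm ℓp : ℝ} {Q : Set ℝ}

lemma infDist_image_eq (h : IsTent f c) (hQ : IsWanderingInterval f Q) {n : ℕ}
    (hn : sSup (f^[n] '' Q) < f c) :
    Metric.infDist (f c) (f^[n] '' Q) = f c - sSup (f^[n] '' Q) := by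
  have hQn := h.isWanderingInterval_iterate hQ n
  obtain ⟨h1, h2, h3, -, -⟩ := hQn.ordConnected.ends hQn.nontrivial hQn.subset_Icc
  have hne := hQn.nontrivial.nonempty
  apply le_antisymm
  · refine le_of_forall_pos_le_add fun ε hε => ?_
    obtain ⟨x, hx⟩ := exists_between (max_lt h1 (by linarith : sSup (f^[n] '' Q) - ε < sSup (f^[n] '' Q)))
    have hx' := max_lt_iff.1 hx.1
    have := Metric.infDist_le_dist_of_mem (x := f c) (h2 ⟨hx'.1, hx.2⟩)
    rw [Real.dist_eq, abs_of_pos (by linarith [hx.2])] at this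
    linarith [hx'.2]
  · rw [Metric.le_infDist hne]
    intro y hy
    rw [Real.dist_eq]
    exact le_trans (by linarith [(h3 hy).2]) (le_abs_self _)

lemma infDist_image_pos (hf : IsUnimodal 2 f c ℓm ℓp) (hmax : IsLocalMax f c)
    (hQ : IsWanderingInterval f Q) (hc : f c ∉ closure Q) (n : ℕ) :
    0 < Metric.infDist (f c) (f^[n] '' Q) := by
  cases n with
  | zero =>
    rw [Function.iterate_zero, image_id]
    exact (Metric.infDist_pos_iff_notMem_closure hQ.nontrivial.nonempty).1 hc
  | succ n =>
    have := hf.sSup_lt_value hmax hQ n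
    rw [infDist_image_eq (hf.isTent hmax) hQ this]
    linarith

theorem infinite_closestReturnMoment (hf : IsUnimodal 2 f c ℓm ℓp) (hmax : IsLocalMax f c)
    (hQ : IsWanderingInterval f Q) (hc : f c ∉ closure Q) :
    {n : ℕ | IsClosestReturnMoment f c Q n}.Infinite := by
  intro hfin
  obtain ⟨M, hM⟩ := hfin.bddAbove
  obtain ⟨j₀, hj₀, hmin⟩ := (Finset.range (M + 1)).exists_min_image
    (fun j => Metric.infDist (f c) (f^[j] '' Q)) ⟨0, by simp⟩
  set ε := Metric.infDist (f c) (f^[j₀] '' Q) with hε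
  have hε0 : 0 < ε := infDist_image_pos hf hmax hQ hc j₀
  have hex : ∃ j, Metric.infDist (f c) (f^[j] '' Q) < ε := by
    obtain ⟨j, hj, hj'⟩ := hf.exists_approach hmax hQ 1 hε0
    obtain ⟨i, rfl⟩ := Nat.exists_eq_add_of_le' hj
    refine ⟨i + 1, ?_⟩
    rw [infDist_image_eq (hf.isTent hmax) hQ (hf.sSup_lt_value hmax hQ i)]
    linarith
  classical
  have h1 := Nat.find_spec hex
  have h2 : M < Nat.find hex := by
    by_contra! hle
    exact absurd (hmin _ (Finset.mem_range.2 (by omega))) (not_le.2 h1)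
  have h3 := hM (show IsClosestReturnMoment f c Q (Nat.find hex) from
    ⟨by omega, fun k hk => h1.trans_le (not_lt.1 (Nat.find_min hex hk))⟩)
  omega

lemma closestMoment_strictMono (hinf : {n : ℕ | IsClosestReturnMoment f c Q n}.Infinite) :
    StrictMono (closestMoment f c Q) := by
  refine strictMono_nat_of_lt_succ fun k => ?_
  cases k with
  | zero => exact (Nat.nth_mem_of_infinite hinf 0).1
  | succ k => exact Nat.nth_strictMono hinf (Nat.lt_succ_self k)

lemma infDist_closestMoment_lt (hinf : {n : ℕ | IsClosestReturnMoment f c Q n}.Infinite) (k : ℕ) {j : ℕ}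
    (hj : j < closestMoment f c Q k) :
    Metric.infDist (f c) (f^[closestMoment f c Q k] '' Q) < Metric.infDist (f c) (f^[j] '' Q) := by
  cases k with
  | zero => exact absurd hj (Nat.not_lt_zero j)
  | succ k => exact (Nat.nth_mem_of_infinite hinf k).2 j hj

lemma infDist_closestMoment_le (hinf : {n : ℕ | IsClosestReturnMoment f c Q n}.Infinite) (k : ℕ) {j : ℕ}
    (hj : j < closestMoment f c Q (k + 1)) :
    Metric.infDist (f c) (f^[closestMoment f c Q k] '' Q) ≤ Metric.infDist (f c) (f^[j] '' Q) := by
  by_contra! hlt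
  classical
  have hex : ∃ j, Metric.infDist (f c) (f^[j] '' Q) <
    Metric.infDist (f c) (f^[closestMoment f c Q k] '' Q) := ⟨j, hlt⟩
  have h1 := Nat.find_spec hex
  have h2 : Nat.find hex ≤ j := Nat.find_min' hex hlt
  have h3 : closestMoment f c Q k < Nat.find hex := by
    by_contra! hle
    rcases hle.eq_or_lt with he | hl
    · rw [he] at h1; exact lt_irrefl _ h1
    · exact lt_asymm h1 (infDist_closestMoment_lt hinf k hl)
  have h4 : IsClosestReturnMoment f c Q (Nat.find hex) :=
    ⟨by omega, fun i hi => h1.trans_le (not_lt.1 (Nat.find_min hex hi))⟩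
  have h5 : closestMoment f c Q (Nat.count (IsClosestReturnMoment f c Q) (Nat.find hex) + 1) =
    Nat.find hex := Nat.nth_count h4
  have hmono := closestMoment_strictMono hinf
  rw [← h5] at h3
  have h6 := hmono.lt_iff_lt.1 h3
  have h7 : closestMoment f c Q (Nat.count (IsClosestReturnMoment f c Q) (Nat.find hex) + 1) <
    closestMoment f c Q (k + 1) := by rw [h5]; omega
  have h8 := hmono.lt_iff_lt.1 h7
  omega

/-- `σ ≥ 1` and `n > σ` are consecutive record times of the sequence `B`. -/
structure ConsecutiveRecords (B : ℕ → ℝ) (σ n : ℕ) : Prop where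
  one_le : 1 ≤ σ
  lt : σ < n
  le : ∀ j < n, B j ≤ B σ
  lt_right : B σ < B n

lemma consecutiveRecords_closestMoment (hf : IsUnimodal 2 f c ℓm ℓp) (hmax : IsLocalMax f c)
    (hQ : IsWanderingInterval f Q) (hinf : {n : ℕ | IsClosestReturnMoment f c Q n}.Infinite) {m k : ℕ}
    (hm : 1 ≤ m) (hk : m < closestMoment f c Q k) :
    ConsecutiveRecords (fun j => sSup (f^[m + j] '' Q)) (closestMoment f c Q k - m)
      (closestMoment f c Q (k + 1) - m) := by
  have hd : ∀ j, 1 ≤ j → Metric.infDist (f c) (f^[j] '' Q) = f c - sSup (f^[j] '' Q) := by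
    intro j hj
    obtain ⟨i, rfl⟩ := Nat.exists_eq_add_of_le' hj
    exact infDist_image_eq (hf.isTent hmax) hQ (hf.sSup_lt_value hmax hQ i)
  have hlt : closestMoment f c Q k < closestMoment f c Q (k + 1) :=
    closestMoment_strictMono hinf (Nat.lt_succ_self k)
  refine ⟨by omega, by omega, fun j hj => ?_, ?_⟩
  · have := infDist_closestMoment_le hinf k (j := m + j) (by omega)
    rw [hd _ (by omega), hd _ (by omega)] at this
    rw [Nat.add_sub_cancel' hk.le]
    linarith
  · have := infDist_closestMoment_lt hinf (k + 1) hlt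
    rw [hd _ (by omega), hd _ (by omega)] at this
    rw [Nat.add_sub_cancel' hk.le, Nat.add_sub_cancel' (by omega)]
    linarith

end

/-! ### Extensions of the first return maps of a wandering interval -/

/-- `p` and `q` are the two endpoints of the interval with index `j`. -/
def IsEnds (A B : ℕ → ℝ) (j : ℕ) (p q : ℝ) : Prop := (p = A j ∧ q = B j) ∨ (p = B j ∧ q = A j)

lemma IsEnds.symm {A B : ℕ → ℝ} {j : ℕ} {p q : ℝ} (h : IsEnds A B j p q) : IsEnds A B j q p := by
  rcases h with ⟨h1, h2⟩ | ⟨h1, h2⟩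
  · exact Or.inr ⟨h2, h1⟩
  · exact Or.inl ⟨h2, h1⟩

section

variable {f : ℝ → ℝ} {c : ℝ} {A B : ℕ → ℝ} {σ N : ℕ}

lemma IsTent.exists_critical_preimage (h : IsTent f c) {e q p : ℝ} (he : e ∈ Icc (0 : ℝ) 1)
    (hp : p ∈ Icc (0 : ℝ) 1) (hq : q ∈ uIcc e p) (hqp : ∀ i, c ∉ f^[i] '' uIcc q p) (m : ℕ) :
    InjOn f^[m] (uIcc e p) ∨
      ∃ t ∈ uIcc e q, ∃ i < m, f^[i] t = c ∧ InjOn f^[m] (uIcc t p) := by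
  have hq1 : q ∈ Icc (0 : ℝ) 1 := IsTent.uIcc_subset he hp hq
  have key : ∀ m, ∀ e' ∈ uIcc e q, InjOn f^[m] (uIcc e' p) → InjOn f^[m + 1] (uIcc e' p) ∨
      ∃ t ∈ uIcc e q, f^[m] t = c ∧ InjOn f^[m + 1] (uIcc t p) := by
    intro m e' he' hi
    have he1 : e' ∈ Icc (0 : ℝ) 1 := IsTent.uIcc_subset he hq1 he'
    by_cases hc : c ∈ f^[m] '' uIcc e' p
    · right
      obtain ⟨t, ht, htc⟩ := hc
      have ht1 : t ∈ Icc (0 : ℝ) 1 := IsTent.uIcc_subset he1 hp ht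
      have htq : t ∈ uIcc e' q := by
        rcases uIcc_subset_uIcc_union_uIcc (b := q) ht with h1 | h1
        · exact h1
        · exact absurd ⟨t, h1, htc⟩ (hqp m)
      have hi' : InjOn f^[m] (uIcc t p) := hi.mono (uIcc_subset_uIcc ht right_mem_uIcc)
      refine ⟨t, uIcc_subset_uIcc he' right_mem_uIcc htq, htc, ?_⟩
      rw [Function.iterate_succ']
      refine InjOn.comp (t := f^[m] '' uIcc t p) ?_ hi' (mapsTo_image _ _)
      rw [h.image_iterate_uIcc ht1 hp hi', htc]
      have hpm := h.iterate_mapsTo m hp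
      apply h.injOn_of_subset
      rcases le_total c (f^[m] p) with h1 | h1
      · right; rw [uIcc_of_le h1]; exact Icc_subset_Icc_right hpm.2
      · left; rw [uIcc_of_ge h1]; exact Icc_subset_Icc_left hpm.1
    · left
      rw [Function.iterate_succ']
      refine InjOn.comp (t := f^[m] '' uIcc e' p) ?_ hi (mapsTo_image _ _)
      rw [h.image_iterate_uIcc he1 hp hi] at hc ⊢
      exact h.injOn_of_subset (IsTent.subset_of_notMem ordConnected_uIcc
        (IsTent.uIcc_subset (h.iterate_mapsTo m he1) (h.iterate_mapsTo m hp)) hc)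
  induction m with
  | zero => exact Or.inl Function.injective_id.injOn
  | succ m ih =>
    rcases ih with ih | ⟨t, ht, i, him, hic, ih⟩
    · rcases key m e left_mem_uIcc ih with h1 | ⟨t, ht, htc, h1⟩
      · exact Or.inl h1
      · exact Or.inr ⟨t, ht, m, by omega, htc, h1⟩
    · rcases key m t ht ih with h1 | ⟨t', ht', htc, h1⟩
      · exact Or.inr ⟨t, ht, i, by omega, hic, h1⟩
      · exact Or.inr ⟨t', ht', m, by omega, htc, h1⟩

namespace WanderingSequence


lemma uIcc_eq (W : WanderingSequence f c A B) {j : ℕ} {p q : ℝ} (hpq : IsEnds A B j p q) : uIcc p q = Icc (A j) (B j) := by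
  rcases hpq with ⟨rfl, rfl⟩ | ⟨rfl, rfl⟩
  · exact uIcc_of_le (W.lt j).le
  · exact uIcc_of_ge (W.lt j).le

lemma isEnds_mem (W : WanderingSequence f c A B) {j : ℕ} {p q : ℝ} (hpq : IsEnds A B j p q) : p ∈ Icc (0 : ℝ) 1 := by
  rcases hpq with ⟨rfl, rfl⟩ | ⟨rfl, rfl⟩
  · exact W.left_mem j
  · exact W.right_mem j

lemma isEnds_map (W : WanderingSequence f c A B) (h : IsTent f c) {j : ℕ} {p q : ℝ} (hpq : IsEnds A B j p q) : IsEnds A B (j + 1) (f p) (f q) := by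
  have hp := W.isEnds_mem hpq
  have hq := W.isEnds_mem hpq.symm
  have hi : InjOn f (uIcc p q) := by
    apply h.injOn_of_subset
    apply IsTent.subset_of_notMem ordConnected_uIcc (IsTent.uIcc_subset hp hq)
    rw [W.uIcc_eq hpq]; exact W.notMem j
  have himg := image_uIcc_of_injOn (h.continuousOn.mono (IsTent.uIcc_subset hp hq)) hi
  rw [W.uIcc_eq hpq, W.image j] at himg
  have hlt := W.lt (j + 1)
  rcases le_total (f p) (f q) with h1 | h1
  · rw [uIcc_of_le h1, Icc_eq_Icc_iff hlt.le] at himg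
    exact Or.inl ⟨himg.1.symm, himg.2.symm⟩
  · rw [uIcc_of_ge h1, Icc_eq_Icc_iff hlt.le] at himg
    exact Or.inr ⟨himg.2.symm, himg.1.symm⟩

lemma isEnds_iterate (W : WanderingSequence f c A B) (h : IsTent f c) {j : ℕ} {p q : ℝ} (hpq : IsEnds A B j p q) (n : ℕ) :
    IsEnds A B (j + n) (f^[n] p) (f^[n] q) := by
  induction n with
  | zero => exact hpq
  | succ n ih =>
    rw [Function.iterate_succ_apply', Function.iterate_succ_apply']
    exact W.isEnds_map h ih

lemma iterate_image (W : WanderingSequence f c A B) (j n : ℕ) : f^[n] '' Icc (A j) (B j) = Icc (A (j + n)) (B (j + n)) := by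
  induction n with
  | zero => simp
  | succ n ih => rw [Function.iterate_succ', image_comp, ih, W.image]; rfl

lemma injOn_iterate (W : WanderingSequence f c A B) (h : IsTent f c) (j n : ℕ) : InjOn f^[n] (Icc (A j) (B j)) := by
  refine h.injOn_iterate_of_notMem ordConnected_Icc
    (Icc_subset_Icc (W.left_mem j).1 (W.right_mem j).2) n fun i _ => ?_
  rw [W.iterate_image]
  exact W.notMem _

lemma le_or_le (W : WanderingSequence f c A B) {i j : ℕ} (hij : i ≠ j) : B i ≤ A j ∨ B j ≤ A i := by
  have := Ioo_disjoint_Ioo.1 (W.disjoint i j hij)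
  have h1 := W.lt i
  have h2 := W.lt j
  rcases min_le_iff.1 this with h3 | h3 <;> rcases le_max_iff.1 h3 with h4 | h4
  · linarith
  · exact Or.inl h4
  · exact Or.inr h4
  · linarith

lemma le_left (W : WanderingSequence f c A B) (R : ConsecutiveRecords B σ (N + 1)) {j : ℕ} (hj : j < N + 1) (hjσ : j ≠ σ) :
    B j ≤ A σ := by
  rcases W.le_or_le hjσ with h1 | h1
  · exact h1
  · linarith [R.le j hj, W.lt j]

lemma right_le (W : WanderingSequence f c A B) (R : ConsecutiveRecords B σ (N + 1)) : B σ ≤ A (N + 1) := by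
  rcases W.le_or_le R.lt.ne with h1 | h1
  · exact h1
  · linarith [R.lt_right, W.lt σ]

lemma left_le_left (W : WanderingSequence f c A B) (R : ConsecutiveRecords B σ (N + 1)) {j : ℕ} (hj : j < N + 1) : A j ≤ A σ := by
  rcases eq_or_ne j σ with rfl | hjσ
  · exact le_rfl
  · linarith [W.le_left R hj hjσ, W.lt j]

/-- No iterate is an injective self-map of an interval containing one of the intervals. -/
lemma not_selfMap (W : WanderingSequence f c A B) (h : IsTent f c) {u v : ℝ} {p j : ℕ} (hp : 1 ≤ p) (hu : u ∈ Icc (0 : ℝ) 1)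
    (hv : v ∈ Icc (0 : ℝ) 1)
    (hi : InjOn f^[p] (uIcc u v)) (hs : uIcc (f^[p] u) (f^[p] v) ⊆ uIcc u v) {x : ℝ}
    (hx : x ∈ Ioo (A j) (B j)) : x ∉ uIcc u v := by
  intro hx'
  refine disjoint_left.1 (W.no_selfMap (min u v) (max u v) p j hp ?_ hi ?_) hx hx'
  · exact IsTent.uIcc_subset hu hv
  · intro y hy
    have := h.image_iterate_uIcc hu hv hi
    exact hs (this ▸ mem_image_of_mem _ hy)

lemma not_selfMap' (W : WanderingSequence f c A B) (h : IsTent f c) {u v : ℝ} {p j : ℕ} (hp : 1 ≤ p) (hu : u ∈ Icc (0 : ℝ) 1)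
    (hv : v ∈ Icc (0 : ℝ) 1)
    (hi : InjOn f^[p] (uIcc u v)) (hs : uIcc (f^[p] u) (f^[p] v) ⊆ uIcc u v)
    (hj : Icc (A j) (B j) ⊆ uIcc u v) : False := by
  obtain ⟨x, hx⟩ := exists_between (W.lt j)
  exact W.not_selfMap h hp hu hv hi hs hx (hj (Ioo_subset_Icc_self hx))

end WanderingSequence

end

section

variable {f : ℝ → ℝ} {c : ℝ} {A B : ℕ → ℝ} {σ N : ℕ}

lemma IsTent.iterate_mem_uIcc (h : IsTent f c) {a b x : ℝ} {n : ℕ} (ha : a ∈ Icc (0 : ℝ) 1)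
    (hb : b ∈ Icc (0 : ℝ) 1) (hi : InjOn f^[n] (uIcc a b)) (hx : x ∈ uIcc a b) :
    f^[n] x ∈ uIcc (f^[n] a) (f^[n] b) :=
  h.image_iterate_uIcc ha hb hi ▸ mem_image_of_mem _ hx

lemma IsTent.value_mem (h : IsTent f c) : f c ∈ Icc (0 : ℝ) 1 :=
  h.mapsTo (Ioo_subset_Icc_self h.mem_Ioo)

lemma IsTent.injOn_iterate_succ (h : IsTent f c) {a b : ℝ} {n : ℕ} (ha : a ∈ Icc (0 : ℝ) 1)
    (hb : b ∈ Icc (0 : ℝ) 1) (hi : InjOn f^[n] (uIcc a b))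
    (hs : (f^[n] a ≤ c ∧ f^[n] b ≤ c) ∨ (c ≤ f^[n] a ∧ c ≤ f^[n] b)) :
    InjOn f^[n + 1] (uIcc a b) := by
  rw [Function.iterate_succ']
  refine InjOn.comp (t := f^[n] '' uIcc a b) ?_ hi (mapsTo_image _ _)
  rw [h.image_iterate_uIcc ha hb hi]
  have ha' := h.iterate_mapsTo n ha
  have hb' := h.iterate_mapsTo n hb
  apply h.injOn_of_subset
  rcases hs with ⟨h1, h2⟩ | ⟨h1, h2⟩
  · exact Or.inl (ordConnected_Icc.uIcc_subset ⟨ha'.1, h1⟩ ⟨hb'.1, h2⟩)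
  · exact Or.inr (ordConnected_Icc.uIcc_subset ⟨h1, ha'.2⟩ ⟨h2, hb'.2⟩)

namespace WanderingSequence

lemma critical_side (W : WanderingSequence f c A B) (h : IsTent f c) {t p q : ℝ}
    (hpq : IsEnds A B 0 p q) (ht : t ∈ Icc (0 : ℝ) 1) (hq : q ∈ uIcc t p) {i : ℕ}
    (hi : InjOn f^[i + 1] (uIcc t p)) (htc : f^[i] t = c) :
    f^[i + 1] t = f c ∧ f^[i + 1] p = A (i + 1) ∧ f^[i + 1] q = B (i + 1) ∧
      f^[i + 1] '' uIcc t p = uIcc (A (i + 1)) (f c) := by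
  have hp := W.isEnds_mem hpq
  have h1 : f^[i + 1] t = f c := by rw [Function.iterate_succ_apply', htc]
  have h2 := h.iterate_mem_uIcc ht hp hi hq
  have h3 := W.isEnds_iterate h hpq (i + 1)
  have h4 := W.lt (i + 1)
  have h5 := W.lt_value (i + 1)
  rw [h1] at h2
  rw [zero_add] at h3
  rcases h3 with ⟨h6, h7⟩ | ⟨h6, h7⟩
  · refine ⟨h1, h6, h7, ?_⟩
    rw [h.image_iterate_uIcc ht hp hi, h1, h6, uIcc_comm]
  · rw [h6, h7, uIcc_of_ge h5.le] at h2
    linarith [h2.1]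

/-- The outer endpoint of the extension. -/
lemma exists_outer (W : WanderingSequence f c A B) (h : IsTent f c)
    (R : ConsecutiveRecords B σ (N + 1)) {t p q : ℝ}
    (hpq : IsEnds A B 0 p q) (ht : t ∈ Icc (0 : ℝ) 1) (hq : q ∈ uIcc t p) {i : ℕ} (hiN : i < N)
    (hi : InjOn f^[N] (uIcc t p)) (htc : f^[i] t = c) (hqA : f^[N + 1] q = A (N + 1))
    (hpB : f^[N + 1] p = B (N + 1)) :
    ∃ x ∈ uIcc t q, f^[N + 1] x = A σ ∧ InjOn f^[N + 1] (uIcc x p) := by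
  have hp := W.isEnds_mem hpq
  have hq1 := W.isEnds_mem hpq.symm
  obtain ⟨e1, e2, e3, e4⟩ := W.critical_side h hpq ht hq (IsTent.injOn_iterate_of_le hiN hi) htc
  have hside : (f^[N] t ≤ c ∧ f^[N] p ≤ c) ∨ (c ≤ f^[N] t ∧ c ≤ f^[N] p) := by
    have hm := h.iterate_mem_uIcc ht hp hi hq
    have hends := W.isEnds_iterate h hpq N
    have hc := W.notMem N
    have hlt := W.lt N
    have hA := W.left_mem N
    have hB := W.right_mem N
    rw [zero_add] at hends
    rw [Function.iterate_succ_apply'] at hqA hpB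
    have hlt' := W.lt (N + 1)
    rcases hends with ⟨g1, g2⟩ | ⟨g1, g2⟩
    · rw [g2] at hqA hm
      rw [g1] at hpB hm ⊢
      rcases lt_or_ge (B N) c with g3 | g3
      · have := h.strictMonoOn ⟨hA.1, by linarith⟩ ⟨hB.1, g3.le⟩ hlt
        linarith
      · right
        have g4 : c < A N := by by_contra! g4; exact hc ⟨g4, g3⟩
        rcases mem_uIcc.1 hm with g5 | g5
        · linarith [g5.2]
        · exact ⟨by linarith [g5.2], g4.le⟩
    · rw [g2] at hqA hm
      rw [g1] at hpB hm ⊢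
      rcases lt_or_ge (B N) c with g3 | g3
      · left
        rcases mem_uIcc.1 hm with g5 | g5
        · exact ⟨by linarith [g5.1], g3.le⟩
        · linarith [g5.1]
      · have g4 : c < A N := by by_contra! g4; exact hc ⟨g4, g3⟩
        have := h.strictAntiOn ⟨g4.le, hA.2⟩ ⟨by linarith, hB.2⟩ hlt
        linarith
  have hi' := h.injOn_iterate_succ ht hp hi hside
  have hsplit : (i + 1) + (N - i) = N + 1 := by omega
  have hle : f^[N + 1] t ≤ A (N + 1) := by
    have := h.iterate_mem_uIcc ht hp hi' hq
    rw [hqA, hpB] at this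
    have hlt' := W.lt (N + 1)
    rcases mem_uIcc.1 this with g5 | g5
    · exact g5.1
    · linarith [g5.1]
  have hjσ : A (i + 1) ≤ A σ := W.left_le_left R (by omega)
  have hσ : B σ ≤ A (N + 1) := W.right_le R
  have hσ' := W.lt σ
  have hlow : f^[N + 1] t < A (i + 1) := by
    by_contra! hcon
    rw [← hsplit] at hi'
    have hinj := IsTent.injOn_image_iterate hi'
    rw [e4] at hinj
    have k1 : f^[N - i] (A (i + 1)) = B (N + 1) := by
      rw [← e2, ← Function.iterate_add_apply, add_comm, hsplit, hpB]
    have k2 : f^[N - i] (f c) = f^[N + 1] t := by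
      rw [← e1, ← Function.iterate_add_apply, add_comm, hsplit]
    have hv := W.lt_value (i + 1)
    have hvN := W.lt_value (N + 1)
    have hj := W.lt (i + 1)
    have hN1 := W.lt (N + 1)
    refine W.not_selfMap' h (j := i + 1) (by omega) (W.left_mem _) h.value_mem hinj ?_ ?_
    · rw [k1, k2, uIcc_of_le (by linarith : A (i + 1) ≤ f c), uIcc_of_ge (by linarith)]
      exact Icc_subset_Icc hcon (by linarith)
    · rw [uIcc_of_le (by linarith : A (i + 1) ≤ f c)]
      exact Icc_subset_Icc_right hv.le
  have htq : uIcc t q ⊆ uIcc t p := uIcc_subset_uIcc left_mem_uIcc hq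
  have himg := h.image_iterate_uIcc ht hq1 (hi'.mono htq)
  have hmem : A σ ∈ f^[N + 1] '' uIcc t q := by
    rw [himg, hqA, mem_uIcc]
    left
    constructor <;> linarith
  obtain ⟨x, hx, hxA⟩ := hmem
  exact ⟨x, hx, hxA, hi'.mono (uIcc_subset_uIcc (htq hx) right_mem_uIcc)⟩

/-- The inner endpoint of the extension. -/
lemma exists_inner (W : WanderingSequence f c A B) (h : IsTent f c)
    (R : ConsecutiveRecords B σ (N + 1)) {t p q : ℝ}
    (hpq : IsEnds A B 0 p q) (ht : t ∈ Icc (0 : ℝ) 1) (hq : q ∈ uIcc t p) {i : ℕ} (hiN : i < N)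
    (hi : InjOn f^[N] (uIcc t p)) (htc : f^[i] t = c) (hqB : f^[N + 1] q = B (N + 1))
    (hpA : f^[N + 1] p = A (N + 1)) :
    ∃ x ∈ uIcc t q, c ∈ uIcc (f^[N] q) (f^[N] x) ∧ f^[N] x ≠ c ∧
      (f^[N + 1] x = A σ ∨ (f^[σ] x = f c ∧ A σ < f^[N + 1] x)) := by
  have hp := W.isEnds_mem hpq
  have hq1 := W.isEnds_mem hpq.symm
  obtain ⟨e1, e2, e3, e4⟩ := W.critical_side h hpq ht hq (IsTent.injOn_iterate_of_le hiN hi) htc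
  have htq : uIcc t q ⊆ uIcc t p := uIcc_subset_uIcc left_mem_uIcc hq
  have hsplit : (i + 1) + (N - i) = N + 1 := by omega
  have hsplit' : (i + 1) + (N - i - 1) = N := by omega
  have hjσ : A (i + 1) ≤ A σ := W.left_le_left R (by omega)
  have hσ : B σ ≤ A (N + 1) := W.right_le R
  have hσ' := W.lt σ
  have hv := W.lt_value (i + 1)
  have hvN := W.lt_value (N + 1)
  have hj := W.lt (i + 1)
  have hN1 := W.lt (N + 1)
  have htN : f^[N + 1] t ≤ f c := by
    rw [Function.iterate_succ_apply']; exact h.le (h.iterate_mapsTo N ht)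
  have hside : ¬ ((f^[N] t ≤ c ∧ f^[N] p ≤ c) ∨ (c ≤ f^[N] t ∧ c ≤ f^[N] p)) := by
    intro hside
    have hi' := h.injOn_iterate_succ ht hp hi hside
    have hge : B (N + 1) ≤ f^[N + 1] t := by
      have := h.iterate_mem_uIcc ht hp hi' hq
      rw [hqB, hpA] at this
      rcases mem_uIcc.1 this with g5 | g5
      · linarith [g5.2]
      · linarith [g5.2]
    rw [← hsplit] at hi'
    have hinj := IsTent.injOn_image_iterate hi'
    rw [e4] at hinj
    have k1 : f^[N - i] (A (i + 1)) = A (N + 1) := by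
      rw [← e2, ← Function.iterate_add_apply, add_comm, hsplit, hpA]
    have k2 : f^[N - i] (f c) = f^[N + 1] t := by
      rw [← e1, ← Function.iterate_add_apply, add_comm, hsplit]
    refine W.not_selfMap' h (j := i + 1) (by omega) (W.left_mem _) h.value_mem hinj ?_ ?_
    · rw [k1, k2, uIcc_of_le (by linarith : A (i + 1) ≤ f c), uIcc_of_le (by linarith)]
      exact Icc_subset_Icc (by linarith) htN
    · rw [uIcc_of_le (by linarith : A (i + 1) ≤ f c)]
      exact Icc_subset_Icc_right hv.le
  have hctN : c ∈ uIcc (f^[N] q) (f^[N] t) ∧ f^[N] t ≠ c := by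
    have hends := W.isEnds_iterate h hpq N
    rw [zero_add] at hends
    have hc := W.notMem N
    push Not at hside
    have hpc : f^[N] p ≠ c := by
      intro he
      rw [← W.uIcc_eq hends, ← he] at hc
      exact hc left_mem_uIcc
    have hcpt : c ∈ uIcc (f^[N] p) (f^[N] t) ∧ f^[N] t ≠ c := by
      rcases lt_or_gt_of_ne hpc with g1 | g1
      · have g2 : c < f^[N] t := by
          by_contra! g2; linarith [hside.1 g2]
        exact ⟨mem_uIcc.2 (Or.inl ⟨g1.le, g2.le⟩), g2.ne'⟩
      · have g2 : f^[N] t < c := by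
          by_contra! g2; linarith [hside.2 g2]
        exact ⟨mem_uIcc.2 (Or.inr ⟨g2.le, g1.le⟩), g2.ne⟩
    refine ⟨?_, hcpt.2⟩
    rcases uIcc_subset_uIcc_union_uIcc (b := f^[N] q) hcpt.1 with g1 | g1
    · rw [W.uIcc_eq hends] at g1; exact absurd g1 hc
    · exact g1
  by_cases hlow : f^[N + 1] t ≤ A σ
  · have hctI : uIcc c (f^[N] t) ⊆ Icc 0 1 :=
      IsTent.uIcc_subset (Ioo_subset_Icc_self h.mem_Ioo) (h.iterate_mapsTo N ht)
    have hivt := intermediate_value_uIcc (h.continuousOn.mono hctI)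
    rw [← Function.iterate_succ_apply' f] at hivt
    have hvσ := W.lt_value σ
    obtain ⟨z, hz, hzA⟩ := hivt (mem_uIcc.2 (Or.inr ⟨hlow, by linarith⟩))
    have himg := h.image_iterate_uIcc ht hq1 (hi.mono htq)
    have hzm : z ∈ f^[N] '' uIcc t q := by
      rw [himg, uIcc_comm]
      exact uIcc_subset_uIcc hctN.1 right_mem_uIcc hz
    obtain ⟨x, hx, rfl⟩ := hzm
    refine ⟨x, hx, ?_, ?_, Or.inl ?_⟩
    · have h1 := hctN.1
      rcases mem_uIcc.1 h1 with g1 | g1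
      · rw [uIcc_of_le g1.2] at hz
        exact mem_uIcc.2 (Or.inl ⟨g1.1, hz.1⟩)
      · rw [uIcc_of_ge g1.1] at hz
        exact mem_uIcc.2 (Or.inr ⟨hz.2, g1.2⟩)
    · intro hxc
      rw [hxc] at hzA
      linarith
    · rw [Function.iterate_succ_apply', hzA]
  · push Not at hlow
    refine ⟨t, left_mem_uIcc, hctN.1, hctN.2, Or.inr ⟨?_, hlow⟩⟩
    suffices i + 1 = σ by rw [← this, e1]
    have hinj : InjOn f^[N - i - 1] (uIcc (A (i + 1)) (f c)) := by
      rw [← hsplit'] at hi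
      have := IsTent.injOn_image_iterate hi
      rwa [e4] at this
    have hAfc : uIcc (A (i + 1)) (f c) = Icc (A (i + 1)) (f c) := uIcc_of_le (by linarith)
    have hAmem := W.left_mem (i + 1)
    -- the values of the last iterate stay to the right of the previous record
    have hval : ∀ x ∈ uIcc (A (i + 1)) (f c), A σ < f^[N - i] x := by
      intro x hx
      have hx1 := IsTent.uIcc_subset hAmem h.value_mem hx
      have m1 := h.iterate_mem_uIcc hAmem h.value_mem hinj hx
      have k1 : f^[N - i - 1] (A (i + 1)) = f^[N] p := by
        rw [← e2, ← Function.iterate_add_apply, add_comm, hsplit']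
      have k2 : f^[N - i - 1] (f c) = f^[N] t := by
        rw [← e1, ← Function.iterate_add_apply, add_comm, hsplit']
      have hs : N - i = (N - i - 1) + 1 := by omega
      rw [hs, Function.iterate_succ_apply']
      rw [k1, k2] at m1
      have hpN := h.iterate_mapsTo N hp
      have htN1 := h.iterate_mapsTo N ht
      have hxN := h.iterate_mapsTo (N - i - 1) hx1
      rw [Function.iterate_succ_apply'] at hpA hlow
      set y := f^[N - i - 1] x
      rcases le_total y c with hy | hy
      · rcases mem_uIcc.1 m1 with g | g
        · have := h.strictMonoOn.monotoneOn ⟨hpN.1, g.1.trans hy⟩ ⟨hxN.1, hy⟩ g.1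
          linarith
        · have := h.strictMonoOn.monotoneOn ⟨htN1.1, g.1.trans hy⟩ ⟨hxN.1, hy⟩ g.1
          linarith
      · rcases mem_uIcc.1 m1 with g | g
        · have := h.strictAntiOn.antitoneOn ⟨hy, hxN.2⟩ ⟨hy.trans g.2, htN1.2⟩ g.2
          linarith
        · have := h.strictAntiOn.antitoneOn ⟨hy, hxN.2⟩ ⟨hy.trans g.2, hpN.2⟩ g.2
          linarith
    have hval' : ∀ j, Icc (A j) (B j) ⊆ uIcc (A (i + 1)) (f c) → A σ < A (j + (N - i)) := by
      intro j hjs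
      have hm : A (j + (N - i)) ∈ f^[N - i] '' Icc (A j) (B j) := by
        rw [W.iterate_image]; exact ⟨le_rfl, (W.lt _).le⟩
      obtain ⟨x, hx, hxe⟩ := hm
      rw [← hxe]
      exact hval x (hjs hx)
    by_contra hne
    rcases lt_or_gt_of_ne hne with hlt | hlt
    · -- the case of an earlier critical passage
      have hBσ : B (i + 1) ≤ A σ := W.le_left R (by omega) hne
      have hvσ := W.lt_value σ
      obtain ⟨r, hr⟩ : ∃ r, σ = (i + 1) + r := ⟨σ - (i + 1), by omega⟩
      have hσN := R.lt
      have hr0 : 0 < r := by omega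
      have hrP : r ≤ N - i - 1 := by omega
      have hQσ : Icc (A σ) (B σ) ⊆ uIcc (A (i + 1)) (f c) := by
        rw [hAfc]; exact Icc_subset_Icc (by linarith) hvσ.le
      have hQj : Icc (A (i + 1)) (B (i + 1)) ⊆ uIcc (A (i + 1)) (f c) := by
        rw [hAfc]; exact Icc_subset_Icc le_rfl hv.le
      have hinjr := IsTent.injOn_iterate_of_le hrP hinj
      have hBmem : B (i + 1) ∈ uIcc (A (i + 1)) (f c) := hQj ⟨hj.le, le_rfl⟩
      have hm := h.iterate_mem_uIcc hAmem h.value_mem hinjr hBmem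
      have hends := W.isEnds_iterate h (Or.inl ⟨rfl, rfl⟩ : IsEnds A B (i + 1) _ _) r
      rw [← hr] at hends
      have hfr : f^[r] (f c) ≤ f c := by
        obtain ⟨r', rfl⟩ := Nat.exists_eq_add_of_le' hr0
        change f^[r' + 1] (f c) ≤ f c
        rw [Function.iterate_succ_apply']
        exact h.le (h.iterate_mapsTo r' h.value_mem)
      rcases hends with ⟨g1, g2⟩ | ⟨g1, g2⟩
      · refine W.not_selfMap' h (j := i + 1) hr0 hAmem h.value_mem hinjr ?_ hQj
        rw [g1, g2] at hm
        rw [g1]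
        have : A σ ≤ f^[r] (f c) := by
          rcases mem_uIcc.1 hm with g | g
          · linarith [g.2]
          · linarith [g.2]
        rw [hAfc, uIcc_of_le this]
        exact Icc_subset_Icc hjσ hfr
      · -- a reversing branch sends the interval of index `i + 1` above the new record
        obtain ⟨s, hs⟩ : ∃ s, N + 1 = σ + s := ⟨N + 1 - σ, by omega⟩
        have hs1 : s ≤ N - i - 1 := by omega
        have hinjs := IsTent.injOn_iterate_of_le hs1 hinj
        have hsr : N - i = r + s := by omega
        -- `f^[s]` maps `B σ` to `A (N+1)` and `A σ` to `B (N+1)`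
        have k1 : f^[s] (B σ) = A (N + 1) := by
          rw [← g1, ← Function.iterate_add_apply, add_comm, ← hsr, ← e2, ← Function.iterate_add_apply,
            add_comm, hsplit, hpA]
        have k2 : f^[s] (A σ) = B (N + 1) := by
          rw [← g2, ← Function.iterate_add_apply, add_comm, ← hsr, ← e3, ← Function.iterate_add_apply,
            add_comm, hsplit, hqB]
        have hcont := (h.iterate_continuousOn s).mono (IsTent.uIcc_subset hAmem h.value_mem)
        have hAσ : A σ ∈ uIcc (A (i + 1)) (f c) := hQσ ⟨le_rfl, hσ'.le⟩
        have hBσ' : B σ ∈ uIcc (A (i + 1)) (f c) := hQσ ⟨hσ'.le, le_rfl⟩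
        have hAj : A (i + 1) ∈ uIcc (A (i + 1)) (f c) := left_mem_uIcc
        have hrec := R.le (i + 1 + s) (by omega)
        have hltr := R.lt_right
        have hends' := W.isEnds_iterate h (Or.inl ⟨rfl, rfl⟩ : IsEnds A B (i + 1) _ _) s
        have hb1 : f^[s] (A (i + 1)) ≤ B (i + 1 + s) := by
          have := W.lt (i + 1 + s)
          rcases hends' with ⟨g3, -⟩ | ⟨g3, -⟩ <;> linarith
        rcases strictMonoOn_or_strictAntiOn_uIcc hcont hinjs with hmono | hanti
        · have := hmono hAσ hBσ' hσ'
          linarith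
        · have := hanti.antitoneOn hAj hAσ hjσ
          linarith
    · -- the case of a later critical passage
      have hBj : B (i + 1) ≤ A σ := W.le_left R (by omega) hne
      have hvσ := W.lt_value σ
      have hQσ : Icc (A σ) (B σ) ⊆ uIcc (A (i + 1)) (f c) := by
        rw [hAfc]; exact Icc_subset_Icc (by linarith) hvσ.le
      have h1 := hval' σ hQσ
      have h2 := W.le_left R (j := σ + (N - i)) (by omega) (by omega)
      linarith [W.lt (σ + (N - i))]

end WanderingSequence

end

lemma injOn_uIcc_of_overlap {g : ℝ → ℝ} {a b c d : ℝ} (ho : Ordered4 a b c d)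
    (hg : ContinuousOn g (uIcc a d)) (h1 : InjOn g (uIcc a c)) (h2 : InjOn g (uIcc b d)) :
    InjOn g (uIcc a d) := by
  wlog hlt : a < d generalizing a b c d
  · have := this ho.reverse (by rwa [uIcc_comm]) (by rwa [uIcc_comm]) (by rwa [uIcc_comm]) (by
      rcases ho with ⟨g1, g2, g3⟩ | ⟨g1, g2, g3⟩
      · exact absurd (g1.trans (g2.trans g3)) hlt
      · exact g1.trans (g2.trans g3))
    rwa [uIcc_comm]
  obtain ⟨g1, g2, g3⟩ : a < b ∧ b < c ∧ c < d := by
    rcases ho with h | ⟨g1, g2, g3⟩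
    · exact h
    · linarith
  have hc1 := hg.mono (uIcc_subset_uIcc left_mem_uIcc ho.mem.2)
  have hc2 := hg.mono (uIcc_subset_uIcc ho.mem.1 right_mem_uIcc)
  have m1 := strictMonoOn_or_strictAntiOn_uIcc hc1 h1
  have m2 := strictMonoOn_or_strictAntiOn_uIcc hc2 h2
  rw [uIcc_of_le (by linarith)] at m1 m2 ⊢
  have hU : Icc a d = Icc a c ∪ Icc c d := (Icc_union_Icc_eq_Icc (by linarith) g3.le).symm
  have hsub : Icc c d ⊆ Icc b d := Icc_subset_Icc_left g2.le
  have hb1 : b ∈ Icc a c := ⟨g1.le, g2.le⟩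
  have hc1 : c ∈ Icc a c := ⟨by linarith, le_rfl⟩
  have hb2 : b ∈ Icc b d := ⟨le_rfl, by linarith⟩
  have hc2 : c ∈ Icc b d := ⟨g2.le, g3.le⟩
  have hmax : IsGreatest (Icc a c) c := isGreatest_Icc (by linarith)
  have hmin : IsLeast (Icc c d) c := isLeast_Icc g3.le
  rw [hU]
  rcases m1 with m1 | m1 <;> rcases m2 with m2 | m2
  · exact (m1.union (m2.mono hsub) hmax hmin).injOn
  · linarith [m1 hb1 hc1 g2, m2 hb2 hc2 g2]
  · linarith [m1 hb1 hc1 g2, m2 hb2 hc2 g2]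
  · exact (m1.union (m2.mono hsub) hmax hmin).injOn

/-- Four points around the interval with index `0` on whose hull `f^[N]` is injective, and whose
images reach from the previous record `A σ` across the critical point. -/
structure ReturnExtension (f : ℝ → ℝ) (c : ℝ) (A B : ℕ → ℝ) (σ N : ℕ) (x₁ x₂ x₃ x₄ : ℝ) : Prop where
  ordered : Ordered4 x₁ x₂ x₃ x₄
  mem₁ : x₁ ∈ Icc (0 : ℝ) 1
  mem₄ : x₄ ∈ Icc (0 : ℝ) 1
  ends : IsEnds A B 0 x₂ x₃
  injOn : InjOn f^[N] (uIcc x₁ x₄)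
  injOn_outer : InjOn f^[N + 1] (uIcc x₁ x₃)
  map₁ : f^[N + 1] x₁ = A σ
  map₂ : f^[N + 1] x₂ = A (N + 1)
  map₃ : f^[N + 1] x₃ = B (N + 1)
  mem_uIcc : c ∈ uIcc (f^[N] x₃) (f^[N] x₄)
  ne : f^[N] x₄ ≠ c
  alt : f^[N + 1] x₄ = A σ ∨ (f^[σ] x₄ = f c ∧ A σ < f^[N + 1] x₄)

section

variable {f : ℝ → ℝ} {c : ℝ} {A B : ℕ → ℝ} {σ N : ℕ}

namespace WanderingSequence

lemma exists_side_extension (W : WanderingSequence f c A B) (h : IsTent f c)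
    (hl : ¬ InjOn f^[N] (Icc 0 (B 0))) (hr : ¬ InjOn f^[N] (Icc (A 0) 1)) {p q : ℝ}
    (hpq : IsEnds A B 0 p q) :
    ∃ t ∈ Icc (0 : ℝ) 1, q ∈ uIcc t p ∧ ∃ i < N, f^[i] t = c ∧ InjOn f^[N] (uIcc t p) := by
  have hp := W.isEnds_mem hpq
  have hq := W.isEnds_mem hpq.symm
  have hlt := W.lt 0
  have hcrit : ∀ i, c ∉ f^[i] '' uIcc q p := by
    intro i
    rw [W.uIcc_eq hpq.symm, W.iterate_image]
    exact W.notMem _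
  rcases hpq with ⟨rfl, rfl⟩ | ⟨rfl, rfl⟩
  · have h1 : B 0 ∈ uIcc 1 (A 0) := mem_uIcc.2 (Or.inr ⟨hlt.le, hq.2⟩)
    rcases h.exists_critical_preimage (right_mem_Icc.2 zero_le_one) hp h1 hcrit N with h2 | h2
    · rw [uIcc_of_ge hp.2] at h2; exact absurd h2 hr
    · obtain ⟨t, ht, i, hi, htc, hinj⟩ := h2
      rw [uIcc_of_ge hq.2] at ht
      exact ⟨t, ⟨by linarith [ht.1, hq.1], ht.2⟩, mem_uIcc.2 (Or.inr ⟨hlt.le, ht.1⟩), i, hi, htc, hinj⟩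
  · have h1 : A 0 ∈ uIcc 0 (B 0) := mem_uIcc.2 (Or.inl ⟨hq.1, hlt.le⟩)
    rcases h.exists_critical_preimage (left_mem_Icc.2 zero_le_one) hp h1 hcrit N with h2 | h2
    · rw [uIcc_of_le hp.1] at h2; exact absurd h2 hl
    · obtain ⟨t, ht, i, hi, htc, hinj⟩ := h2
      rw [uIcc_of_le hq.1] at ht
      exact ⟨t, ⟨ht.1, by linarith [ht.2, hq.2]⟩, mem_uIcc.2 (Or.inl ⟨ht.2, hlt.le⟩), i, hi, htc, hinj⟩

theorem exists_returnExtension (W : WanderingSequence f c A B) (h : IsTent f c)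
    (R : ConsecutiveRecords B σ (N + 1)) (hl : ¬ InjOn f^[N] (Icc 0 (B 0)))
    (hr : ¬ InjOn f^[N] (Icc (A 0) 1)) :
    ∃ x₁ x₂ x₃ x₄, ReturnExtension f c A B σ N x₁ x₂ x₃ x₄ := by
  obtain ⟨p, q, hpq, hpA, hqB⟩ : ∃ p q, IsEnds A B 0 p q ∧ f^[N + 1] p = A (N + 1) ∧
      f^[N + 1] q = B (N + 1) := by
    have := W.isEnds_iterate h (Or.inl ⟨rfl, rfl⟩ : IsEnds A B 0 (A 0) (B 0)) (N + 1)
    rw [zero_add] at this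
    rcases this with ⟨h1, h2⟩ | ⟨h1, h2⟩
    · exact ⟨A 0, B 0, Or.inl ⟨rfl, rfl⟩, h1, h2⟩
    · exact ⟨B 0, A 0, Or.inr ⟨rfl, rfl⟩, h2, h1⟩
  obtain ⟨t, ht, hqt, i, hi, htc, hinj⟩ := W.exists_side_extension h hl hr hpq
  obtain ⟨t', ht', hpt, i', hi', htc', hinj'⟩ := W.exists_side_extension h hl hr hpq.symm
  obtain ⟨x₄, hx₄, hx₄c, hx₄n, halt⟩ := W.exists_inner h R hpq ht hqt hi hinj htc hqB hpA
  obtain ⟨x₁, hx₁, hx₁A, hx₁i⟩ := W.exists_outer h R hpq.symm ht' hpt hi' hinj' htc' hpA hqB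
  have hp := W.isEnds_mem hpq
  have hq := W.isEnds_mem hpq.symm
  have hq4 : q ∈ uIcc x₄ p := by
    rcases mem_uIcc.1 hqt with g | g
    · rw [uIcc_of_le g.1] at hx₄
      exact mem_uIcc.2 (Or.inl ⟨hx₄.2, g.2⟩)
    · rw [uIcc_of_ge g.2] at hx₄
      exact mem_uIcc.2 (Or.inr ⟨g.1, hx₄.1⟩)
  have hp1 : p ∈ uIcc x₁ q := by
    rcases mem_uIcc.1 hpt with g | g
    · rw [uIcc_of_le g.1] at hx₁
      exact mem_uIcc.2 (Or.inl ⟨hx₁.2, g.2⟩)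
    · rw [uIcc_of_ge g.2] at hx₁
      exact mem_uIcc.2 (Or.inr ⟨g.1, hx₁.1⟩)
  have hne1 : x₁ ≠ p := by
    rintro rfl
    have := W.right_le R
    linarith [W.lt σ]
  have hne4 : x₄ ≠ q := by
    rintro rfl
    rw [uIcc_self, mem_singleton_iff] at hx₄c
    exact hx₄n hx₄c.symm
  have hord : Ordered4 x₁ p q x₄ := by
    have hlt := W.lt 0
    have hpq' : p ≠ q := by
      rcases hpq with ⟨rfl, rfl⟩ | ⟨rfl, rfl⟩
      · exact hlt.ne
      · exact hlt.ne'
    rcases lt_or_gt_of_ne hpq' with g | g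
    · left
      refine ⟨lt_of_le_of_ne ?_ hne1, g, lt_of_le_of_ne ?_ hne4.symm⟩
      · rcases mem_uIcc.1 hp1 with k | k
        · exact k.1
        · linarith [k.1]
      · rcases mem_uIcc.1 hq4 with k | k
        · linarith [k.2]
        · exact k.2
    · right
      refine ⟨lt_of_le_of_ne ?_ hne4, g, lt_of_le_of_ne ?_ hne1.symm⟩
      · rcases mem_uIcc.1 hq4 with k | k
        · exact k.1
        · linarith [k.1]
      · rcases mem_uIcc.1 hp1 with k | k
        · linarith [k.2]
        · exact k.2
  have hx₄m := IsTent.uIcc_subset ht hq hx₄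
  have hx₁m := IsTent.uIcc_subset ht' hp hx₁
  refine ⟨x₁, p, q, x₄, hord, hx₁m, hx₄m, hpq, ?_, hx₁i, hx₁A, hpA, hqB, hx₄c, hx₄n, halt⟩
  refine injOn_uIcc_of_overlap hord ((h.iterate_continuousOn N).mono (IsTent.uIcc_subset hx₁m hx₄m))
    (IsTent.injOn_iterate_of_le (Nat.le_succ N) hx₁i) (hinj.mono ?_)
  rw [uIcc_comm]
  exact uIcc_subset_uIcc (uIcc_subset_uIcc left_mem_uIcc hqt hx₄) right_mem_uIcc

end WanderingSequence

end

section

variable {f : ℝ → ℝ} {c : ℝ} {A B : ℕ → ℝ} {σ N : ℕ} {x₁ x₂ x₃ x₄ : ℝ}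

namespace WanderingSequence

lemma iterate_mem_Ioo (W : WanderingSequence f c A B) (h : IsTent f c) {j : ℕ} {x : ℝ}
    (hx : x ∈ Ioo (A j) (B j)) (n : ℕ) : f^[n] x ∈ Ioo (A (j + n)) (B (j + n)) := by
  have h1 := h.image_iterate_Ioo (W.lt j) (W.left_mem j) (W.right_mem j) (W.injOn_iterate h j n)
  have h2 := mem_image_of_mem f^[n] hx
  rw [h1] at h2
  have hlt := W.lt (j + n)
  rcases W.isEnds_iterate h (Or.inl ⟨rfl, rfl⟩ : IsEnds A B j _ _) n with ⟨h3, h4⟩ | ⟨h3, h4⟩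
  · rwa [h3, h4, min_eq_left hlt.le, max_eq_right hlt.le] at h2
  · rwa [h3, h4, min_eq_right hlt.le, max_eq_left hlt.le] at h2

lemma isEnds_notMem (W : WanderingSequence f c A B) {i j : ℕ} {p q : ℝ} (hpq : IsEnds A B i p q) :
    p ∉ Ioo (A j) (B j) := by
  rintro ⟨h1, h2⟩
  have hi := W.lt i
  rcases eq_or_ne i j with rfl | hne
  · rcases hpq with ⟨rfl, -⟩ | ⟨rfl, -⟩ <;> linarith
  · rcases hpq with ⟨rfl, -⟩ | ⟨rfl, -⟩ <;> rcases W.le_or_le hne with h3 | h3 <;> linarith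

end WanderingSequence

namespace ReturnExtension

lemma mem₃ (E : ReturnExtension f c A B σ N x₁ x₂ x₃ x₄) : x₃ ∈ Icc (0 : ℝ) 1 :=
  IsTent.uIcc_subset E.mem₁ E.mem₄ E.ordered.mem.2

lemma mem₂ (E : ReturnExtension f c A B σ N x₁ x₂ x₃ x₄) : x₂ ∈ Icc (0 : ℝ) 1 :=
  IsTent.uIcc_subset E.mem₁ E.mem₄ E.ordered.mem.1

lemma mem_uIcc₂ (E : ReturnExtension f c A B σ N x₁ x₂ x₃ x₄) : x₂ ∈ uIcc x₁ x₃ := by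
  rcases E.ordered with ⟨h1, h2, h3⟩ | ⟨h1, h2, h3⟩
  · exact Set.mem_uIcc.2 (Or.inl ⟨h1.le, h2.le⟩)
  · exact Set.mem_uIcc.2 (Or.inr ⟨h2.le, h3.le⟩)

lemma isEnds (E : ReturnExtension f c A B σ N x₁ x₂ x₃ x₄) (W : WanderingSequence f c A B)
    (h : IsTent f c) (i : ℕ) : IsEnds A B i (f^[i] x₂) (f^[i] x₃) := by
  have := W.isEnds_iterate h E.ends i
  rwa [zero_add] at this

lemma image_outer (E : ReturnExtension f c A B σ N x₁ x₂ x₃ x₄) (h : IsTent f c) {i : ℕ}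
    (hi : i ≤ N + 1) : f^[i] '' uIcc x₁ x₃ = uIcc (f^[i] x₁) (f^[i] x₃) :=
  h.image_iterate_uIcc E.mem₁ E.mem₃ (IsTent.injOn_iterate_of_le hi E.injOn_outer)

lemma subset_outer (E : ReturnExtension f c A B σ N x₁ x₂ x₃ x₄) (W : WanderingSequence f c A B)
    (h : IsTent f c) {i : ℕ} (hi : i ≤ N + 1) :
    Icc (A i) (B i) ⊆ uIcc (f^[i] x₁) (f^[i] x₃) := by
  rw [← W.uIcc_eq (E.isEnds W h i), ← E.image_outer h hi]
  rw [E.image_outer h hi]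
  refine uIcc_subset_uIcc ?_ right_mem_uIcc
  rw [← E.image_outer h hi]
  exact mem_image_of_mem _ E.mem_uIcc₂

/-- An image of the outer hull contains no later interval. -/
lemma not_subset_of_lt (E : ReturnExtension f c A B σ N x₁ x₂ x₃ x₄) (W : WanderingSequence f c A B)
    (h : IsTent f c) (R : ConsecutiveRecords B σ (N + 1)) {i i' : ℕ} (hii : i < i') (hi' : i' ≤ N + 1) :
    ¬ Icc (A i') (B i') ⊆ uIcc (f^[i] x₁) (f^[i] x₃) := by
  intro hs
  obtain ⟨s, hs'⟩ : ∃ s, N + 1 = i' + s := ⟨N + 1 - i', by omega⟩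
  obtain ⟨p, hp⟩ : ∃ p, i' = i + p := ⟨i' - i, by omega⟩
  have hr : (i + s) + p = N + 1 := by omega
  have hH : Icc (A (N + 1)) (B (N + 1)) ⊆ uIcc (f^[i + s] x₁) (f^[i + s] x₃) := by
    rw [hs', ← W.iterate_image, ← E.image_outer h (by omega : i + s ≤ N + 1)]
    rw [← E.image_outer h (by omega : i ≤ N + 1)] at hs
    refine (image_mono hs).trans ?_
    rw [← image_comp, ← Function.iterate_add, add_comm]
  have hr' := E.subset_outer W h (by omega : i + s ≤ N + 1)
  have hσ := W.right_le R
  have hlt := W.lt σ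
  have hltN := W.lt (N + 1)
  have hAr : A (i + s) ≤ A σ := W.left_le_left R (by omega)
  have hltr := W.lt (i + s)
  have hbig : Icc (A σ) (B (N + 1)) ⊆ uIcc (f^[i + s] x₁) (f^[i + s] x₃) :=
    (Icc_subset_Icc_left hAr).trans
      (ordConnected_uIcc.out (hr' ⟨le_rfl, hltr.le⟩) (hH ⟨hltN.le, le_rfl⟩))
  have hinj : InjOn f^[p] (uIcc (f^[i + s] x₁) (f^[i + s] x₃)) := by
    rw [← E.image_outer h (by omega : i + s ≤ N + 1)]
    apply IsTent.injOn_image_iterate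
    rw [hr]; exact E.injOn_outer
  refine W.not_selfMap' h (by omega) (h.iterate_mapsTo _ E.mem₁) (h.iterate_mapsTo _ E.mem₃) hinj ?_ hr'
  rw [← Function.iterate_add_apply, ← Function.iterate_add_apply, add_comm p, hr, E.map₁, E.map₃,
    uIcc_of_le (by linarith)]
  exact hbig

/-- An image of the outer hull contains at most one earlier interval. -/
lemma eq_of_subset (E : ReturnExtension f c A B σ N x₁ x₂ x₃ x₄) (W : WanderingSequence f c A B)
    (h : IsTent f c) (R : ConsecutiveRecords B σ (N + 1)) {i i' : ℕ} (hii : i' < i) (hi : i ≤ N + 1)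
    (hs : Icc (A i') (B i') ⊆ uIcc (f^[i] x₁) (f^[i] x₃)) : i = i' + (N + 1 - σ) := by
  obtain ⟨s, hs'⟩ : ∃ s, N + 1 = i + s := ⟨N + 1 - i, by omega⟩
  by_contra hne
  have hσ' := R.lt
  have hσ := W.right_le R
  have hlt := W.lt σ
  have hltN := W.lt (N + 1)
  have hu := W.le_left R (j := i' + s) (by omega) (by omega)
  have hsub : Icc (A (i' + s)) (B (i' + s)) ⊆ Icc (A σ) (B (N + 1)) := by
    rw [← uIcc_of_le (by linarith : A σ ≤ B (N + 1)), ← E.map₁, ← E.map₃, ← E.image_outer h le_rfl,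
      ← W.iterate_image]
    rw [← E.image_outer h hi] at hs
    refine (image_mono hs).trans ?_
    rw [← image_comp, ← Function.iterate_add, add_comm, ← hs']
  have hl := W.lt (i' + s)
  linarith [(hsub ⟨le_rfl, hl.le⟩).1]

lemma iterate_notMem (E : ReturnExtension f c A B σ N x₁ x₂ x₃ x₄) (W : WanderingSequence f c A B)
    (h : IsTent f c) {i i' : ℕ} (hi : i ≤ N + 1) : f^[i] x₁ ∉ Ioo (A i') (B i') := by
  intro hx
  have := W.iterate_mem_Ioo h hx (N + 1 - i)
  rw [← Function.iterate_add_apply, Nat.sub_add_cancel hi, E.map₁] at this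
  exact W.isEnds_notMem (Or.inl ⟨rfl, rfl⟩ : IsEnds A B σ _ _) this

lemma not_subset (E : ReturnExtension f c A B σ N x₁ x₂ x₃ x₄) (W : WanderingSequence f c A B)
    (h : IsTent f c) (R : ConsecutiveRecords B σ (N + 1)) {i i' : ℕ} (hi : i ≤ N + 1)
    (hi' : i' ≤ N + 1) (hne : i ≠ i') (hpar : i / (N + 1 - σ) % 2 = i' / (N + 1 - σ) % 2) :
    ¬ Icc (A i') (B i') ⊆ uIcc (f^[i] x₁) (f^[i] x₃) := by
  intro hs
  rcases lt_or_gt_of_ne hne with hlt | hlt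
  · exact E.not_subset_of_lt W h R hlt hi' hs
  · have h1 := E.eq_of_subset W h R hlt hi hs
    have h2 := R.lt
    rw [h1, Nat.add_div_right _ (by omega)] at hpar
    omega

lemma orientation (E : ReturnExtension f c A B σ N x₁ x₂ x₃ x₄) (W : WanderingSequence f c A B)
    (h : IsTent f c) {i : ℕ} (hi : i ≤ N + 1) :
    (f^[i] x₁ ≤ f^[i] x₃ → f^[i] x₁ ≤ A i ∧ f^[i] x₃ = B i) ∧
    (f^[i] x₃ ≤ f^[i] x₁ → B i ≤ f^[i] x₁ ∧ f^[i] x₃ = A i) := by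
  have h1 := mem_image_of_mem f^[i] E.mem_uIcc₂
  rw [E.image_outer h hi] at h1
  have h2 := E.isEnds W h i
  have h3 := W.lt i
  constructor
  · intro h4
    rw [uIcc_of_le h4] at h1
    rcases h2 with ⟨h5, h6⟩ | ⟨h5, h6⟩
    · exact ⟨h5 ▸ h1.1, h6⟩
    · linarith [h1.2]
  · intro h4
    rw [uIcc_of_ge h4] at h1
    rcases h2 with ⟨h5, h6⟩ | ⟨h5, h6⟩
    · linarith [h1.1]
    · exact ⟨h5 ▸ h1.2, h6⟩

theorem sum_le_four (E : ReturnExtension f c A B σ N x₁ x₂ x₃ x₄) (W : WanderingSequence f c A B)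
    (h : IsTent f c) (R : ConsecutiveRecords B σ (N + 1)) :
    ∑ i ∈ Finset.range (N + 2), |f^[i] x₃ - f^[i] x₁| ≤ 4 := by
  classical
  set g : ℕ → Bool × Bool := fun i =>
    (decide (f^[i] x₁ ≤ f^[i] x₃), decide (i / (N + 1 - σ) % 2 = 0)) with hg
  rw [← Finset.sum_fiberwise (Finset.range (N + 2)) g]
  have key : ∀ b : Bool × Bool, ∑ i ∈ Finset.range (N + 2) with g i = b, |f^[i] x₃ - f^[i] x₁| ≤ 1 := by
    intro b
    have hdis : ∀ i i', i ≤ N + 1 → i' ≤ N + 1 → i ≠ i' → g i = g i' → B i' ≤ A i →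
        Disjoint (Ioo (min (f^[i] x₁) (f^[i] x₃)) (max (f^[i] x₁) (f^[i] x₃)))
          (Ioo (min (f^[i'] x₁) (f^[i'] x₃)) (max (f^[i'] x₁) (f^[i'] x₃))) := by
      intro i i' hi hi' hne hgi hle
      simp only [hg, Prod.mk.injEq, decide_eq_decide] at hgi
      obtain ⟨hor, hpar⟩ := hgi
      have hpar' : i / (N + 1 - σ) % 2 = i' / (N + 1 - σ) % 2 := by omega
      have hlt := W.lt i
      have hlt' := W.lt i'
      rw [disjoint_left]
      intro x hx hx'
      rcases le_total (f^[i] x₁) (f^[i] x₃) with h1 | h1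
      · have h1' := hor.1 h1
        obtain ⟨k1, k2⟩ := (E.orientation W h hi).1 h1
        obtain ⟨k3, k4⟩ := (E.orientation W h hi').1 h1'
        rw [min_eq_left h1, max_eq_right h1] at hx
        rw [min_eq_left h1', max_eq_right h1', k4] at hx'
        have k5 : f^[i] x₁ ≤ A i' := by
          by_contra! k5
          exact E.iterate_notMem W h hi ⟨k5, hx.1.trans hx'.2⟩
        refine E.not_subset W h R hi hi' hne hpar' ?_
        rw [uIcc_of_le h1, k2]
        exact Icc_subset_Icc k5 (by linarith)
      · rcases h1.eq_or_lt with h0 | h1s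
        · rw [h0, min_self, max_self] at hx
          exact lt_asymm hx.1 hx.2
        have h1' : f^[i'] x₃ ≤ f^[i'] x₁ := by
          by_contra! hcon
          exact absurd (hor.2 hcon.le) (not_le.2 h1s)
        obtain ⟨k1, k2⟩ := (E.orientation W h hi).2 h1
        obtain ⟨k3, k4⟩ := (E.orientation W h hi').2 h1'
        rw [min_eq_right h1, max_eq_left h1, k2] at hx
        rw [min_eq_right h1', max_eq_left h1'] at hx'
        have k5 : B i ≤ f^[i'] x₁ := by
          by_contra! k5
          exact E.iterate_notMem W h hi' ⟨hx.1.trans hx'.2, k5⟩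
        refine E.not_subset W h R hi' hi hne.symm hpar'.symm ?_
        rw [uIcc_of_ge h1', k4]
        exact Icc_subset_Icc (by linarith) k5
    have := sum_length_le_one (Finset.filter (fun i => g i = b) (Finset.range (N + 2)))
      (fun i => min (f^[i] x₁) (f^[i] x₃)) (fun i => max (f^[i] x₁) (f^[i] x₃))
      (fun i _ => min_le_max) (fun i _ => IsTent.uIcc_subset (h.iterate_mapsTo i E.mem₁)
        (h.iterate_mapsTo i E.mem₃)) (fun i hi j hj hij => by
        simp only [Finset.mem_filter, Finset.mem_range] at hi hj
        rcases W.le_or_le hij with h1 | h1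
        · exact (hdis j i (by omega) (by omega) hij.symm (by rw [hi.2, hj.2]) h1).symm
        · exact hdis i j (by omega) (by omega) hij (by rw [hi.2, hj.2]) h1)
    refine le_trans (le_of_eq (Finset.sum_congr rfl fun i _ => ?_)) this
    rw [max_sub_min_eq_abs]
  refine (Finset.sum_le_card_nsmul _ _ 1 fun b _ => key b).trans ?_
  simp

end ReturnExtension

end

/-- The map `f^[q+1]` folds the interval `[A σ, f c]` at the point `e`. -/
structure FoldedReturn (f : ℝ → ℝ) (c : ℝ) (A B : ℕ → ℝ) (σ q : ℕ) (e : ℝ) : Prop where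
  lt_left : B σ < e
  lt_right : e < f c
  map : f^[q] e = c
  injOn : InjOn f^[q] (uIcc (A σ) (f c))
  strictMonoOn : StrictMonoOn f^[q + 1] (Icc (A σ) e)
  iterate_le : ∀ r, 0 < r → r ≤ q → ∀ x ∈ Icc (A σ) (f c), f^[r] x ≤ A σ
  left_lt : ∀ x ∈ Icc (A σ) (f c), A σ < f^[q + 1] x
  sum_le : ∑ i ∈ Finset.range (q + 1), |f^[i] (f c) - f^[i] (A σ)| ≤ 1
  value_lt : f^[q + 1] (f c) < e
  escape : f^[q + 1] (f^[q + 1] (f c)) < e ∨ e < f^[q + 1] (f^[q + 1] (f^[q + 1] (f c)))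

section

variable {f : ℝ → ℝ} {c : ℝ} {A B : ℕ → ℝ} {σ q : ℕ} {x₁ x₂ x₃ x₄ : ℝ}

lemma IsTent.lt_of_mem_uIcc (h : IsTent f c) {a b y v : ℝ} (ha : a ∈ Icc (0 : ℝ) 1)
    (hb : b ∈ Icc (0 : ℝ) 1) (hy : y ∈ uIcc a b) (hva : v < f a) (hvb : v < f b) : v < f y := by
  wlog hab : a ≤ b generalizing a b
  · exact this hb ha (by rwa [uIcc_comm]) hvb hva (le_of_not_ge hab)
  rw [uIcc_of_le hab] at hy
  rcases le_total y c with h1 | h1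
  · exact hva.trans_le
      (h.strictMonoOn.monotoneOn ⟨ha.1, hy.1.trans h1⟩ ⟨ha.1.trans hy.1, h1⟩ hy.1)
  · exact hvb.trans_le
      (h.strictAntiOn.antitoneOn ⟨h1, hy.2.trans hb.2⟩ ⟨h1.trans hy.2, hb.2⟩ hy.2)

namespace WanderingSequence

lemma iterate_value_notMem (W : WanderingSequence f c A B) (h : IsTent f c) (r j : ℕ) :
    f^[r] (f c) ∉ Ioo (A j) (B j) := by
  intro hmem
  have hev : ∀ᶠ y in 𝓝[Icc 0 1] (f c), f^[r] y ∈ Ioo (A j) (B j) :=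
    (h.iterate_continuousOn r _ h.value_mem).eventually (isOpen_Ioo.mem_nhds hmem)
  obtain ⟨ε, hε, hball⟩ := Metric.mem_nhdsWithin_iff.1 hev
  obtain ⟨i, hi⟩ := W.approach ε hε
  have hlt := W.lt_value i
  have h1 : f^[r] (B i) ∈ Ioo (A j) (B j) := by
    refine hball ⟨?_, W.right_mem i⟩
    rw [Metric.mem_ball, Real.dist_eq, abs_lt]
    constructor <;> linarith
  exact W.isEnds_notMem (W.isEnds_iterate h (Or.inr ⟨rfl, rfl⟩ : IsEnds A B i (B i) _) r) h1

lemma not_selfMap_value (W : WanderingSequence f c A B) (h : IsTent f c) {u : ℝ} {p : ℕ} (hp : 1 ≤ p)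
    (hu : u ∈ Icc (0 : ℝ) 1) (huc : u < f c) (hi : InjOn f^[p] (uIcc u (f c)))
    (h1 : u ≤ f^[p] u) (h2 : u ≤ f^[p] (f c)) : False := by
  obtain ⟨i, hiu⟩ := W.approach (f c - u) (by linarith)
  have hlt := W.lt_value i
  obtain ⟨x, hx⟩ := exists_between (max_lt (W.lt i) (by linarith : u < B i))
  have hx' := max_lt_iff.1 hx.1
  have hval : ∀ y ∈ Icc (0 : ℝ) 1, f^[p] y ≤ f c := by
    intro y hy
    obtain ⟨p', rfl⟩ := Nat.exists_eq_add_of_le' hp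
    rw [Function.iterate_succ_apply']
    exact h.le (h.iterate_mapsTo p' hy)
  refine W.not_selfMap h hp hu h.value_mem hi ?_ ⟨hx'.1, hx.2⟩ ?_
  · rw [uIcc_of_le huc.le]
    exact ordConnected_Icc.uIcc_subset ⟨h1, hval u hu⟩ ⟨h2, hval _ h.value_mem⟩
  · rw [uIcc_of_le huc.le]
    exact ⟨hx'.2.le, by linarith [hx.2]⟩

end WanderingSequence

namespace ReturnExtension

lemma fold_ends (E : ReturnExtension f c A B σ (σ + q) x₁ x₂ x₃ x₄) (W : WanderingSequence f c A B)
    (h : IsTent f c) (hx : f^[σ] x₄ = f c) :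
    f^[σ] x₂ = A σ ∧ f^[σ] x₃ = B σ ∧ f^[σ] x₁ ≤ A σ ∧ InjOn f^[q] (uIcc (f^[σ] x₁) (f c)) := by
  have hlt := W.lt σ
  have hv := W.lt_value σ
  have hinj : InjOn f^[σ] (uIcc x₁ x₄) := IsTent.injOn_iterate_of_le (Nat.le_add_right σ q) E.injOn
  have h1 : f^[σ] x₃ ∈ uIcc (f^[σ] x₂) (f^[σ] x₄) := by
    refine h.iterate_mem_uIcc E.mem₂ E.mem₄ (hinj.mono (uIcc_subset_uIcc E.ordered.mem.1 right_mem_uIcc)) ?_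
    rcases E.ordered with ⟨g1, g2, g3⟩ | ⟨g1, g2, g3⟩
    · exact Set.mem_uIcc.2 (Or.inl ⟨g2.le, g3.le⟩)
    · exact Set.mem_uIcc.2 (Or.inr ⟨g1.le, g2.le⟩)
  have h2 : f^[σ] x₂ = A σ ∧ f^[σ] x₃ = B σ := by
    rcases E.isEnds W h σ with g | ⟨g1, g2⟩
    · exact g
    · rw [hx, g1, g2, uIcc_of_le hv.le] at h1
      linarith [h1.1]
  refine ⟨h2.1, h2.2, ?_, ?_⟩
  · have h3 := h.iterate_mem_uIcc E.mem₁ E.mem₄ hinj E.ordered.mem.1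
    rw [h2.1, hx] at h3
    rcases Set.mem_uIcc.1 h3 with g | g
    · exact g.1
    · linarith [g.1]
  · rw [← hx, ← h.image_iterate_uIcc E.mem₁ E.mem₄ hinj]
    exact IsTent.injOn_image_iterate E.injOn

theorem exists_foldedReturn (E : ReturnExtension f c A B σ (σ + q) x₁ x₂ x₃ x₄)
    (W : WanderingSequence f c A B) (h : IsTent f c) (R : ConsecutiveRecords B σ (σ + q + 1))
    (hx : f^[σ] x₄ = f c) (hx' : A σ < f^[σ + q + 1] x₄) : ∃ e, FoldedReturn f c A B σ q e := by
  obtain ⟨e1, e2, e3, e4⟩ := E.fold_ends W h hx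
  have hlt := W.lt σ
  have hv := W.lt_value σ
  have hAm := W.left_mem σ
  have hBm := W.right_mem σ
  have hσ := W.right_le R
  have hvN := W.lt_value (σ + q + 1)
  have hltN := W.lt (σ + q + 1)
  have hAfc : uIcc (A σ) (f c) = Icc (A σ) (f c) := uIcc_of_le (by linarith)
  have hinj : InjOn f^[q] (uIcc (A σ) (f c)) := by
    refine e4.mono (uIcc_subset_uIcc ?_ right_mem_uIcc)
    exact Set.mem_uIcc.2 (Or.inl ⟨e3, by linarith⟩)
  have k1 : f^[q] (A σ) = f^[σ + q] x₂ := by rw [← e1, ← Function.iterate_add_apply, add_comm]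
  have k2 : f^[q] (B σ) = f^[σ + q] x₃ := by rw [← e2, ← Function.iterate_add_apply, add_comm]
  have k3 : f^[q] (f c) = f^[σ + q] x₄ := by rw [← hx, ← Function.iterate_add_apply, add_comm]
  have hFA : f^[q + 1] (A σ) = A (σ + q + 1) := by
    rw [Function.iterate_succ_apply', k1, ← Function.iterate_succ_apply' f, E.map₂]
  have hIc : Icc (A σ) (f c) ⊆ Icc 0 1 := Icc_subset_Icc hAm.1 h.value_mem.2
  have left_lt : ∀ x ∈ Icc (A σ) (f c), A σ < f^[q + 1] x := by
    intro x hx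
    have hm := h.iterate_mem_uIcc hAm h.value_mem hinj (hAfc ▸ hx)
    rw [Function.iterate_succ_apply']
    refine h.lt_of_mem_uIcc (h.iterate_mapsTo q hAm) (h.iterate_mapsTo q h.value_mem) hm ?_ ?_
    · rw [← Function.iterate_succ_apply' f, hFA]; linarith
    · rw [k3, ← Function.iterate_succ_apply' f]; exact hx'
  have iterate_le : ∀ r, 0 < r → r ≤ q → ∀ x ∈ Icc (A σ) (f c), f^[r] x ≤ A σ := by
    intro r hr hrq x hx
    have hinjr := IsTent.injOn_iterate_of_le hrq hinj
    have himg := h.image_iterate_uIcc hAm h.value_mem hinjr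
    have hAr : f^[r] (A σ) ≤ A σ := by
      have h1 := W.le_left R (j := σ + r) (by omega) (by omega)
      have h2 := W.lt (σ + r)
      rcases W.isEnds_iterate h (Or.inl ⟨rfl, rfl⟩ : IsEnds A B σ _ _) r with ⟨g, -⟩ | ⟨g, -⟩ <;>
        linarith
    have hcr : f^[r] (f c) ≤ A σ := by
      by_contra! hcon
      have h1 : B σ ≤ f^[r] (f c) := by
        by_contra! h1
        exact W.iterate_value_notMem h r σ ⟨hcon, h1⟩
      have h2 : Icc (A σ) (B σ) ⊆ f^[r] '' Icc (A σ) (f c) := by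
        rw [← hAfc, himg, uIcc_of_le (by linarith)]
        exact Icc_subset_Icc hAr h1
      have h3 : A (σ + (q + 1 - r)) ∈ f^[q + 1 - r] '' Icc (A σ) (B σ) := by
        rw [W.iterate_image]; exact ⟨le_rfl, (W.lt _).le⟩
      obtain ⟨y, hy, hyA⟩ := h3
      obtain ⟨z, hz, rfl⟩ := h2 hy
      rw [← Function.iterate_add_apply, Nat.sub_add_cancel (by omega)] at hyA
      have h4 := left_lt z hz
      have h5 := W.le_left R (j := σ + (q + 1 - r)) (by omega) (by omega)
      linarith [W.lt (σ + (q + 1 - r))]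
    have hm := h.iterate_mem_uIcc hAm h.value_mem hinjr (hAfc ▸ hx)
    rcases Set.mem_uIcc.1 hm with g | g
    · linarith [g.2]
    · linarith [g.2]
  have sum_le : ∑ i ∈ Finset.range (q + 1), |f^[i] (f c) - f^[i] (A σ)| ≤ 1 := by
    have himg : ∀ i ≤ q, f^[i] '' Icc (A σ) (f c) = uIcc (f^[i] (A σ)) (f^[i] (f c)) := fun i hi => by
      rw [← hAfc]
      exact h.image_iterate_uIcc hAm h.value_mem (IsTent.injOn_iterate_of_le hi hinj)
    have hdis : ∀ i i', i < i' → i' ≤ q → Disjoint (uIcc (f^[i] (A σ)) (f^[i] (f c)))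
        (uIcc (f^[i'] (A σ)) (f^[i'] (f c))) := by
      intro i i' hii hi'
      rw [← himg i (by omega), ← himg i' hi', disjoint_left]
      rintro _ ⟨x, hx, rfl⟩ ⟨y, hy, hxy⟩
      have h1 := congrArg f^[q + 1 - i'] hxy
      rw [← Function.iterate_add_apply, ← Function.iterate_add_apply,
        Nat.sub_add_cancel (by omega)] at h1
      have h2 := left_lt y hy
      have h3 := iterate_le (q + 1 - i' + i) (by omega) (by omega) x hx
      linarith
    have := sum_length_le_one (Finset.range (q + 1))
      (fun i => min (f^[i] (A σ)) (f^[i] (f c))) (fun i => max (f^[i] (A σ)) (f^[i] (f c)))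
      (fun i _ => min_le_max) (fun i _ => IsTent.uIcc_subset (h.iterate_mapsTo i hAm)
        (h.iterate_mapsTo i h.value_mem)) (fun i hi j hj hij => by
        simp only [Finset.mem_range] at hi hj
        refine Disjoint.mono Ioo_subset_Icc_self Ioo_subset_Icc_self ?_
        rcases lt_or_gt_of_ne hij with h1 | h1
        · exact hdis i j h1 (by omega)
        · exact (hdis j i h1 (by omega)).symm)
    refine le_trans (le_of_eq (Finset.sum_congr rfl fun i _ => ?_)) this
    rw [max_sub_min_eq_abs]
  have hBfc : uIcc (B σ) (f c) ⊆ uIcc (A σ) (f c) :=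
    uIcc_subset_uIcc (hAfc ▸ ⟨hlt.le, hv.le⟩) right_mem_uIcc
  obtain ⟨e, he, hec⟩ : c ∈ f^[q] '' uIcc (B σ) (f c) := by
    rw [h.image_iterate_uIcc hBm h.value_mem (hinj.mono hBfc), k2, k3]
    exact E.mem_uIcc
  rw [uIcc_of_le hv.le] at he
  have heB : B σ < e := by
    refine lt_of_le_of_ne he.1 fun hBe => ?_
    have h1 := W.notMem (σ + q)
    rw [← W.uIcc_eq (E.isEnds W h (σ + q)), ← k2, hBe, hec] at h1
    exact h1 right_mem_uIcc
  have hefc : e < f c := by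
    refine lt_of_le_of_ne he.2 fun hee => ?_
    have h1 := E.ne
    rw [← k3, ← hee, hec] at h1
    exact h1 rfl
  have hem : e ∈ Icc (0 : ℝ) 1 := hIc ⟨by linarith, he.2⟩
  have hFe : f^[q + 1] e = f c := by rw [Function.iterate_succ_apply', hec]
  have hFle : ∀ x ∈ Icc (0 : ℝ) 1, f^[q + 1] x ≤ f c := fun x hx => by
    rw [Function.iterate_succ_apply']; exact h.le (h.iterate_mapsTo q hx)
  have hinj1 : InjOn f^[q + 1] (uIcc (A σ) e) := by
    refine h.injOn_iterate_succ hAm hem (hinj.mono ?_) ?_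
    · exact uIcc_subset_uIcc left_mem_uIcc (hAfc ▸ ⟨by linarith, he.2⟩)
    · rw [hec]; rcases le_total (f^[q] (A σ)) c with g | g
      · exact Or.inl ⟨g, le_rfl⟩
      · exact Or.inr ⟨g, le_rfl⟩
  have hinj2 : InjOn f^[q + 1] (uIcc e (f c)) := by
    refine h.injOn_iterate_succ hem h.value_mem (hinj.mono ?_) ?_
    · exact uIcc_subset_uIcc (hAfc ▸ ⟨by linarith, he.2⟩) right_mem_uIcc
    · rw [hec]; rcases le_total (f^[q] (f c)) c with g | g
      · exact Or.inl ⟨le_rfl, g⟩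
      · exact Or.inr ⟨le_rfl, g⟩
  have hAe : uIcc (A σ) e = Icc (A σ) e := uIcc_of_le (by linarith)
  have hefc' : uIcc e (f c) = Icc e (f c) := uIcc_of_le hefc.le
  have hmono : StrictMonoOn f^[q + 1] (Icc (A σ) e) := by
    rw [← hAe]
    rcases strictMonoOn_or_strictAntiOn_uIcc
      ((h.iterate_continuousOn (q + 1)).mono (IsTent.uIcc_subset hAm hem)) hinj1 with g | g
    · exact g
    · have := g left_mem_uIcc right_mem_uIcc (by linarith)
      linarith
  have hanti : StrictAntiOn f^[q + 1] (Icc e (f c)) := by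
    rw [← hefc']
    rcases strictMonoOn_or_strictAntiOn_uIcc
      ((h.iterate_continuousOn (q + 1)).mono (IsTent.uIcc_subset hem h.value_mem)) hinj2 with g | g
    · have := g left_mem_uIcc right_mem_uIcc hefc
      linarith [hFle _ h.value_mem]
    · exact g
  have value_lt : f^[q + 1] (f c) < e := by
    by_contra! hcon
    exact W.not_selfMap_value h (by omega) hem hefc hinj2 (by rw [hFe]; exact hefc.le) hcon
  refine ⟨e, heB, hefc, hec, hinj, hmono, iterate_le, left_lt, sum_le, value_lt, ?_⟩
  by_contra! hcon
  obtain ⟨hc1, hc2⟩ := hcon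
  set v := f^[q + 1] (f c) with hvdef
  set u := f^[q + 1] v with hu
  have hAv : A σ < v := left_lt _ ⟨by linarith, le_rfl⟩
  have hvm : v ∈ Icc (A σ) e := ⟨hAv.le, value_lt.le⟩
  have hum : u < f c := by
    have := hmono hvm ⟨by linarith, le_rfl⟩ value_lt
    rwa [hFe] at this
  have hAu : A σ < f^[q + 1] u := left_lt u ⟨by linarith, hum.le⟩
  have huv : v ≤ f^[q + 1] u := hanti.antitoneOn ⟨hc1, hum.le⟩ ⟨hefc.le, le_rfl⟩ hum.le
  have huI : u ∈ Icc (0 : ℝ) 1 := hIc ⟨by linarith, hum.le⟩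
  refine W.not_selfMap_value h (p := (q + 1) + (q + 1)) (by omega) huI hum ?_ ?_ ?_
  · rw [Function.iterate_add]
    have hsub : uIcc u (f c) ⊆ uIcc e (f c) := uIcc_subset_uIcc (hefc' ▸ ⟨hc1, hum.le⟩) right_mem_uIcc
    refine InjOn.comp (t := f^[q + 1] '' uIcc u (f c)) ?_ (hinj2.mono hsub) (mapsTo_image _ _)
    rw [h.image_iterate_uIcc huI h.value_mem (hinj2.mono hsub)]
    exact hinj1.mono (hAe ▸ ordConnected_Icc.uIcc_subset ⟨hAu.le, hc2⟩ hvm)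
  · rw [Function.iterate_add_apply]
    exact hmono.monotoneOn hvm ⟨hAu.le, hc2⟩ huv
  · rw [Function.iterate_add_apply]

end ReturnExtension

end

/-! ### Cross-ratio estimates along the extensions -/

lemma Ordered4.le_crossRatio {a b c d : ℝ} (h : Ordered4 a b c d) :
    |c - b| / |d - c| ≤ crossRatio a b c d ∧ |c - b| / |b - a| ≤ crossRatio a b c d := by
  obtain ⟨h1, h2, h3, h4, h5⟩ := h.abs_add
  unfold crossRatio
  constructor
  · rw [div_le_div_iff₀ h5 (by positivity), h1]
    nlinarith [mul_pos h4 h5, mul_pos (mul_pos h4 h5) h4, mul_pos (mul_pos h4 h5) h5]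
  · rw [div_le_div_iff₀ h3 (by positivity), h1]
    nlinarith [mul_pos h3 h4, mul_pos (mul_pos h3 h4) h3, mul_pos (mul_pos h3 h4) h4]

/-- `S` and `S'` are the two monotonicity branches of a unimodal map with critical point `c`. -/
def IsBranchPair (c : ℝ) (S S' : Set ℝ) : Prop :=
  (S = Icc 0 c ∧ S' = Icc c 1) ∨ (S = Icc c 1 ∧ S' = Icc 0 c)

section

variable {f : ℝ → ℝ} {c l l' K M ε : ℝ} {A B : ℕ → ℝ} {σ N : ℕ} {x₁ x₂ x₃ x₄ : ℝ} {S S' : Set ℝ}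

lemma IsTent.crossRatio_iterate_le (h : IsTent f c) (hS : IsBranchPair c S S')
    (b : BranchEstimates f c l S K M ε) (b' : BranchEstimates f c l' S' K M ε) {n : ℕ}
    (hx : Ordered4 x₁ x₂ x₃ x₄) (h₁ : x₁ ∈ Icc (0 : ℝ) 1) (h₄ : x₄ ∈ Icc (0 : ℝ) 1)
    (hi : InjOn f^[n] (uIcc x₁ x₄)) :
    Real.exp (-(K * ∑ i ∈ Finset.range n,
      (|f^[i] x₃ - f^[i] x₁| + |f^[i + 1] x₃ - f^[i + 1] x₁|))) * crossRatio x₁ x₂ x₃ x₄ ≤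
      crossRatio (f^[n] x₁) (f^[n] x₂) (f^[n] x₃) (f^[n] x₄) := by
  induction n with
  | zero => simp
  | succ n ih =>
    have hin := IsTent.injOn_iterate_of_le (Nat.le_succ n) hi
    have ih := ih hin
    have hord := hx.image ((h.iterate_continuousOn n).mono (IsTent.uIcc_subset h₁ h₄)) hin
    have hinj : InjOn f (uIcc (f^[n] x₁) (f^[n] x₄)) := by
      rw [← h.image_iterate_uIcc h₁ h₄ hin]
      exact IsTent.injOn_image_iterate (n := 1) hi
    have hsub := h.subset_of_injOn ordConnected_uIcc
      (IsTent.uIcc_subset (h.iterate_mapsTo n h₁) (h.iterate_mapsTo n h₄)) hinj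
    have hstep : Real.exp (-(K * (|f^[n] x₃ - f^[n] x₁| + |f^[n + 1] x₃ - f^[n + 1] x₁|))) *
        crossRatio (f^[n] x₁) (f^[n] x₂) (f^[n] x₃) (f^[n] x₄) ≤
        crossRatio (f^[n + 1] x₁) (f^[n + 1] x₂) (f^[n + 1] x₃) (f^[n + 1] x₄) := by
      simp only [Function.iterate_succ_apply']
      rcases hS with ⟨rfl, rfl⟩ | ⟨rfl, rfl⟩ <;> rcases hsub with hs | hs
      · exact b.crossRatio_le _ _ _ _ hord (hs left_mem_uIcc) (hs right_mem_uIcc)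
      · exact b'.crossRatio_le _ _ _ _ hord (hs left_mem_uIcc) (hs right_mem_uIcc)
      · exact b'.crossRatio_le _ _ _ _ hord (hs left_mem_uIcc) (hs right_mem_uIcc)
      · exact b.crossRatio_le _ _ _ _ hord (hs left_mem_uIcc) (hs right_mem_uIcc)
    refine le_trans ?_ hstep
    rw [Finset.sum_range_succ, mul_add, neg_add, add_comm, Real.exp_add, mul_assoc]
    exact mul_le_mul_of_nonneg_left ih (Real.exp_pos _).le

namespace ReturnExtension

lemma ordered_iterate (E : ReturnExtension f c A B σ N x₁ x₂ x₃ x₄) (h : IsTent f c) {t : ℕ} (ht : t ≤ N) :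
    Ordered4 (f^[t] x₁) (f^[t] x₂) (f^[t] x₃) (f^[t] x₄) :=
  E.ordered.image ((h.iterate_continuousOn t).mono (IsTent.uIcc_subset E.mem₁ E.mem₄))
    (IsTent.injOn_iterate_of_le ht E.injOn)

lemma crossRatio_le (E : ReturnExtension f c A B σ N x₁ x₂ x₃ x₄) (W : WanderingSequence f c A B)
    (h : IsTent f c) (R : ConsecutiveRecords B σ (N + 1)) (hS : IsBranchPair c S S') (hK : 0 ≤ K)
    (b : BranchEstimates f c l S K M ε) (b' : BranchEstimates f c l' S' K M ε) {t : ℕ} (ht : t ≤ N) :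
    Real.exp (-(8 * K)) * crossRatio (f^[t] x₁) (f^[t] x₂) (f^[t] x₃) (f^[t] x₄) ≤
      crossRatio (f^[N] x₁) (f^[N] x₂) (f^[N] x₃) (f^[N] x₄) := by
  have hit := IsTent.injOn_iterate_of_le ht E.injOn
  have hinj : InjOn f^[N - t] (uIcc (f^[t] x₁) (f^[t] x₄)) := by
    rw [← h.image_iterate_uIcc E.mem₁ E.mem₄ hit]
    apply IsTent.injOn_image_iterate
    rw [Nat.add_sub_cancel' ht]
    exact E.injOn
  have h1 := h.crossRatio_iterate_le hS b b' (E.ordered_iterate h ht) (h.iterate_mapsTo t E.mem₁)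
    (h.iterate_mapsTo t E.mem₄) hinj
  simp only [← Function.iterate_add_apply, Nat.sub_add_cancel ht] at h1
  refine le_trans (mul_le_mul_of_nonneg_right ?_ (E.ordered_iterate h ht).crossRatio_pos.le) h1
  rw [Real.exp_le_exp, neg_le_neg_iff, mul_comm 8]
  refine mul_le_mul_of_nonneg_left ?_ hK
  have h4 := E.sum_le_four W h R
  have hpos : ∀ i, 0 ≤ |f^[i] x₃ - f^[i] x₁| := fun i => abs_nonneg _
  rw [Finset.sum_add_distrib]
  have s1 : ∑ i ∈ Finset.range (N - t), |f^[i + t] x₃ - f^[i + t] x₁| ≤ 4 := by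
    refine le_trans ?_ h4
    rw [Finset.sum_nbij (s := Finset.range (N - t)) (t := Finset.Ico t N) (fun i => i + t)
      (g := fun i => |f^[i] x₃ - f^[i] x₁|)
      (fun i hi => by simp only [Finset.mem_range, Finset.mem_Ico] at *; omega)
      (fun i _ j _ hij => by simpa using hij)
      (fun i hi => by
        simp only [Finset.coe_Ico, mem_Ico] at hi
        exact ⟨i - t, by simp only [Finset.coe_range, mem_Iio]; omega, by dsimp only; omega⟩)
      (fun i _ => rfl)]
    refine Finset.sum_le_sum_of_subset_of_nonneg ?_ fun i _ _ => hpos i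
    intro i hi
    simp only [Finset.mem_range, Finset.mem_Ico] at *; omega
  have s2 : ∑ i ∈ Finset.range (N - t), |f^[i + 1 + t] x₃ - f^[i + 1 + t] x₁| ≤ 4 := by
    refine le_trans ?_ h4
    rw [Finset.sum_nbij (s := Finset.range (N - t)) (t := Finset.Ico (t + 1) (N + 1)) (fun i => i + 1 + t)
      (g := fun i => |f^[i] x₃ - f^[i] x₁|)
      (fun i hi => by simp only [Finset.mem_range, Finset.mem_Ico] at *; omega)
      (fun i _ j _ hij => by simpa using hij)
      (fun i hi => by
        simp only [Finset.coe_Ico, mem_Ico] at hi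
        exact ⟨i - 1 - t, by simp only [Finset.coe_range, mem_Iio]; omega, by dsimp only; omega⟩)
      (fun i _ => rfl)]
    refine Finset.sum_le_sum_of_subset_of_nonneg ?_ fun i _ _ => hpos i
    intro i hi
    simp only [Finset.mem_range, Finset.mem_Ico] at *; omega
  linarith

end ReturnExtension

/-- The initial cross-ratios of the extensions tend to infinity. -/
lemma WanderingSequence.exists_le_crossRatio (W : WanderingSequence f c A B) (L : ℝ) :
    ∃ N₀, ∀ N ≥ N₀, ∀ σ x₁ x₂ x₃ x₄, ReturnExtension f c A B σ N x₁ x₂ x₃ x₄ →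
      L ≤ crossRatio x₁ x₂ x₃ x₄ := by
  set δ := (B 0 - A 0) / (|L| + 1) with hδ
  have hlt := W.lt 0
  have hL : 0 < |L| + 1 := by positivity
  have hδ0 : 0 < δ := div_pos (by linarith) hL
  have hkey : ∀ d, 0 < d → d ≤ δ → L ≤ (B 0 - A 0) / d := by
    intro d hd hdδ
    rw [le_div_iff₀ hd]
    have : (|L| + 1) * δ = B 0 - A 0 := by rw [hδ]; field_simp
    nlinarith [le_abs_self L]
  have habs : |B 0 - A 0| = B 0 - A 0 := abs_of_pos (by linarith)
  rcases W.side with hs | hs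
  · obtain ⟨N₀, hN₀⟩ := hs δ hδ0
    refine ⟨N₀, fun N hN σ x₁ x₂ x₃ x₄ E => ?_⟩
    have hno : ¬ InjOn f^[N] (Icc (A 0) (min 1 (B 0 + δ))) := fun hi =>
      hN₀ (IsTent.injOn_iterate_of_le hN hi)
    have hord := E.ordered
    have hgap : ∀ e ∈ uIcc x₁ x₄, e ∈ Icc (0 : ℝ) 1 → A 0 ∈ uIcc x₁ x₄ → B 0 < e → |e - B 0| ≤ δ := by
      intro e he he1 hA hBe
      rw [abs_of_pos (by linarith)]
      by_contra! hcon
      refine hno (E.injOn.mono ((Icc_subset_Icc_right ?_).trans (ordConnected_uIcc.out hA he)))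
      exact (min_le_right _ _).trans (by linarith)
    rcases E.ends with ⟨rfl, rfl⟩ | ⟨rfl, rfl⟩
    · have h3 : B 0 < x₄ := by rcases hord with h | h <;> linarith [h.1, h.2.1, h.2.2]
      have h4 := hgap x₄ right_mem_uIcc E.mem₄ hord.mem.1 h3
      refine le_trans ?_ hord.le_crossRatio.1
      rw [habs]
      exact hkey _ (abs_pos.2 (by linarith)) h4
    · have h3 : B 0 < x₁ := by rcases hord with h | h <;> linarith [h.1, h.2.1, h.2.2]
      have h4 := hgap x₁ left_mem_uIcc E.mem₁ hord.mem.2 h3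
      refine le_trans ?_ hord.le_crossRatio.2
      rw [abs_sub_comm (A 0), habs, abs_sub_comm (B 0)]
      exact hkey _ (abs_pos.2 (by linarith)) h4
  · obtain ⟨N₀, hN₀⟩ := hs δ hδ0
    refine ⟨N₀, fun N hN σ x₁ x₂ x₃ x₄ E => ?_⟩
    have hno : ¬ InjOn f^[N] (Icc (max 0 (A 0 - δ)) (B 0)) := fun hi =>
      hN₀ (IsTent.injOn_iterate_of_le hN hi)
    have hord := E.ordered
    have hgap : ∀ e ∈ uIcc x₁ x₄, e ∈ Icc (0 : ℝ) 1 → B 0 ∈ uIcc x₁ x₄ → e < A 0 → |e - A 0| ≤ δ := by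
      intro e he he1 hA hBe
      rw [abs_of_neg (by linarith)]
      by_contra! hcon
      refine hno (E.injOn.mono ((Icc_subset_Icc_left ?_).trans (ordConnected_uIcc.out he hA)))
      exact le_trans (by linarith) (le_max_right _ _)
    rcases E.ends with ⟨rfl, rfl⟩ | ⟨rfl, rfl⟩
    · have h3 : x₁ < A 0 := by rcases hord with h | h <;> linarith [h.1, h.2.1, h.2.2]
      have h4 := hgap x₁ left_mem_uIcc E.mem₁ hord.mem.2 h3
      refine le_trans ?_ hord.le_crossRatio.2
      rw [habs, abs_sub_comm (A 0)]
      exact hkey _ (abs_pos.2 (by linarith)) h4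
    · have h3 : x₄ < A 0 := by rcases hord with h | h <;> linarith [h.1, h.2.1, h.2.2]
      have h4 := hgap x₄ right_mem_uIcc E.mem₄ hord.mem.1 h3
      refine le_trans ?_ hord.le_crossRatio.1
      rw [abs_sub_comm (A 0), habs]
      exact hkey _ (abs_pos.2 (by linarith)) h4

end

/-- The constant in the quantitative estimate for the part of the extension around the critical
point. -/
noncomputable def tightConst (K ε : ℝ) : ℝ :=
  1 + 2 / (ε * Real.exp (-(8 * K))) +
    2 * (1 + 1 / ε) * (1 + ε * Real.exp (-(8 * K)) / 2) / Real.exp (-(8 * K))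

/-- A return extension whose outer part is large and whose part around the critical point is
small. -/
structure TightExtension (f : ℝ → ℝ) (c : ℝ) (A B : ℕ → ℝ) (σ N : ℕ) (ε δ C x₁ x₂ x₃ x₄ : ℝ) : Prop where
  toReturnExtension : ReturnExtension f c A B σ N x₁ x₂ x₃ x₄
  outer_le : ε * |f^[N] x₃ - f^[N] x₂| ≤ |f^[N] x₂ - f^[N] x₁|
  inner_le : |f^[N] x₄ - f^[N] x₃| ≤ δ * |f^[N] x₃ - f^[N] x₂|
  inner_le' : |f^[N] x₄ - f^[N] x₃| * (f c - A σ) ≤ C * (f c - B σ) * |f^[N] x₃ - f^[N] x₂|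

lemma inner_le_of_crossRatio {O J I ε κ : ℝ} (hO : 0 < O) (hJ : 0 ≤ J) (hI : 0 < I) (hε : 0 < ε)
    (hκ : 2 / ε ≤ κ) (hcr : κ ≤ (O + J + I) * J / (O * I)) (hOJ : ε * J ≤ O) :
    I * κ ≤ 2 * (1 + 1 / ε) * J := by
  rw [le_div_iff₀ (by positivity)] at hcr
  have h1 : J ≤ O * (1 / ε) := by
    rw [mul_one_div, le_div_iff₀ hε]; linarith
  have h2 : (O + J + I) * J ≤ O * (1 + 1 / ε) * J + I * (O * (1 / ε)) := by
    have e1 : (O + J) * J ≤ (O + O * (1 / ε)) * J := by gcongr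
    have e2 : I * J ≤ I * (O * (1 / ε)) := by gcongr
    nlinarith
  have h3 : I * (O * (1 / ε)) ≤ I * O * (κ / 2) := by
    have : 1 / ε ≤ κ / 2 := by
      have : 2 / ε = 2 * (1 / ε) := by ring
      linarith
    rw [← mul_assoc]
    gcongr
  have h4 : O * (I * κ) ≤ O * (2 * (1 + 1 / ε) * J) := by nlinarith
  exact le_of_mul_le_mul_left h4 hO

lemma inner_mul_le_tightConst {I J u w K ε : ℝ} (hε : 0 < ε) (hJ : 0 ≤ J) (hI : 0 ≤ I) (hw : 0 < w)
    (hu : 0 < u) (hIJ : I ≤ J)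
    (h : 2 / ε ≤ Real.exp (-(8 * K)) * (w / u) →
      I * (Real.exp (-(8 * K)) * (w / u)) ≤ 2 * (1 + 1 / ε) * J) :
    I * (w + u) ≤ tightConst K ε * u * J := by
  unfold tightConst
  have hC := Real.exp_pos (-(8 * K))
  set C₀ := Real.exp (-(8 * K))
  have t1 : 0 ≤ 2 / (ε * C₀) * u * J := by positivity
  have t2 : 0 ≤ 2 * (1 + 1 / ε) * (1 + ε * C₀ / 2) / C₀ * u * J := by positivity
  have t3 : 0 ≤ u * J := by positivity
  have hexp : (1 + 2 / (ε * C₀) + 2 * (1 + 1 / ε) * (1 + ε * C₀ / 2) / C₀) * u * J =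
      u * J + 2 / (ε * C₀) * u * J + 2 * (1 + 1 / ε) * (1 + ε * C₀ / 2) / C₀ * u * J := by ring
  rw [hexp]
  rcases le_or_gt (2 / ε) (C₀ * (w / u)) with hlarge | hsmall
  · have h2 := h hlarge
    have h3 : I * w ≤ 2 * (1 + 1 / ε) / C₀ * u * J := by
      have e1 : I * (C₀ * (w / u)) = I * w * (C₀ / u) := by ring
      rw [e1] at h2
      have e2 : 2 * (1 + 1 / ε) / C₀ * u * J = 2 * (1 + 1 / ε) * J / (C₀ / u) := by
        field_simp
      rw [e2, le_div_iff₀ (by positivity)]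
      exact h2
    have h4 : u ≤ ε * C₀ / 2 * w := by
      rw [mul_div_assoc', div_le_div_iff₀ hε hu] at hlarge
      linarith
    have h5 : I * (w + u) ≤ I * w * (1 + ε * C₀ / 2) := by
      have := mul_le_mul_of_nonneg_left h4 hI
      linarith
    have h6 : I * w * (1 + ε * C₀ / 2) ≤ 2 * (1 + 1 / ε) / C₀ * u * J * (1 + ε * C₀ / 2) :=
      mul_le_mul_of_nonneg_right h3 (by positivity)
    have h7 : 2 * (1 + 1 / ε) / C₀ * u * J * (1 + ε * C₀ / 2) =
      2 * (1 + 1 / ε) * (1 + ε * C₀ / 2) / C₀ * u * J := by ring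
    linarith
  · have h1 : w ≤ 2 / (ε * C₀) * u := by
      rw [mul_div_assoc', div_lt_div_iff₀ hu hε] at hsmall
      rw [div_mul_eq_mul_div, le_div_iff₀ (by positivity)]
      linarith
    have h5 : I * (w + u) ≤ J * (w + u) := mul_le_mul_of_nonneg_right hIJ (by positivity)
    have h6 : J * (w + u) ≤ J * (2 / (ε * C₀) * u + u) := mul_le_mul_of_nonneg_left (by linarith) hJ
    linarith

section

variable {f : ℝ → ℝ} {c l l' K M ε δ C : ℝ} {A B : ℕ → ℝ} {σ N : ℕ} {x₁ x₂ x₃ x₄ : ℝ} {S S' : Set ℝ}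

lemma WanderingSequence.exists_branchPair (W : WanderingSequence f c A B) (N : ℕ) :
    Icc (A N) (B N) ⊆ Icc 0 c ∨ Icc (A N) (B N) ⊆ Icc c 1 :=
  IsTent.subset_of_notMem ordConnected_Icc (Icc_subset_Icc (W.left_mem N).1 (W.right_mem N).2)
    (W.notMem N)

namespace ReturnExtension

lemma positions (E : ReturnExtension f c A B σ N x₁ x₂ x₃ x₄) (W : WanderingSequence f c A B)
    (h : IsTent f c) (hS : IsBranchPair c S S') (hQ : Icc (A N) (B N) ⊆ S) :
    f^[N] x₁ ∈ S ∧ f^[N] x₂ ∈ S ∧ f^[N] x₃ ∈ S ∧ f^[N] x₄ ∈ S' ∧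
    |f^[N] x₄ - f^[N] x₃| = |f^[N] x₃ - c| + |f^[N] x₄ - c| ∧
    |f^[N] x₂ - c| = |f^[N] x₃ - f^[N] x₂| + |f^[N] x₃ - c| := by
  have hends := E.isEnds W h N
  have hu := W.uIcc_eq hends
  have h3 : f^[N] x₃ ∈ S := hQ (hu ▸ right_mem_uIcc)
  have h2 : f^[N] x₂ ∈ S := hQ (hu ▸ left_mem_uIcc)
  have hc := W.notMem N
  have h3c : f^[N] x₃ ≠ c := fun he => hc (by rw [← hu, ← he]; exact right_mem_uIcc)
  have hinj : InjOn f (uIcc (f^[N] x₁) (f^[N] x₃)) := by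
    rw [← E.image_outer h (Nat.le_succ N)]
    exact IsTent.injOn_image_iterate (n := 1) E.injOn_outer
  have hsub := h.subset_of_injOn ordConnected_uIcc
    (IsTent.uIcc_subset (h.iterate_mapsTo N E.mem₁) (h.iterate_mapsTo N E.mem₃)) hinj
  have hord := E.ordered_iterate h le_rfl
  have hm := E.mem_uIcc
  have h4m := h.iterate_mapsTo N E.mem₄
  have h5 : |f^[N] x₄ - f^[N] x₃| = |f^[N] x₃ - c| + |f^[N] x₄ - c| := by
    rw [abs_sub_add_of_mem_uIcc hm, abs_sub_comm c]
  have h6 : f^[N] x₃ ∈ uIcc (f^[N] x₂) c := by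
    rcases hord with ⟨g1, g2, g3⟩ | ⟨g1, g2, g3⟩
    · rw [uIcc_of_le g3.le] at hm
      exact Set.mem_uIcc.2 (Or.inl ⟨g2.le, hm.1⟩)
    · rw [uIcc_of_ge g1.le] at hm
      exact Set.mem_uIcc.2 (Or.inr ⟨hm.2, g2.le⟩)
  have h7 : |f^[N] x₂ - c| = |f^[N] x₃ - f^[N] x₂| + |f^[N] x₃ - c| := by
    rw [abs_sub_comm _ c, abs_sub_add_of_mem_uIcc h6, abs_sub_comm c]
  rcases hS with ⟨rfl, rfl⟩ | ⟨rfl, rfl⟩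
  · have h3' : f^[N] x₃ < c := lt_of_le_of_ne h3.2 h3c
    refine ⟨?_, h2, h3, ⟨?_, h4m.2⟩, h5, h7⟩
    · rcases hsub with hs | hs
      · exact hs left_mem_uIcc
      · exact absurd (hs right_mem_uIcc).1 (not_le.2 h3')
    · rcases Set.mem_uIcc.1 hm with g | g
      · exact g.2
      · linarith [g.2]
  · have h3' : c < f^[N] x₃ := lt_of_le_of_ne h3.1 h3c.symm
    refine ⟨?_, h2, h3, ⟨h4m.1, ?_⟩, h5, h7⟩
    · rcases hsub with hs | hs
      · exact absurd (hs right_mem_uIcc).2 (not_le.2 h3')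
      · exact hs left_mem_uIcc
    · rcases Set.mem_uIcc.1 hm with g | g
      · linarith [g.1]
      · exact g.1

/-- The cross-ratio at the time of the previous record. -/
lemma le_crossRatio_record (E : ReturnExtension f c A B σ N x₁ x₂ x₃ x₄) (W : WanderingSequence f c A B)
    (h : IsTent f c) (R : ConsecutiveRecords B σ (N + 1)) :
    (B σ - A σ) / (f c - B σ) ≤ crossRatio (f^[σ] x₁) (f^[σ] x₂) (f^[σ] x₃) (f^[σ] x₄) := by
  have hσ := R.lt
  have hord := E.ordered_iterate h (by omega : σ ≤ N)
  have hlt := W.lt σ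
  have hle : ∀ x ∈ Icc (0 : ℝ) 1, f^[σ] x ≤ f c := by
    intro x hx
    obtain ⟨s, rfl⟩ := Nat.exists_eq_add_of_le' R.one_le
    rw [Function.iterate_succ_apply']
    exact h.le (h.iterate_mapsTo s hx)
  have h1 := hle _ E.mem₁
  have h4 := hle _ E.mem₄
  rcases E.isEnds W h σ with ⟨g2, g3⟩ | ⟨g2, g3⟩
  · refine le_trans ?_ hord.le_crossRatio.1
    rw [g2, g3] at hord ⊢
    obtain ⟨k1, k2, k3⟩ : f^[σ] x₁ < A σ ∧ A σ < B σ ∧ B σ < f^[σ] x₄ := by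
      rcases hord with k | k
      · exact k
      · linarith [k.2.1]
    rw [abs_of_pos (by linarith), abs_of_pos (by linarith)]
    gcongr
  · refine le_trans ?_ hord.le_crossRatio.2
    rw [g2, g3] at hord ⊢
    obtain ⟨k1, k2, k3⟩ : f^[σ] x₄ < A σ ∧ A σ < B σ ∧ B σ < f^[σ] x₁ := by
      rcases hord with k | k
      · linarith [k.2.1]
      · exact k
    rw [abs_of_neg (by linarith), abs_of_neg (by linarith), neg_sub, neg_sub]
    gcongr

theorem tight_or_growth (E : ReturnExtension f c A B σ N x₁ x₂ x₃ x₄) (W : WanderingSequence f c A B)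
    (h : IsTent f c) (R : ConsecutiveRecords B σ (N + 1)) (hS : IsBranchPair c S S')
    (hQ : Icc (A N) (B N) ⊆ S) (hK : 0 ≤ K) (hε : 0 < ε) (hδ1 : δ ≤ 1)
    (b : BranchEstimates f c l S K M ε) (b' : BranchEstimates f c l' S' K M ε) {L : ℝ}
    (hL1 : 2 / ε ≤ Real.exp (-(8 * K)) * L)
    (hL2 : 2 * (1 + 1 / ε) ≤ δ * (Real.exp (-(8 * K)) * L)) (hL : L ≤ crossRatio x₁ x₂ x₃ x₄) :
    B σ - A σ ≤ 1 / 2 * (B (N + 1) - A (N + 1)) ∨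
      TightExtension f c A B σ N ε δ (tightConst K ε) x₁ x₂ x₃ x₄ := by
  obtain ⟨p1, p2, p3, p4, p5, p6⟩ := E.positions W h hS hQ
  have hσA := W.right_le R
  have hlt := W.lt σ
  have hltN := W.lt (N + 1)
  have hord := E.ordered_iterate h (le_refl N)
  obtain ⟨a1, a2, a3, a4, a5⟩ := hord.abs_add
  have hcr : crossRatio (f^[N] x₁) (f^[N] x₂) (f^[N] x₃) (f^[N] x₄) =
      (|f^[N] x₂ - f^[N] x₁| + |f^[N] x₃ - f^[N] x₂| + |f^[N] x₄ - f^[N] x₃|) *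
        |f^[N] x₃ - f^[N] x₂| / (|f^[N] x₂ - f^[N] x₁| * |f^[N] x₄ - f^[N] x₃|) := by
    rw [crossRatio, a1]
  set y₁ := f^[N] x₁ with hy₁
  set y₂ := f^[N] x₂ with hy₂
  set y₃ := f^[N] x₃ with hy₃
  set y₄ := f^[N] x₄ with hy₄
  set C₀ := Real.exp (-(8 * K)) with hC₀
  have hC₀0 : 0 < C₀ := Real.exp_pos _
  have f1 : f y₁ = A σ := by rw [hy₁, ← Function.iterate_succ_apply' f, E.map₁]
  have f2 : f y₂ = A (N + 1) := by rw [hy₂, ← Function.iterate_succ_apply' f, E.map₂]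
  have f3 : f y₃ = B (N + 1) := by rw [hy₃, ← Function.iterate_succ_apply' f, E.map₃]
  rcases le_or_gt (|y₂ - y₁|) (ε * |y₃ - y₂|) with hO | hO
  · left
    have := b.outer y₃ p3 y₂ p2 y₁ p1 (by rw [f1, f2]; linarith) (by rw [f2, f3]; linarith) (by
      rw [abs_sub_comm y₁, abs_sub_comm y₂ y₃]; exact hO)
    rw [f1, f2, f3, abs_sub_comm, abs_of_pos (by linarith), abs_sub_comm,
      abs_of_pos (by linarith)] at this
    linarith
  · right
    have hI1 : |y₄ - y₃| ≤ δ * |y₃ - y₂| := by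
      have h1 : C₀ * L ≤ crossRatio y₁ y₂ y₃ y₄ := by
        refine le_trans ?_ (E.crossRatio_le W h R hS hK b b' (Nat.zero_le N))
        exact mul_le_mul_of_nonneg_left hL hC₀0.le
      rw [hcr] at h1
      have h2 := inner_le_of_crossRatio a3 a4.le a5 hε hL1 h1 hO.le
      have h3 : |y₄ - y₃| * (C₀ * L) ≤ δ * |y₃ - y₂| * (C₀ * L) := by
        refine h2.trans ?_
        have := mul_le_mul_of_nonneg_right hL2 a4.le
        linarith
      have h4 : 0 < C₀ * L := lt_of_lt_of_le (by positivity) hL1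
      exact le_of_mul_le_mul_right h3 h4
    refine ⟨E, hO.le, hI1, ?_⟩
    have hv := W.lt_value σ
    set u := f c - B σ with hu
    set w := B σ - A σ with hw
    have hu0 : 0 < u := by rw [hu]; linarith
    have hw0 : 0 < w := by rw [hw]; linarith
    have hwu : f c - A σ = w + u := by rw [hu, hw]; ring
    rw [hwu]
    show |y₄ - y₃| * (w + u) ≤ tightConst K ε * u * |y₃ - y₂|
    refine inner_mul_le_tightConst hε a4.le a5.le hw0 hu0 (hI1.trans ?_) fun hlarge => ?_
    · exact mul_le_of_le_one_left a4.le hδ1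
    · have h1 : C₀ * (w / u) ≤ crossRatio y₁ y₂ y₃ y₄ := by
        refine le_trans ?_ (E.crossRatio_le W h R hS hK b b' (by have := R.lt; omega : σ ≤ N))
        exact mul_le_mul_of_nonneg_left (E.le_crossRatio_record W h R) hC₀0.le
      rw [hcr] at h1
      exact inner_le_of_crossRatio a3 a4.le a5 hε hlarge h1 hO.le

end ReturnExtension

end

/-- The exponent of the ratio in the growth estimate at a critical order `l`. -/
noncomputable def ratioExponent (l : ℝ) : ℝ := l * (l - 1) / (l + 1)

lemma ratioExponent_nonneg {l : ℝ} (hl : 1 ≤ l) : 0 ≤ ratioExponent l := by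
  unfold ratioExponent
  have : 0 ≤ l - 1 := by linarith
  positivity

lemma ratioExponent_le {l : ℝ} (hl : 1 ≤ l) : ratioExponent l ≤ l := by
  unfold ratioExponent
  rw [div_le_iff₀ (by linarith)]
  nlinarith

section

variable {f : ℝ → ℝ} {c l l' K M ε δ C : ℝ} {A B : ℕ → ℝ} {σ N : ℕ} {x₁ x₂ x₃ x₄ : ℝ} {S S' : Set ℝ}

namespace TightExtension

lemma basic (T : TightExtension f c A B σ N ε δ C x₁ x₂ x₃ x₄) (W : WanderingSequence f c A B)
    (h : IsTent f c) (hS : IsBranchPair c S S')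
    (hQ : Icc (A N) (B N) ⊆ S) (hδ : 0 ≤ δ)
    (b : BranchEstimates f c l S K M ε) (b' : BranchEstimates f c l' S' K M ε) :
    |f^[N] x₃ - f^[N] x₂| ≤ |f^[N] x₂ - c| ∧ |f^[N] x₂ - c| ≤ 1 ∧
    |f^[N] x₄ - f^[N] x₃| ≤ δ * |f^[N] x₂ - c| ∧
    |f^[N] x₃ - c| ≤ |f^[N] x₄ - f^[N] x₃| ∧ |f^[N] x₄ - c| ≤ |f^[N] x₄ - f^[N] x₃| ∧
    |f^[N] x₂ - c| ^ l ≤ M * (f c - A (N + 1)) ∧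
    f c - B (N + 1) ≤ M * |f^[N] x₃ - c| ^ l ∧
    f c - f^[N + 1] x₄ ≤ M * |f^[N] x₄ - c| ^ l' := by
  obtain ⟨p1, p2, p3, p4, p5, p6⟩ := T.toReturnExtension.positions W h hS hQ
  have E := T.toReturnExtension
  have h1 : |f^[N] x₃ - f^[N] x₂| ≤ |f^[N] x₂ - c| := by rw [p6]; linarith [abs_nonneg (f^[N] x₃ - c)]
  refine ⟨h1, ?_, T.inner_le.trans (mul_le_mul_of_nonneg_left h1 hδ), ?_, ?_, ?_, ?_, ?_⟩
  · have := abs_sub_le_of_mem_Icc (h.iterate_mapsTo N E.mem₂) (Ioo_subset_Icc_self h.mem_Ioo)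
    linarith
  · rw [p5]; linarith [abs_nonneg (f^[N] x₄ - c)]
  · rw [p5]; linarith [abs_nonneg (f^[N] x₃ - c)]
  · have := b.lower _ p2
    rwa [← Function.iterate_succ_apply' f, E.map₂] at this
  · have := b.upper _ p3
    rwa [← Function.iterate_succ_apply' f, E.map₃] at this
  · have := b'.upper _ p4
    rwa [← Function.iterate_succ_apply' f] at this

lemma mul_rpow_le {x y : ℝ} (hx : 0 ≤ x) (hx1 : x ≤ 1) (hy : 0 ≤ y) (hl : 1 ≤ l) :
    (x * y) ^ l ≤ x * y ^ l := by
  rw [Real.mul_rpow hx hy]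
  refine mul_le_mul_of_nonneg_right ?_ (Real.rpow_nonneg hy l)
  calc x ^ l ≤ x ^ (1 : ℝ) := Real.rpow_le_rpow_of_exponent_ge' hx hx1 zero_le_one hl
    _ = x := Real.rpow_one x

/-- After a tight extension the next record interval is far from the critical value. -/
lemma next_ratio_le (T : TightExtension f c A B σ N ε δ C x₁ x₂ x₃ x₄) (W : WanderingSequence f c A B)
    (h : IsTent f c) (hS : IsBranchPair c S S')
    (hQ : Icc (A N) (B N) ⊆ S) (hM : 1 ≤ M) (hδ : 0 ≤ δ) (hδ1 : δ ≤ 1) (hl : 1 ≤ l)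
    (b : BranchEstimates f c l S K M ε) (b' : BranchEstimates f c l' S' K M ε) :
    f c - B (N + 1) ≤ M ^ 2 * δ * (f c - A (N + 1)) := by
  obtain ⟨h1, h2, h3, h4, h5, h6, h7, h8⟩ := T.basic W h hS hQ hδ b b'
  have hl0 : 0 ≤ l := by linarith
  calc f c - B (N + 1) ≤ M * |f^[N] x₃ - c| ^ l := h7
    _ ≤ M * (δ * |f^[N] x₂ - c|) ^ l := by gcongr; linarith
    _ ≤ M * (δ * |f^[N] x₂ - c| ^ l) := by
        gcongr; exact mul_rpow_le hδ hδ1 (abs_nonneg _) hl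
    _ ≤ M * (δ * (M * (f c - A (N + 1)))) := by gcongr
    _ = _ := by ring

/-- If the critical order on the side of the return is at most the order on the other side, then
the image of the far endpoint is close to the critical value. -/
lemma sub_iterate_lt (T : TightExtension f c A B σ N ε δ C x₁ x₂ x₃ x₄) (W : WanderingSequence f c A B)
    (h : IsTent f c) (hS : IsBranchPair c S S')
    (hQ : Icc (A N) (B N) ⊆ S) (hM : 1 ≤ M) (hδ : 0 ≤ δ) (hδ1 : M ^ 2 * δ < 1) (hl : 1 ≤ l)
    (hll : l ≤ l') (b : BranchEstimates f c l S K M ε) (b' : BranchEstimates f c l' S' K M ε) :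
    f c - f^[N + 1] x₄ < f c - A (N + 1) := by
  obtain ⟨h1, h2, h3, h4, h5, h6, h7, h8⟩ := T.basic W h hS hQ hδ b b'
  have hl0 : 0 ≤ l' := by linarith
  have hδ1' : δ ≤ 1 := by nlinarith
  have hD : 0 < f c - A (N + 1) := by linarith [W.lt (N + 1), W.lt_value (N + 1)]
  calc f c - f^[N + 1] x₄ ≤ M * |f^[N] x₄ - c| ^ l' := h8
    _ ≤ M * (δ * |f^[N] x₂ - c|) ^ l' := by gcongr; linarith
    _ ≤ M * (δ * |f^[N] x₂ - c| ^ l') := by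
        gcongr; exact mul_rpow_le hδ hδ1' (abs_nonneg _) (hl.trans hll)
    _ ≤ M * (δ * |f^[N] x₂ - c| ^ l) := by
        gcongr ?_ * (?_ * ?_)
        exact Real.rpow_le_rpow_of_exponent_ge' (abs_nonneg _) h2 (by linarith) hll
    _ ≤ M * (δ * (M * (f c - A (N + 1)))) := by gcongr
    _ = M ^ 2 * δ * (f c - A (N + 1)) := by ring
    _ < _ := by nlinarith

lemma lt_of_map_eq (T : TightExtension f c A B σ N ε δ C x₁ x₂ x₃ x₄) (W : WanderingSequence f c A B)
    (h : IsTent f c) (R : ConsecutiveRecords B σ (N + 1)) (hS : IsBranchPair c S S')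
    (hQ : Icc (A N) (B N) ⊆ S) (hM : 1 ≤ M) (hδ : 0 ≤ δ) (hδ1 : M ^ 2 * δ < 1) (hl : 1 ≤ l)
    (b : BranchEstimates f c l S K M ε) (b' : BranchEstimates f c l' S' K M ε)
    (hx : f^[N + 1] x₄ = A σ) : l' < l := by
  by_contra! hll
  have := T.sub_iterate_lt W h hS hQ hM hδ hδ1 hl hll b b'
  rw [hx] at this
  linarith [W.right_le R, W.lt σ]

lemma rpow_le_of_map_eq (T : TightExtension f c A B σ N ε δ C x₁ x₂ x₃ x₄)
    (W : WanderingSequence f c A B) (h : IsTent f c) (hS : IsBranchPair c S S')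
    (hQ : Icc (A N) (B N) ⊆ S) (hM : 1 ≤ M) (hδ : 0 ≤ δ) (hC : 0 ≤ C) (hl : 1 ≤ l) (hl' : 1 ≤ l')
    (b : BranchEstimates f c l S K M ε) (b' : BranchEstimates f c l' S' K M ε)
    (hx : f^[N + 1] x₄ = A σ) :
    (f c - A σ) ^ l ≤ M ^ (l + 1) * C ^ l *
      (((f c - B σ) / (f c - A σ)) ^ ratioExponent l * (f c - A (N + 1))) := by
  obtain ⟨h1, h2, h3, h4, h5, h6, h7, h8⟩ := T.basic W h hS hQ hδ b b'
  rw [hx] at h8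
  have hlt := W.lt σ
  have hv := W.lt_value σ
  set D := f c - A σ with hD
  have hD0 : 0 < D := by rw [hD]; linarith
  have hD1 : D ≤ 1 := by
    have := h.value_mem.2
    have := (W.left_mem σ).1
    linarith
  set η := (f c - B σ) / D with hη
  have hη0 : 0 < η := div_pos (by linarith) hD0
  have hη1 : η ≤ 1 := (div_le_one hD0).2 (by rw [hD]; linarith)
  set Y := |f^[N] x₂ - c| with hY
  have hY0 : 0 ≤ Y := abs_nonneg _
  have hI : |f^[N] x₄ - f^[N] x₃| ≤ C * η * Y := by
    have h9 := T.inner_le'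
    have h10 : |f^[N] x₄ - f^[N] x₃| * D ≤ C * η * Y * D := by
      refine h9.trans ?_
      have e1 : C * η * Y * D = C * (f c - B σ) * Y := by rw [hη]; field_simp
      rw [e1]
      have : 0 ≤ f c - B σ := by linarith
      gcongr
    exact le_of_mul_le_mul_right h10 hD0
  have hl0 : 0 ≤ l := by linarith
  have hl'0 : 0 < l' := by linarith
  have hM0 : 0 < M := by linarith
  have k1 : D ≤ M * (C * η * Y) ^ l' := by
    refine h8.trans ?_
    gcongr
    linarith
  have hbase : 0 ≤ C * η * Y := by positivity
  have k2 : D ^ (l / l') ≤ M ^ l * (C * η * Y) ^ l := by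
    calc D ^ (l / l') ≤ (M * (C * η * Y) ^ l') ^ (l / l') := by gcongr
      _ = M ^ (l / l') * (C * η * Y) ^ l := by
          rw [Real.mul_rpow hM0.le (Real.rpow_nonneg hbase _), ← Real.rpow_mul hbase]
          congr 2; field_simp
      _ ≤ M ^ l * (C * η * Y) ^ l := by
          gcongr
          exact div_le_self hl0 hl'
  have k3 : D ^ l ≤ D ^ (l / l') :=
    Real.rpow_le_rpow_of_exponent_ge' hD0.le hD1 (by positivity) (div_le_self hl0 hl')
  calc D ^ l ≤ M ^ l * (C * η * Y) ^ l := k3.trans k2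
    _ = M ^ l * C ^ l * (η ^ l * Y ^ l) := by
        rw [Real.mul_rpow (by positivity) hY0, Real.mul_rpow hC hη0.le]; ring
    _ ≤ M ^ l * C ^ l * (η ^ ratioExponent l * (M * (f c - A (N + 1)))) := by
        gcongr ?_ * (?_ * ?_)
        exact Real.rpow_le_rpow_of_exponent_ge' hη0.le hη1 (ratioExponent_nonneg hl) (ratioExponent_le hl)
    _ = _ := by rw [Real.rpow_add_one hM0.ne']; ring

end TightExtension

end

/-- The constant in the Lipschitz estimate for the folded returns. -/
noncomputable def foldConst (K ε : ℝ) : ℝ := 4 * Real.exp (2 * K) * (1 + 2 / ε)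

section

variable {f : ℝ → ℝ} {c l l' K M ε δ C e : ℝ} {A B : ℕ → ℝ} {σ q : ℕ} {x₁ x₂ x₃ x₄ : ℝ} {S S' : Set ℝ}

namespace FoldedReturn

lemma le_value (F : FoldedReturn f c A B σ q e) (W : WanderingSequence f c A B) (h : IsTent f c) :
    B σ ≤ f^[q + 1] (f c) := by
  have h1 := F.left_lt (f c) ⟨by linarith [W.lt σ, W.lt_value σ], le_rfl⟩
  by_contra! h2
  have h3 := W.iterate_value_notMem h (q + 1) σ
  exact h3 ⟨h1, h2⟩

lemma iterate_mem_branch (F : FoldedReturn f c A B σ q e) (W : WanderingSequence f c A B) (h : IsTent f c)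
    (hS : IsBranchPair c S S') (hA : f^[q] (A σ) ∈ S) {x : ℝ} (hx : x ∈ Icc (A σ) e) : f^[q] x ∈ S := by
  have he1 := F.lt_left
  have he2 := F.lt_right
  have hlt := W.lt σ
  have hAm := W.left_mem σ
  have hcS : c ∈ S ∧ S.OrdConnected := by
    have := h.mem_Ioo
    rcases hS with ⟨rfl, -⟩ | ⟨rfl, -⟩
    · exact ⟨⟨this.1.le, le_rfl⟩, ordConnected_Icc⟩
    · exact ⟨⟨le_rfl, this.2.le⟩, ordConnected_Icc⟩
  have hem : e ∈ Icc (0 : ℝ) 1 := ⟨by linarith [hAm.1], by linarith [h.value_mem.2]⟩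
  have := h.iterate_mem_uIcc (n := q) hAm hem (F.injOn.mono (uIcc_subset_uIcc left_mem_uIcc
    (mem_uIcc.2 (Or.inl ⟨by linarith, he2.le⟩)))) (by rw [uIcc_of_le (by linarith)]; exact hx)
  rw [F.map] at this
  exact hcS.2.uIcc_subset hA hcS.1 this

end FoldedReturn

namespace TightExtension

lemma lipschitz_fold (T : TightExtension f c A B σ (σ + q) ε δ C x₁ x₂ x₃ x₄)
    (F : FoldedReturn f c A B σ q e) (W : WanderingSequence f c A B) (h : IsTent f c)
    (hx : f^[σ] x₄ = f c) (hS : IsBranchPair c S S')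
    (hQ : Icc (A (σ + q)) (B (σ + q)) ⊆ S) (hK : 0 ≤ K) (hε : 0 < ε) (hδ : 0 ≤ δ) (hδ1 : δ ≤ 1)
    (hη : f c - B σ ≤ 1 / 2 * (f c - A σ))
    (b : BranchEstimates f c l S K M ε) (b' : BranchEstimates f c l' S' K M ε) {v v' : ℝ}
    (hv : B σ ≤ v) (hvv : v < v') (hv' : v' ≤ f c) :
    |f^[q] v' - f^[q] v| ≤ foldConst K ε * |f^[σ + q] x₂ - c| / (f c - A σ) * (v' - v) := by
  have E := T.toReturnExtension
  obtain ⟨e1, e2, e3, e4⟩ := E.fold_ends W h hx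
  obtain ⟨p1, p2, p3, p4, p5, p6⟩ := E.positions W h hS hQ
  obtain ⟨q1, q2, q3, q4, q5, -⟩ := T.basic W h hS hQ hδ b b'
  have hlt := W.lt σ
  have hvσ := W.lt_value σ
  have hAm := W.left_mem σ
  have hAfc : uIcc (A σ) (f c) = Icc (A σ) (f c) := uIcc_of_le (by linarith)
  have hIc : Icc (A σ) (f c) ⊆ Icc 0 1 := Icc_subset_Icc hAm.1 h.value_mem.2
  have hvA : v ∈ Icc (A σ) (f c) := ⟨by linarith, by linarith⟩
  have hv'A : v' ∈ Icc (A σ) (f c) := ⟨by linarith, hv'⟩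
  have hu1 : f^[σ] x₁ < A σ := by
    refine lt_of_le_of_ne e3 fun he => ?_
    have := (E.ordered_iterate h (Nat.le_add_right σ q)).abs_add.2.2.1
    rw [e1, he, sub_self, abs_zero] at this
    exact lt_irrefl _ this
  set u := f^[σ] x₁ with hu
  have hum : u ∈ Icc (0 : ℝ) 1 := h.iterate_mapsTo σ E.mem₁
  have g1 : f^[q] u = f^[σ + q] x₁ := by rw [hu, ← Function.iterate_add_apply, add_comm]
  have g2 : f^[q] (A σ) = f^[σ + q] x₂ := by rw [← e1, ← Function.iterate_add_apply, add_comm]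
  have g4 : f^[q] (f c) = f^[σ + q] x₄ := by rw [← hx, ← Function.iterate_add_apply, add_comm]
  have hord : Ordered4 v' v (A σ) u := Or.inr ⟨hu1, by linarith, hvv⟩
  have hinj : InjOn f^[q] (uIcc v' u) := by
    refine e4.mono ?_
    rw [uIcc_comm, uIcc_of_le (by linarith), uIcc_of_le (by linarith)]
    exact Icc_subset_Icc_right hv'
  have hcr := h.crossRatio_iterate_le hS b b' hord (hIc hv'A) hum hinj
  have hord' := hord.image ((h.iterate_continuousOn q).mono (IsTent.uIcc_subset (hIc hv'A) hum)) hinj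
  -- the total length of the images
  have hmemi : ∀ i ≤ q, ∀ x ∈ Icc (A σ) (f c), f^[i] x ∈ uIcc (f^[i] (A σ)) (f^[i] (f c)) :=
    fun i hi x hx => h.iterate_mem_uIcc hAm h.value_mem (IsTent.injOn_iterate_of_le hi F.injOn)
      (hAfc ▸ hx)
  have hlen : ∀ i ≤ q, |f^[i] (A σ) - f^[i] v'| ≤ |f^[i] (f c) - f^[i] (A σ)| := fun i hi => by
    rw [abs_sub_comm]
    exact abs_sub_left_of_mem_uIcc (hmemi i hi v' hv'A)
  have hsum : ∑ i ∈ Finset.range q, (|f^[i] (A σ) - f^[i] v'| + |f^[i + 1] (A σ) - f^[i + 1] v'|) ≤ 2 := by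
    have s1 : ∑ i ∈ Finset.range q, |f^[i] (f c) - f^[i] (A σ)| ≤ 1 := by
      refine le_trans ?_ F.sum_le
      exact Finset.sum_le_sum_of_subset_of_nonneg (Finset.range_subset_range.2 (Nat.le_succ q))
        fun _ _ _ => abs_nonneg _
    have s2 : ∑ i ∈ Finset.range q, |f^[i + 1] (f c) - f^[i + 1] (A σ)| ≤ 1 := by
      refine le_trans ?_ F.sum_le
      rw [Finset.sum_range_succ']
      exact le_add_of_nonneg_right (abs_nonneg _)
    have := Finset.sum_le_sum (s := Finset.range q) fun i hi =>
      add_le_add (hlen i (by have := Finset.mem_range.1 hi; omega))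
        (hlen (i + 1) (by have := Finset.mem_range.1 hi; omega))
    rw [Finset.sum_add_distrib (f := fun i => |f^[i] (f c) - f^[i] (A σ)|)] at this
    linarith
  have hexp : Real.exp (-(2 * K)) ≤ Real.exp (-(K * ∑ i ∈ Finset.range q,
      (|f^[i] (A σ) - f^[i] v'| + |f^[i + 1] (A σ) - f^[i + 1] v'|))) := by
    rw [Real.exp_le_exp, neg_le_neg_iff, mul_comm 2]
    exact mul_le_mul_of_nonneg_left hsum hK
  have hw : (f c - A σ) / 2 ≤ B σ - A σ := by linarith
  have hD0 : 0 < f c - A σ := by linarith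
  have hlow : (f c - A σ) / 2 / (v' - v) ≤ crossRatio v' v (A σ) u := by
    refine le_trans ?_ hord.le_crossRatio.2
    rw [abs_sub_comm (A σ), abs_sub_comm v v', abs_of_pos (by linarith), abs_of_pos (by linarith)]
    exact div_le_div_of_nonneg_right (by linarith) (by linarith)
  set Y := |f^[σ + q] x₂ - c| with hY
  -- the upper bound for the image cross-ratio
  obtain ⟨a1, a2, a3, a4, a5⟩ := hord'.abs_add
  have hO : ε * |f^[σ + q] x₃ - f^[σ + q] x₂| ≤ |f^[q] u - f^[q] (A σ)| := by
    rw [g1, g2, abs_sub_comm (f^[σ + q] x₁)]; exact T.outer_le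
  set J := |f^[σ + q] x₃ - f^[σ + q] x₂| with hJ
  have hJ0 : 0 ≤ J := abs_nonneg _
  have hI : |f^[σ + q] x₄ - f^[σ + q] x₃| ≤ J :=
    T.inner_le.trans (mul_le_of_le_one_left hJ0 hδ1)
  have hgap : ∀ x ∈ Icc (A σ) (f c), |f^[q] x - f^[q] (A σ)| ≤ 2 * J := by
    intro x hx
    have h1 := abs_sub_left_of_mem_uIcc (hmemi q le_rfl x hx)
    rw [g2, g4] at h1
    rw [g2]
    refine h1.trans ?_
    have := abs_sub_le (f^[σ + q] x₄) (f^[σ + q] x₃) (f^[σ + q] x₂)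
    linarith
  have hgv := hgap v hvA
  have hgv' := hgap v' hv'A
  rw [abs_sub_comm] at hgv hgv'
  have hup : crossRatio (f^[q] v') (f^[q] v) (f^[q] (A σ)) (f^[q] u) * |f^[q] v - f^[q] v'| ≤
      (1 + 2 / ε) * (2 * J) := by
    have h2 : 2 * J ≤ 2 / ε * |f^[q] u - f^[q] (A σ)| := by
      rw [div_mul_eq_mul_div, le_div_iff₀ hε]; linarith
    have h3 : |f^[q] u - f^[q] v'| ≤ (1 + 2 / ε) * |f^[q] u - f^[q] (A σ)| := by
      rw [a1]; linarith
    unfold crossRatio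
    rw [div_mul_eq_mul_div, div_le_iff₀ (by positivity)]
    calc |f^[q] u - f^[q] v'| * |f^[q] (A σ) - f^[q] v| * |f^[q] v - f^[q] v'|
        ≤ (1 + 2 / ε) * |f^[q] u - f^[q] (A σ)| * (2 * J) * |f^[q] v - f^[q] v'| := by gcongr
      _ = _ := by ring
  have hfin : Real.exp (-(2 * K)) * ((f c - A σ) / 2 / (v' - v)) * |f^[q] v - f^[q] v'| ≤
      (1 + 2 / ε) * (2 * J) := by
    refine le_trans (mul_le_mul_of_nonneg_right ?_ (abs_nonneg _)) hup
    refine le_trans (mul_le_mul hexp hlow ?_ (Real.exp_pos _).le) hcr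
    exact div_nonneg (by linarith) (by linarith)
  have hvv0 : 0 < v' - v := by linarith
  have hexp2 : Real.exp (-(2 * K)) * Real.exp (2 * K) = 1 := by rw [← Real.exp_add]; simp
  rw [abs_sub_comm]
  have hfin2 : |f^[q] v - f^[q] v'| * (f c - A σ) ≤ foldConst K ε * J * (v' - v) := by
    have e5 : Real.exp (-(2 * K)) * ((f c - A σ) / 2 / (v' - v)) * |f^[q] v - f^[q] v'| =
        Real.exp (-(2 * K)) * (|f^[q] v - f^[q] v'| * (f c - A σ)) / (2 * (v' - v)) := by
      field_simp
    rw [e5, div_le_iff₀ (by positivity)] at hfin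
    have := mul_le_mul_of_nonneg_left hfin (Real.exp_pos (2 * K)).le
    have e6 : Real.exp (2 * K) * (Real.exp (-(2 * K)) * (|f^[q] v - f^[q] v'| * (f c - A σ))) =
        |f^[q] v - f^[q] v'| * (f c - A σ) := by
      rw [← mul_assoc, mul_comm (Real.exp (2 * K)), hexp2, one_mul]
    rw [e6] at this
    unfold foldConst
    linarith
  rw [div_mul_eq_mul_div, le_div_iff₀ hD0]
  refine hfin2.trans ?_
  have hfc : 0 ≤ foldConst K ε := by unfold foldConst; positivity
  gcongr

/-- The folded return maps have large derivatives. -/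
lemma exists_le_fold (T : TightExtension f c A B σ (σ + q) ε δ C x₁ x₂ x₃ x₄)
    (F : FoldedReturn f c A B σ q e) (W : WanderingSequence f c A B) (h : IsTent f c)
    (hx : f^[σ] x₄ = f c) (hS : IsBranchPair c S S')
    (hQ : Icc (A (σ + q)) (B (σ + q)) ⊆ S) (hK : 0 ≤ K) (hM : 1 ≤ M) (hε : 0 < ε) (hδ : 0 ≤ δ)
    (hδ1 : δ ≤ 1) (hη : f c - B σ ≤ 1 / 2 * (f c - A σ)) (hl : 1 ≤ l)
    (b : BranchEstimates f c l S K M ε) (b' : BranchEstimates f c l' S' K M ε) :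
    ∃ t, 0 < t ∧ t ≤ f c - B σ ∧
      t ≤ M ^ 2 * (foldConst K ε * |f^[σ + q] x₂ - c| / (f c - A σ)) ^ (1 + l) * t ^ l := by
  set Λ := foldConst K ε * |f^[σ + q] x₂ - c| / (f c - A σ) with hΛ
  have hlip := fun v v' => T.lipschitz_fold F W h hx hS hQ hK hε hδ hδ1 hη b b' (v := v) (v' := v')
  have E := T.toReturnExtension
  obtain ⟨p1, p2, p3, p4, p5, p6⟩ := E.positions W h hS hQ
  obtain ⟨e1, e2, e3, e4⟩ := E.fold_ends W h hx
  have hlt := W.lt σ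
  have hvσ := W.lt_value σ
  have hAm := W.left_mem σ
  have he1 := F.lt_left
  have he2 := F.lt_right
  have hD0 : 0 < f c - A σ := by linarith
  have hΛ0 : 0 ≤ Λ := by rw [hΛ]; unfold foldConst; positivity
  have g2 : f^[q] (A σ) = f^[σ + q] x₂ := by rw [← e1, ← Function.iterate_add_apply, add_comm]
  have g4 : f^[q] (f c) = f^[σ + q] x₄ := by rw [← hx, ← Function.iterate_add_apply, add_comm]
  have hAfc : uIcc (A σ) (f c) = Icc (A σ) (f c) := uIcc_of_le (by linarith)
  have hIc : Icc (A σ) (f c) ⊆ Icc 0 1 := Icc_subset_Icc hAm.1 h.value_mem.2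
  have hcS' : c ∈ S' ∧ S'.OrdConnected := by
    have := h.mem_Ioo
    rcases hS with ⟨-, rfl⟩ | ⟨-, rfl⟩
    · exact ⟨⟨le_rfl, this.2.le⟩, ordConnected_Icc⟩
    · exact ⟨⟨this.1.le, le_rfl⟩, ordConnected_Icc⟩
  have hem : e ∈ Icc (0 : ℝ) 1 := hIc ⟨by linarith, he2.le⟩
  have hleft : ∀ x ∈ Icc (A σ) e, f^[q] x ∈ S := fun x hx =>
    F.iterate_mem_branch W h hS (g2 ▸ p2) hx
  have hright : ∀ x ∈ Icc e (f c), f^[q] x ∈ S' := by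
    intro x hx
    have := h.iterate_mem_uIcc (n := q) hem h.value_mem (F.injOn.mono (uIcc_subset_uIcc
      (hAfc ▸ ⟨by linarith, he2.le⟩) right_mem_uIcc)) (by rw [uIcc_of_le he2.le]; exact hx)
    rw [F.map, g4] at this
    exact hcS'.2.uIcc_subset hcS'.1 p4 this
  have hFe : f^[q + 1] e = f c := by rw [Function.iterate_succ_apply', F.map]
  -- the two estimates for the folding map
  have est1 : ∀ v, B σ ≤ v → v < e → f c - f^[q + 1] v ≤ M * (Λ * (e - v)) ^ l := by
    intro v hv hve
    rw [Function.iterate_succ_apply']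
    have h1 := b.upper _ (hleft v ⟨by linarith, hve.le⟩)
    have h2 := hlip v e hv hve he2.le
    rw [F.map, abs_sub_comm] at h2
    have hl0 : 0 ≤ l := by linarith
    refine h1.trans ?_
    gcongr
  have est2 : ∀ v v', e ≤ v → v < v' → v' ≤ f c → |f^[q + 1] v' - f^[q + 1] v| ≤ M * (Λ * (v' - v)) := by
    intro v v' hv hvv hv'
    rw [Function.iterate_succ_apply', Function.iterate_succ_apply']
    have h1 := b'.lipschitz _ (hright v ⟨hv, by linarith⟩) _ (hright v' ⟨by linarith, hv'⟩)
    have h2 := hlip v v' (by linarith) hvv hv'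
    refine h1.trans ?_
    gcongr
  have hBv := F.le_value W h
  have hve := F.value_lt
  have hesc := F.escape
  have hlast := est2 e (f c) le_rfl he2 le_rfl
  set v := f^[q + 1] (f c) with hv
  have hzle : ∀ x ∈ Icc (0 : ℝ) 1, f^[q + 1] x ≤ f c := fun x hx => by
    rw [Function.iterate_succ_apply']; exact h.le (h.iterate_mapsTo q hx)
  have hvm : v ∈ Icc (0 : ℝ) 1 := h.iterate_mapsTo _ h.value_mem
  have h1 := est1 v hBv hve
  have hpow : ∀ t, 0 < t → M * (Λ * (M * (Λ * t) ^ l)) = M ^ 2 * Λ ^ (1 + l) * t ^ l := by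
    intro t ht
    rcases hΛ0.eq_or_lt with h0 | h0
    · rw [← h0, Real.zero_rpow (by linarith)]; ring
    · rw [Real.mul_rpow hΛ0 ht.le, Real.rpow_add h0, Real.rpow_one]; ring
  have hcase2 : e ≤ f^[q + 1] v → e < f^[q + 1] (f^[q + 1] v) →
      e - v ≤ M ^ 2 * Λ ^ (1 + l) * (e - v) ^ l := by
    intro hz hz3
    set z := f^[q + 1] v with hzdef
    have hzfc : z ≤ f c := hzle v hvm
    rcases hzfc.eq_or_lt with hzeq | hzlt
    · rw [hzeq] at hz3; linarith
    have h2 := est2 z (f c) hz hzlt le_rfl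
    rw [← hv, abs_sub_comm, abs_of_pos (by linarith)] at h2
    rw [← hpow _ (by linarith)]
    have h3 : M * (Λ * (f c - z)) ≤ M * (Λ * (M * (Λ * (e - v)) ^ l)) := by gcongr
    linarith
  rcases le_or_gt e (f^[q + 1] v) with hz | hz
  · refine ⟨e - v, by linarith, by linarith, ?_⟩
    rcases hesc with h2 | h2
    · linarith
    · exact hcase2 hz h2
  · refine ⟨f c - v, by linarith, by linarith, ?_⟩
    rw [hFe, abs_sub_comm, abs_of_pos (by linarith)] at hlast
    rw [← hpow _ (by linarith)]
    have hl0 : 0 ≤ l := by linarith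
    calc f c - v ≤ M * (Λ * (f c - e)) := hlast
      _ ≤ M * (Λ * (M * (Λ * (e - v)) ^ l)) := by gcongr; linarith
      _ ≤ M * (Λ * (M * (Λ * (f c - v)) ^ l)) := by
          have : 0 ≤ Λ * (e - v) := mul_nonneg hΛ0 (by linarith)
          gcongr

end TightExtension

end

/-- The constant in the growth estimate at a critical order `l`. -/
noncomputable def growthConst (K M ε C l : ℝ) : ℝ :=
  M ^ (l + 1) * C ^ l + (M ^ 2 * foldConst K ε ^ (1 + l)) ^ (l / (l + 1)) * M

section

variable {f : ℝ → ℝ} {c l l' K M ε δ C e : ℝ} {A B : ℕ → ℝ} {σ N q : ℕ} {x₁ x₂ x₃ x₄ : ℝ} {S S' : Set ℝ}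

namespace TightExtension

lemma rpow_le_of_fold (T : TightExtension f c A B σ (σ + q) ε δ C x₁ x₂ x₃ x₄)
    (F : FoldedReturn f c A B σ q e) (W : WanderingSequence f c A B) (h : IsTent f c)
    (hx : f^[σ] x₄ = f c) (hS : IsBranchPair c S S')
    (hQ : Icc (A (σ + q)) (B (σ + q)) ⊆ S) (hK : 0 ≤ K) (hM : 1 ≤ M) (hε : 0 < ε) (hδ : 0 ≤ δ)
    (hδ1 : δ ≤ 1) (hη : f c - B σ ≤ 1 / 2 * (f c - A σ)) (hl : 1 ≤ l)
    (b : BranchEstimates f c l S K M ε) (b' : BranchEstimates f c l' S' K M ε) :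
    (f c - A σ) ^ l ≤ (M ^ 2 * foldConst K ε ^ (1 + l)) ^ (l / (l + 1)) * M *
      (((f c - B σ) / (f c - A σ)) ^ ratioExponent l * (f c - A (σ + q + 1))) := by
  obtain ⟨t, ht0, htu, ht⟩ := T.exists_le_fold F W h hx hS hQ hK hM hε hδ hδ1 hη hl b b'
  obtain ⟨-, -, -, -, -, h6, -, -⟩ := T.basic W h hS hQ hδ b b'
  have hlt := W.lt σ
  have hv := W.lt_value σ
  set D := f c - A σ with hD
  have hD0 : 0 < D := by rw [hD]; linarith
  have hD1 : D ≤ 1 := by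
    have := h.value_mem.2
    have := (W.left_mem σ).1
    linarith
  set η := (f c - B σ) / D with hηd
  have hη0 : 0 < η := div_pos (by linarith) hD0
  have hu : f c - B σ = η * D := by rw [hηd]; field_simp
  set Y := |f^[σ + q] x₂ - c| with hY
  have hY0 : 0 ≤ Y := abs_nonneg _
  set C₃ := foldConst K ε with hC₃
  have hC₃0 : 0 < C₃ := by rw [hC₃]; unfold foldConst; positivity
  have hM0 : 0 < M := by linarith
  have hl1 : 0 ≤ l - 1 := by linarith
  have hl0 : 0 < l := by linarith
  set Λ := C₃ * Y / D with hΛ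
  have hΛ0 : 0 ≤ Λ := by positivity
  have k1 : 1 ≤ M ^ 2 * Λ ^ (1 + l) * (η * D) ^ (l - 1) := by
    have e1 : t ^ l = t * t ^ (l - 1) := by
      rw [← Real.rpow_one_add' ht0.le (by linarith)]; congr 1; ring
    rw [e1] at ht
    have e2 : t * 1 ≤ t * (M ^ 2 * Λ ^ (1 + l) * t ^ (l - 1)) := by linarith
    refine (le_of_mul_le_mul_left e2 ht0).trans ?_
    rw [hu] at htu
    gcongr
  have k2 : D ^ (2 : ℝ) ≤ M ^ 2 * C₃ ^ (1 + l) * η ^ (l - 1) * Y ^ (1 + l) := by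
    have e1 : M ^ 2 * Λ ^ (1 + l) * (η * D) ^ (l - 1) =
        M ^ 2 * C₃ ^ (1 + l) * η ^ (l - 1) * Y ^ (1 + l) / D ^ (2 : ℝ) := by
      have e2 : D ^ (1 + l) = D ^ (l - 1) * D ^ (2 : ℝ) := by
        rw [← Real.rpow_add hD0]; congr 1; ring
      rw [hΛ, Real.div_rpow (by positivity) hD0.le, Real.mul_rpow hC₃0.le hY0,
        Real.mul_rpow hη0.le hD0.le, e2]
      have := Real.rpow_pos_of_pos hD0 (l - 1)
      have := Real.rpow_pos_of_pos hD0 2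
      field_simp
    rw [e1, le_div_iff₀ (Real.rpow_pos_of_pos hD0 2), one_mul] at k1
    exact k1
  have hlp : 0 < l / (l + 1) := by positivity
  have k3 : D ^ (2 * (l / (l + 1))) ≤
      (M ^ 2 * C₃ ^ (1 + l)) ^ (l / (l + 1)) * η ^ ratioExponent l * Y ^ l := by
    rw [Real.rpow_mul hD0.le]
    refine (Real.rpow_le_rpow (Real.rpow_nonneg hD0.le _) k2 hlp.le).trans (le_of_eq ?_)
    rw [Real.mul_rpow (by positivity) (by positivity), Real.mul_rpow (by positivity) (by positivity),
      ← Real.rpow_mul hη0.le, ← Real.rpow_mul hY0]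
    congr 2
    · congr 1; unfold ratioExponent; ring
    · field_simp; ring
  have k4 : D ^ l ≤ D ^ (2 * (l / (l + 1))) := by
    refine Real.rpow_le_rpow_of_exponent_ge' hD0.le hD1 (by positivity) ?_
    rw [mul_div_assoc', div_le_iff₀ (by positivity)]
    nlinarith
  have hη' := Real.rpow_nonneg hη0.le (ratioExponent l)
  calc D ^ l ≤ (M ^ 2 * C₃ ^ (1 + l)) ^ (l / (l + 1)) * η ^ ratioExponent l * Y ^ l := k4.trans k3
    _ ≤ (M ^ 2 * C₃ ^ (1 + l)) ^ (l / (l + 1)) * η ^ ratioExponent l * (M * (f c - A (σ + q + 1))) := by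
        gcongr
    _ = _ := by ring

/-- The growth estimate, and the dichotomy between the two kinds of returns. -/
theorem growth (T : TightExtension f c A B σ N ε δ C x₁ x₂ x₃ x₄)
    (W : WanderingSequence f c A B) (h : IsTent f c) (R : ConsecutiveRecords B σ (N + 1))
    (hS : IsBranchPair c S S') (hQ : Icc (A N) (B N) ⊆ S) (hK : 0 ≤ K) (hM : 1 ≤ M) (hε : 0 < ε)
    (hδ : 0 ≤ δ) (hδ1 : M ^ 2 * δ < 1) (hC : 0 ≤ C) (hη : f c - B σ ≤ 1 / 2 * (f c - A σ)) (hl : 1 ≤ l)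
    (hl' : 1 ≤ l') (b : BranchEstimates f c l S K M ε) (b' : BranchEstimates f c l' S' K M ε) :
    (f c - A σ) ^ l ≤ growthConst K M ε C l *
      (((f c - B σ) / (f c - A σ)) ^ ratioExponent l * (f c - A (N + 1))) ∧
    (l ≤ l' → ∃ q e, N = σ + q ∧ FoldedReturn f c A B σ q e ∧ B (N + 1) ≤ f^[q + 1] (f c)) := by
  have hδ1' : δ ≤ 1 := by nlinarith
  have hpos : 0 ≤ ((f c - B σ) / (f c - A σ)) ^ ratioExponent l * (f c - A (N + 1)) := by
    have h1 := W.lt σ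
    have h2 := W.lt_value σ
    have h3 := W.lt (N + 1)
    have h4 := W.lt_value (N + 1)
    exact mul_nonneg (Real.rpow_nonneg (div_nonneg (by linarith) (by linarith)) _) (by linarith)
  have hc1 : 0 ≤ M ^ (l + 1) * C ^ l := by positivity
  have hc2 : 0 ≤ (M ^ 2 * foldConst K ε ^ (1 + l)) ^ (l / (l + 1)) * M := by
    have : 0 ≤ foldConst K ε := by unfold foldConst; positivity
    positivity
  unfold growthConst
  rcases T.toReturnExtension.alt with hx | ⟨hx, hx'⟩
  · refine ⟨(T.rpow_le_of_map_eq W h hS hQ hM hδ hC hl hl' b b' hx).trans ?_, fun hll => ?_⟩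
    · rw [add_mul]; linarith [mul_nonneg hc2 hpos]
    · exact absurd (T.lt_of_map_eq W h R hS hQ hM hδ hδ1 hl b b' hx) (not_lt.2 hll)
  · obtain ⟨q, rfl⟩ : ∃ q, N = σ + q := ⟨N - σ, by have := R.lt; omega⟩
    obtain ⟨e, F⟩ := T.toReturnExtension.exists_foldedReturn W h R hx hx'
    refine ⟨(T.rpow_le_of_fold F W h hx hS hQ hK hM hε hδ hδ1' hη hl b b').trans ?_, fun hll => ?_⟩
    · rw [add_mul]; linarith [mul_nonneg hc1 hpos]
    · refine ⟨q, e, rfl, F, ?_⟩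
      have h1 := T.sub_iterate_lt W h hS hQ hM hδ hδ1 hl hll b b'
      have h2 : f^[σ + q + 1] x₄ = f^[q + 1] (f c) := by
        rw [← hx, ← Function.iterate_add_apply]; congr 1; omega
      rw [h2] at h1
      by_contra! h3
      exact W.iterate_value_notMem h (q + 1) (σ + q + 1) ⟨by linarith, h3⟩

end TightExtension

end

section

variable {f : ℝ → ℝ} {c l l' ℓm ℓp K M ε δ C e : ℝ} {A B : ℕ → ℝ} {s : ℕ → ℕ} {S S' : Set ℝ}

namespace WanderingSequence

lemma tendsto_right (W : WanderingSequence f c A B) (hs : ∀ k, ConsecutiveRecords B (s k) (s (k + 1)))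
    {x : ℝ} (hx : x < f c) : ∃ K₀, ∀ k ≥ K₀, x < B (s k) := by
  obtain ⟨j, hj⟩ := W.approach (f c - x) (by linarith)
  have hmono : StrictMono s := strictMono_nat_of_lt_succ fun k => (hs k).lt
  refine ⟨j, fun k hk => ?_⟩
  have h1 : j < s (k + 1) := by have := hmono.le_apply (x := k + 1); omega
  have := (hs k).le j h1
  linarith

/-- A folded return after which the critical value stays beyond the record interval is followed by
a return of the same kind. -/
lemma next_of_fold (W : WanderingSequence f c A B) (h : IsTent f c) {σ q n' : ℕ}
    (F : FoldedReturn f c A B σ q e) (R : ConsecutiveRecords B σ (σ + q + 1))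
    (R' : ConsecutiveRecords B (σ + q + 1) n') (hB : B (σ + q + 1) ≤ f^[q + 1] (f c))
    (hS : IsBranchPair c S S') (hQ : Icc (A (σ + q)) (B (σ + q)) ⊆ S) :
    n' = (σ + q + 1) + q + 1 ∧
      Icc (A (σ + q + 1 + q)) (B (σ + q + 1 + q)) ⊆ S := by
  have hlt := W.lt σ
  have hσn := W.right_le R
  have hltn := W.lt (σ + q + 1)
  have hvn := W.lt_value (σ + q + 1)
  have he := F.value_lt
  have he1 := F.lt_left
  have hAσ : A σ ∈ Icc (A σ) e := ⟨le_rfl, by linarith⟩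
  have hBσ : B σ ∈ Icc (A σ) e := ⟨hlt.le, he1.le⟩
  have hBn : B (σ + q + 1) ∈ Icc (A σ) e := ⟨by linarith, by linarith⟩
  have hends := W.isEnds_iterate h (Or.inl ⟨rfl, rfl⟩ : IsEnds A B σ _ _) (q + 1)
  have hFA : f^[q + 1] (A σ) = A (σ + q + 1) := by
    rcases hends with ⟨g, -⟩ | ⟨g1, g2⟩
    · exact g
    · have := F.strictMonoOn hAσ hBσ hlt
      rw [g1, g2] at this
      have hl' := W.lt (σ + (q + 1))
      linarith
  have hstep := F.strictMonoOn hAσ hBn (by linarith)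
  rw [hFA] at hstep
  have hends' := W.isEnds_iterate h (Or.inr ⟨rfl, rfl⟩ : IsEnds A B (σ + q + 1) (B _) _)
  have hclose : B (σ + q + 1) < B (σ + q + 1 + (q + 1)) := by
    have h1 := W.lt (σ + q + 1 + (q + 1))
    rcases W.le_or_le (i := σ + q + 1) (j := σ + q + 1 + (q + 1)) (by omega) with h2 | h2
    · linarith
    · rcases hends' (q + 1) with ⟨g, -⟩ | ⟨g, -⟩ <;> linarith
  have hfar : ∀ r, 0 < r → r ≤ q → B (σ + q + 1 + r) ≤ A σ := by
    intro r hr hrq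
    have h1 := F.iterate_le r hr hrq (B (σ + q + 1)) ⟨by linarith, hvn.le⟩
    have h2 := F.iterate_le r hr hrq (A (σ + q + 1)) ⟨by linarith, by linarith⟩
    rcases hends' r with ⟨-, g⟩ | ⟨g, -⟩ <;> linarith
  constructor
  · have h1 : ¬ σ + q + 1 + (q + 1) < n' := fun hlt' => by
      have := R'.le _ hlt'
      linarith
    have h2 := R'.lt
    by_contra hne
    have h3 := hfar (n' - (σ + q + 1)) (by omega) (by omega)
    rw [Nat.add_sub_cancel' h2.le] at h3
    have := R'.lt_right
    linarith
  · rw [← W.iterate_image]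
    rintro _ ⟨x, hx, rfl⟩
    refine F.iterate_mem_branch W h hS ?_ ⟨by linarith [hx.1], by linarith [hx.2]⟩
    apply hQ
    rw [← W.iterate_image]
    exact mem_image_of_mem _ ⟨le_rfl, hlt.le⟩

/-- From some record on all the return extensions are tight. -/
theorem eventually_tight (W : WanderingSequence f c A B) (h : IsTent f c)
    (hs : ∀ k, ConsecutiveRecords B (s k) (s (k + 1)))
    (hK : 0 ≤ K) (hM : 1 ≤ M) (hε : 0 < ε) (hδ : 0 < δ) (hδ1 : M ^ 2 * δ ≤ 1 / 4)
    (hℓm : 1 ≤ ℓm) (hℓp : 1 ≤ ℓp)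
    (bm : BranchEstimates f c ℓm (Icc 0 c) K M ε) (bp : BranchEstimates f c ℓp (Icc c 1) K M ε) :
    ∃ k₁, ∀ k ≥ k₁, (∃ x₁ x₂ x₃ x₄, TightExtension f c A B (s k) (s (k + 1) - 1) ε δ
      (tightConst K ε) x₁ x₂ x₃ x₄) ∧ f c - B (s k) ≤ 1 / 2 * (f c - A (s k)) := by
  have hmono : StrictMono s := strictMono_nat_of_lt_succ fun k => (hs k).lt
  have hδ1' : δ ≤ 1 := by nlinarith
  have hsucc : ∀ k, s (k + 1) - 1 + 1 = s (k + 1) := fun k => by have := (hs k).lt; omega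
  have hs' : ∀ k, ConsecutiveRecords B (s k) (s (k + 1) - 1 + 1) := fun k => by
    rw [hsucc]; exact hs k
  have hpair : ∀ N, ∃ l l' S S', 1 ≤ l ∧ IsBranchPair c S S' ∧ Icc (A N) (B N) ⊆ S ∧
      BranchEstimates f c l S K M ε ∧ BranchEstimates f c l' S' K M ε := by
    intro N
    rcases W.exists_branchPair N with g | g
    · exact ⟨ℓm, ℓp, _, _, hℓm, Or.inl ⟨rfl, rfl⟩, g, bm, bp⟩
    · exact ⟨ℓp, ℓm, _, _, hℓp, Or.inr ⟨rfl, rfl⟩, g, bp, bm⟩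
  obtain ⟨L, hL1, hL2⟩ : ∃ L, 2 / ε ≤ Real.exp (-(8 * K)) * L ∧
      2 * (1 + 1 / ε) ≤ δ * (Real.exp (-(8 * K)) * L) := by
    refine ⟨(2 / ε + 2 * (1 + 1 / ε) / δ) / Real.exp (-(8 * K)), ?_, ?_⟩
    · rw [mul_div_cancel₀ _ (Real.exp_pos _).ne']
      have : 0 ≤ 2 * (1 + 1 / ε) / δ := by positivity
      linarith
    · rw [mul_div_cancel₀ _ (Real.exp_pos _).ne']
      have h1 : δ * (2 / ε + 2 * (1 + 1 / ε) / δ) = δ * (2 / ε) + 2 * (1 + 1 / ε) := by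
        field_simp
      have : 0 ≤ δ * (2 / ε) := by positivity
      linarith
  obtain ⟨N₁, hN₁⟩ := W.exists_le_crossRatio L
  obtain ⟨N₂, hN₂⟩ := W.left_free
  obtain ⟨N₃, hN₃⟩ := W.right_free
  set k₀ := N₁ + N₂ + N₃ + 1 with hk₀
  have hlarge : ∀ k ≥ k₀, N₁ ≤ s (k + 1) - 1 ∧ N₂ ≤ s (k + 1) - 1 ∧ N₃ ≤ s (k + 1) - 1 := by
    intro k hk
    have := hmono.le_apply (x := k + 1)
    omega
  -- the dichotomy
  have hdich : ∀ k ≥ k₀, B (s k) - A (s k) ≤ 1 / 2 * (B (s (k + 1)) - A (s (k + 1))) ∨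
      ∃ x₁ x₂ x₃ x₄, TightExtension f c A B (s k) (s (k + 1) - 1) ε δ
        (tightConst K ε) x₁ x₂ x₃ x₄ := by
    intro k hk
    obtain ⟨g1, g2, g3⟩ := hlarge k hk
    obtain ⟨x₁, x₂, x₃, x₄, E⟩ := W.exists_returnExtension h (hs' k)
      (fun hi => hN₂ (IsTent.injOn_iterate_of_le g2 hi))
      (fun hi => hN₃ (IsTent.injOn_iterate_of_le g3 hi))
    obtain ⟨l, l', S, S', hl, hS, hQ, b, b'⟩ := hpair (s (k + 1) - 1)
    have := E.tight_or_growth W h (hs' k) hS hQ hK hε hδ1' b b' hL1 hL2 (hN₁ _ g1 _ _ _ _ _ E)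
    rw [hsucc] at this
    exact this.imp id fun T => ⟨x₁, x₂, x₃, x₄, T⟩
  have hnext : ∀ k, (∃ x₁ x₂ x₃ x₄, TightExtension f c A B (s k) (s (k + 1) - 1) ε δ
      (tightConst K ε) x₁ x₂ x₃ x₄) →
      f c - B (s (k + 1)) ≤ 1 / 4 * (f c - A (s (k + 1))) := by
    rintro k ⟨x₁, x₂, x₃, x₄, T⟩
    obtain ⟨l, l', S, S', hl, hS, hQ, b, b'⟩ := hpair (s (k + 1) - 1)
    have h1 := T.next_ratio_le W h hS hQ hM hδ.le hδ1' hl b b'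
    rw [hsucc] at h1
    refine h1.trans (mul_le_mul_of_nonneg_right hδ1 ?_)
    linarith [W.lt (s (k + 1)), W.lt_value (s (k + 1))]
  obtain ⟨k₁, hk₁, hT⟩ : ∃ k ≥ k₀, ∃ x₁ x₂ x₃ x₄, TightExtension f c A B (s k) (s (k + 1) - 1) ε δ
      (tightConst K ε) x₁ x₂ x₃ x₄ := by
    by_contra! hcon
    have hbig : ∀ k ≥ k₀, B (s k) - A (s k) ≤ 1 / 2 * (B (s (k + 1)) - A (s (k + 1))) := by
      intro k hk
      rcases hdich k hk with g | ⟨x₁, x₂, x₃, x₄, T⟩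
      · exact g
      · exact absurd T (hcon k hk x₁ x₂ x₃ x₄)
    have hpow : ∀ i : ℕ, 2 ^ i * (B (s k₀) - A (s k₀)) ≤ B (s (k₀ + i)) - A (s (k₀ + i)) := by
      intro i
      induction i with
      | zero => simp
      | succ i ih =>
        have := hbig (k₀ + i) (by omega)
        rw [pow_succ, ← add_assoc]
        linarith
    have hpos : 0 < B (s k₀) - A (s k₀) := by linarith [W.lt (s k₀)]
    obtain ⟨i, hi⟩ := pow_unbounded_of_one_lt (1 / (B (s k₀) - A (s k₀))) (one_lt_two (α := ℝ))
    rw [div_lt_iff₀ hpos] at hi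
    have := hpow i
    linarith [(W.right_mem (s (k₀ + i))).2, (W.left_mem (s (k₀ + i))).1]
  have hall : ∀ i : ℕ, ∃ x₁ x₂ x₃ x₄, TightExtension f c A B (s (k₁ + i)) (s (k₁ + i + 1) - 1) ε δ
      (tightConst K ε) x₁ x₂ x₃ x₄ := by
    intro i
    induction i with
    | zero => exact hT
    | succ i ih =>
      rcases hdich (k₁ + i + 1) (by omega) with g | g
      · exfalso
        have h1 := hnext _ ih
        have h2 := W.right_le (hs' (k₁ + i + 1))
        rw [hsucc] at h2
        have h3 := W.lt_value (s (k₁ + i + 1 + 1))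
        have h4 := W.lt_value (s (k₁ + i + 1))
        have h5 := W.lt (s (k₁ + i + 1))
        linarith
      · exact g
  refine ⟨k₁ + 1, fun k hk => ?_⟩
  obtain ⟨i, rfl⟩ := Nat.exists_eq_add_of_le hk
  constructor
  · have := hall (1 + i)
    rwa [← add_assoc] at this
  · have h1 := hnext _ (hall i)
    rw [add_right_comm]
    have h4 := W.lt_value (s (k₁ + i + 1))
    have h5 := W.lt (s (k₁ + i + 1))
    linarith

/-- The critical order on the side of the returns is eventually the larger one. -/
theorem lt_of_tight (W : WanderingSequence f c A B) (h : IsTent f c)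
    (hs : ∀ k, ConsecutiveRecords B (s k) (s (k + 1)))
    (hS : IsBranchPair c S S') (hK : 0 ≤ K) (hM : 1 ≤ M) (hε : 0 < ε) (hδ : 0 ≤ δ)
    (hδ1 : M ^ 2 * δ < 1) (hC : 0 ≤ C) (hl : 1 ≤ l) (hl' : 1 ≤ l') (b : BranchEstimates f c l S K M ε)
    (b' : BranchEstimates f c l' S' K M ε) {k₁ : ℕ}
    (hT : ∀ k ≥ k₁, (∃ x₁ x₂ x₃ x₄, TightExtension f c A B (s k) (s (k + 1) - 1) ε δ
      C x₁ x₂ x₃ x₄) ∧ f c - B (s k) ≤ 1 / 2 * (f c - A (s k))) {k : ℕ} (hk : k₁ ≤ k)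
    (hQ : Icc (A (s (k + 1) - 1)) (B (s (k + 1) - 1)) ⊆ S) : l' < l := by
  by_contra! hll
  have hsucc : ∀ k, s (k + 1) - 1 + 1 = s (k + 1) := fun k => by have := (hs k).lt; omega
  have hstep : ∀ k ≥ k₁, Icc (A (s (k + 1) - 1)) (B (s (k + 1) - 1)) ⊆ S →
      ∃ q e, s (k + 1) = s k + q + 1 ∧ FoldedReturn f c A B (s k) q e ∧
        B (s (k + 1)) ≤ f^[q + 1] (f c) := by
    intro k hk hQ
    obtain ⟨⟨x₁, x₂, x₃, x₄, T⟩, hη⟩ := hT k hk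
    obtain ⟨q, e, h1, h2, h3⟩ := (T.growth W h (by rw [hsucc]; exact hs k) hS hQ hK hM hε hδ hδ1 hC hη
      hl hl' b b').2 hll
    rw [hsucc] at h3
    exact ⟨q, e, by have := hsucc k; omega, h2, h3⟩
  obtain ⟨q, e, h1, h2, h3⟩ := hstep k hk hQ
  have hall : ∀ i : ℕ, Icc (A (s (k + i + 1) - 1)) (B (s (k + i + 1) - 1)) ⊆ S ∧
      ∃ e, s (k + i + 1) = s (k + i) + q + 1 ∧ FoldedReturn f c A B (s (k + i)) q e ∧
        B (s (k + i + 1)) ≤ f^[q + 1] (f c) := by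
    intro i
    induction i with
    | zero => exact ⟨hQ, e, h1, h2, h3⟩
    | succ i ih =>
      obtain ⟨g1, e, g2, g3, g4⟩ := ih
      have R := hs (k + i)
      have R' := hs (k + i + 1)
      rw [g2] at R R' g4
      rw [g2, Nat.add_sub_cancel] at g1
      obtain ⟨j1, j2⟩ := W.next_of_fold h g3 R R' g4 hS g1
      have hQ' : Icc (A (s (k + (i + 1) + 1) - 1)) (B (s (k + (i + 1) + 1) - 1)) ⊆ S := by
        rw [← add_assoc, j1, Nat.add_sub_cancel]; exact j2
      obtain ⟨q', e', m1, m2, m3⟩ := hstep (k + (i + 1)) (by omega) hQ'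
      have hqq : q' = q := by
        rw [← add_assoc, j1] at m1
        rw [g2] at m1
        omega
      subst hqq
      exact ⟨hQ', e', m1, m2, m3⟩
  obtain ⟨K₀, hK₀⟩ := W.tendsto_right hs (h2.value_lt.trans h2.lt_right)
  have h5 := hK₀ (k + K₀ + 1) (by omega)
  obtain ⟨-, -, -, -, h6⟩ := hall K₀
  linarith

/-- The main dichotomy for the returns of a wandering sequence. -/
theorem return_dichotomy (W : WanderingSequence f c A B) (h : IsTent f c)
    (hs : ∀ k, ConsecutiveRecords B (s k) (s (k + 1)))
    (hK : 0 ≤ K) (hM : 1 ≤ M) (hε : 0 < ε) (hℓm : 1 ≤ ℓm) (hℓp : 1 ≤ ℓp)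
    (bm : BranchEstimates f c ℓm (Icc 0 c) K M ε) (bp : BranchEstimates f c ℓp (Icc c 1) K M ε) :
    (ℓm < ℓp ∧ ∃ k₁, ∀ k ≥ k₁, Icc (A (s (k + 1) - 1)) (B (s (k + 1) - 1)) ⊆ Icc c 1 ∧
      (f c - A (s k)) ^ ℓp ≤ growthConst K M ε (tightConst K ε) ℓp *
        (((f c - B (s k)) / (f c - A (s k))) ^ ratioExponent ℓp * (f c - A (s (k + 1))))) ∨
    (ℓp < ℓm ∧ ∃ k₁, ∀ k ≥ k₁, Icc (A (s (k + 1) - 1)) (B (s (k + 1) - 1)) ⊆ Icc 0 c ∧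
      (f c - A (s k)) ^ ℓm ≤ growthConst K M ε (tightConst K ε) ℓm *
        (((f c - B (s k)) / (f c - A (s k))) ^ ratioExponent ℓm * (f c - A (s (k + 1))))) := by
  have hsucc : ∀ k, s (k + 1) - 1 + 1 = s (k + 1) := fun k => by have := (hs k).lt; omega
  have hδ : 0 < 1 / (4 * M ^ 2) := by positivity
  have hδ1 : M ^ 2 * (1 / (4 * M ^ 2)) = 1 / 4 := by field_simp
  have hC : 0 ≤ tightConst K ε := by unfold tightConst; positivity
  obtain ⟨k₁, hT⟩ := W.eventually_tight h hs hK hM hε hδ hδ1.le hℓm hℓp bm bp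
  have hδ1' : M ^ 2 * (1 / (4 * M ^ 2)) < 1 := by rw [hδ1]; norm_num
  have hm : ∀ k ≥ k₁, Icc (A (s (k + 1) - 1)) (B (s (k + 1) - 1)) ⊆ Icc 0 c → ℓp < ℓm := fun k hk hQ =>
    W.lt_of_tight h hs (Or.inl ⟨rfl, rfl⟩) hK hM hε hδ.le hδ1' hC hℓm hℓp bm bp hT hk hQ
  have hp : ∀ k ≥ k₁, Icc (A (s (k + 1) - 1)) (B (s (k + 1) - 1)) ⊆ Icc c 1 → ℓm < ℓp := fun k hk hQ =>
    W.lt_of_tight h hs (Or.inr ⟨rfl, rfl⟩) hK hM hε hδ.le hδ1' hC hℓp hℓm bp bm hT hk hQ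
  rcases W.exists_branchPair (s (k₁ + 1) - 1) with g | g
  · right
    have hlt := hm k₁ le_rfl g
    refine ⟨hlt, k₁, fun k hk => ?_⟩
    have hQ : Icc (A (s (k + 1) - 1)) (B (s (k + 1) - 1)) ⊆ Icc 0 c := by
      rcases W.exists_branchPair (s (k + 1) - 1) with g' | g'
      · exact g'
      · exact absurd (hp k hk g') (not_lt.2 hlt.le)
    obtain ⟨⟨x₁, x₂, x₃, x₄, T⟩, hη⟩ := hT k hk
    have := (T.growth W h (by rw [hsucc]; exact hs k) (Or.inl ⟨rfl, rfl⟩) hQ hK hM hε hδ.le hδ1' hC hη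
      hℓm hℓp bm bp).1
    rw [hsucc] at this
    exact ⟨hQ, this⟩
  · left
    have hlt := hp k₁ le_rfl g
    refine ⟨hlt, k₁, fun k hk => ?_⟩
    have hQ : Icc (A (s (k + 1) - 1)) (B (s (k + 1) - 1)) ⊆ Icc c 1 := by
      rcases W.exists_branchPair (s (k + 1) - 1) with g' | g'
      · exact absurd (hm k hk g') (not_lt.2 hlt.le)
      · exact g'
    obtain ⟨⟨x₁, x₂, x₃, x₄, T⟩, hη⟩ := hT k hk
    have := (T.growth W h (by rw [hsucc]; exact hs k) (Or.inr ⟨rfl, rfl⟩) hQ hK hM hε hδ.le hδ1' hC hη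
      hℓp hℓm bp bm).1
    rw [hsucc] at this
    exact ⟨hQ, this⟩

end WanderingSequence

end

/-! ### The main theorem -/

section

variable {f : ℝ → ℝ} {c ℓm ℓp : ℝ} {Q J : Set ℝ}

/-- There is a maximal wandering interval whose closure does not contain the critical value. -/
lemma IsUnimodal.exists_maximal_notMem_closure (hf : IsUnimodal 2 f c ℓm ℓp) (hmax : IsLocalMax f c)
    (hJ : IsWanderingInterval f J) : ∃ Q, IsMaximalWanderingInterval f Q ∧ f c ∉ closure Q := by
  have h := hf.isTent hmax
  have hfJ := h.isWanderingInterval_image hJ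
  obtain ⟨Q, hJQ, hQ⟩ := exists_maximal_wanderingInterval hfJ
  refine ⟨Q, hQ, fun hc => ?_⟩
  obtain ⟨y, hy, hyc⟩ := hfJ.nontrivial.exists_ne (f c)
  obtain ⟨x, hx, rfl⟩ := hy
  have hlt : f x < f c := lt_of_le_of_ne (h.le (hJ.subset_Icc hx)) hyc
  have hxQ : f x ∈ Q := hJQ ⟨x, hx, rfl⟩
  obtain ⟨j, hj, hjs⟩ := hf.exists_approach hmax hQ.1 1 (sub_pos.2 hlt)
  obtain ⟨i, rfl⟩ := Nat.exists_eq_add_of_le' hj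
  have hsup := hf.sSup_lt_value hmax hQ.1 i
  have hQj := h.isWanderingInterval_iterate hQ.1 (i + 1)
  obtain ⟨w, hw, hxw⟩ := exists_lt_of_lt_csSup hQj.nontrivial.nonempty hjs
  have hwc : w < f c :=
    (le_csSup ⟨1, fun z hz => (hQj.subset_Icc hz).2⟩ hw).trans_lt hsup
  obtain ⟨z, hz, hzd⟩ := Metric.mem_closure_iff.1 hc (f c - w) (sub_pos.2 hwc)
  rw [Real.dist_eq, abs_lt] at hzd
  have hwQ : w ∈ f^[0] '' Q := by
    rw [Function.iterate_zero, image_id]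
    exact hQ.1.ordConnected.out hxQ hz ⟨by linarith, by linarith [hzd.2]⟩
  exact disjoint_left.1 (hQ.1.disjoint_images (i := 0) (j := i + 1) (by omega)) hwQ hw

lemma growthConst_pos {K M ε C l : ℝ} (hM : 1 ≤ M) (hε : 0 < ε) (hC : 0 ≤ C) :
    0 < growthConst K M ε C l := by
  have h1 : 0 < foldConst K ε := by unfold foldConst; positivity
  have h2 : 0 < M := by linarith
  have h3 : 0 ≤ C ^ l := Real.rpow_nonneg hC l
  unfold growthConst
  positivity

lemma returnLiminf_pos {α l G : ℝ} (hG : 0 < G) (k₀ : ℕ)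
    (hlt : ∀ k ≥ k₀, rightEnd f c Q k < f c ∧ leftEnd f c Q k < f c)
    (hgrow : ∀ k ≥ k₀, (f c - leftEnd f c Q k) ^ l ≤
      G * (((f c - rightEnd f c Q k) / (f c - leftEnd f c Q k)) ^ α * (f c - leftEnd f c Q (k + 1)))) :
    0 < returnLiminf f c Q α l := by
  refine lt_of_lt_of_le (EReal.coe_pos.2 (one_div_pos.2 hG)) (le_liminf_of_le (by isBoundedDefault) ?_)
  filter_upwards [eventually_ge_atTop (k₀ + 1)] with k hk
  obtain ⟨i, rfl⟩ := Nat.exists_eq_add_of_le' (by omega : 1 ≤ k)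
  rw [Nat.add_sub_cancel, EReal.coe_le_coe_iff]
  obtain ⟨h1, h2⟩ := hlt i (by omega)
  obtain ⟨-, h4⟩ := hlt (i + 1) (by omega)
  have h5 := hgrow i (by omega)
  unfold returnRatio
  rw [abs_sub_comm, abs_sub_comm _ (f c), abs_sub_comm _ (f c), abs_of_pos (by linarith),
    abs_of_pos (by linarith), abs_of_pos (by linarith),
    div_le_div_iff₀ hG (Real.rpow_pos_of_pos (by linarith) l)]
  linarith

theorem IsUnimodal.closestReturns (hf : IsUnimodal 2 f c ℓm ℓp) (hmax : IsLocalMax f c)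
    (hQ : IsMaximalWanderingInterval f Q) (hc : f c ∉ closure Q) :
    ∃ α : ℝ, 0 < α ∧
      ((ℓm < ℓp ∧
          (∀ᶠ k : ℕ in atTop, f^[closestMoment f c Q k - 1] '' Q ⊆ Ioi c) ∧
          0 < returnLiminf f c Q α ℓp) ∨
        (ℓp < ℓm ∧
          (∀ᶠ k : ℕ in atTop, f^[closestMoment f c Q k - 1] '' Q ⊆ Iio c) ∧
          0 < returnLiminf f c Q α ℓm)) := by
  have h := hf.isTent hmax
  have hinf := infinite_closestReturnMoment hf hmax hQ.1 hc
  have hmono := closestMoment_strictMono hinf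
  obtain ⟨m, hm, W⟩ := hf.exists_wanderingSequence hmax hQ
  obtain ⟨K, M, ε, hK, hM, hε, bm, bp⟩ := hf.exists_branchEstimates hmax
  have hC : 0 ≤ tightConst K ε := by unfold tightConst; positivity
  have hlarge : ∀ k, m < closestMoment f c Q (m + 1 + k) := fun k => by
    have := hmono.le_apply (x := m + 1 + k); omega
  have hs : ∀ k, ConsecutiveRecords (fun j => sSup (f^[m + j] '' Q))
      (closestMoment f c Q (m + 1 + k) - m) (closestMoment f c Q (m + 1 + (k + 1)) - m) := fun k =>
    consecutiveRecords_closestMoment hf hmax hQ.1 hinf hm (hlarge k)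
  have hidx : ∀ k, m + (closestMoment f c Q (m + 1 + k) - m) = closestMoment f c Q (m + 1 + k) :=
    fun k => Nat.add_sub_cancel' (hlarge k).le
  have hidx' : ∀ k, m + (closestMoment f c Q (m + 1 + k) - m - 1) =
      closestMoment f c Q (m + 1 + k) - 1 := fun k => by have := hlarge k; omega
  have hsub : ∀ n, f^[n] '' Q ⊆ Icc (sInf (f^[n] '' Q)) (sSup (f^[n] '' Q)) := fun n => by
    have hQn := h.isWanderingInterval_iterate hQ.1 n
    exact (hQn.ordConnected.ends hQn.nontrivial hQn.subset_Icc).2.2.1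
  have hcn : ∀ n, c ∉ f^[n] '' Q := fun n hcQ =>
    (hf.iterate_ends hmax hQ.1 n).2.2.2.2 (hsub n hcQ)
  have hends : ∀ k ≥ m + 1, rightEnd f c Q k < f c ∧ leftEnd f c Q k < f c := by
    intro k hk
    obtain ⟨i, rfl⟩ := Nat.exists_eq_add_of_le hk
    have h1 := W.lt_value (closestMoment f c Q (m + 1 + i) - m)
    have h2 := W.lt (closestMoment f c Q (m + 1 + i) - m)
    simp only [hidx] at h1 h2
    exact ⟨h1, h2.trans h1⟩
  have hfinal : ∀ {l G : ℝ}, 0 < G → (∃ k₁, ∀ k ≥ k₁,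
      (f c - leftEnd f c Q (m + 1 + k)) ^ l ≤ G * (((f c - rightEnd f c Q (m + 1 + k)) /
        (f c - leftEnd f c Q (m + 1 + k))) ^ ratioExponent l *
          (f c - leftEnd f c Q (m + 1 + (k + 1))))) →
      0 < returnLiminf f c Q (ratioExponent l) l := by
    rintro l G hG ⟨k₁, hk₁⟩
    refine returnLiminf_pos hG (m + 1 + k₁) (fun k hk => hends k (by omega)) fun k hk => ?_
    obtain ⟨i, rfl⟩ := Nat.exists_eq_add_of_le hk
    have := hk₁ (k₁ + i) (by omega)
    rwa [← add_assoc, ← add_assoc, ← add_assoc] at this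
  have hpos : ∀ {l l' : ℝ}, 1 ≤ l → l < l' → 0 < ratioExponent l' := fun h1 h2 => by
    unfold ratioExponent
    exact div_pos (mul_pos (by linarith) (by linarith)) (by linarith)
  rcases W.return_dichotomy h hs hK hM hε hf.one_le_left hf.one_le_right bm bp with
    ⟨hlt, k₁, hk₁⟩ | ⟨hlt, k₁, hk₁⟩
  · refine ⟨ratioExponent ℓp, hpos hf.one_le_left hlt, Or.inl ⟨hlt, ?_,
      hfinal (growthConst_pos (K := K) (l := ℓp) hM hε hC) ⟨k₁, fun k hk => ?_⟩⟩⟩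
    · filter_upwards [eventually_ge_atTop (m + 1 + k₁ + 1)] with k hk
      obtain ⟨i, rfl⟩ : ∃ i, k = m + 1 + (k₁ + i + 1) := ⟨k - (m + 1 + k₁ + 1), by omega⟩
      have h1 := (hk₁ (k₁ + i) (by omega)).1
      simp only [hidx'] at h1
      intro x hx
      refine lt_of_le_of_ne (h1 (hsub _ hx)).1 ?_
      rintro rfl
      exact hcn _ hx
    · have h1 := (hk₁ k hk).2
      simp only [hidx] at h1
      exact h1
  · refine ⟨ratioExponent ℓm, hpos hf.one_le_right hlt, Or.inr ⟨hlt, ?_,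
      hfinal (growthConst_pos (K := K) (l := ℓm) hM hε hC) ⟨k₁, fun k hk => ?_⟩⟩⟩
    · filter_upwards [eventually_ge_atTop (m + 1 + k₁ + 1)] with k hk
      obtain ⟨i, rfl⟩ : ∃ i, k = m + 1 + (k₁ + i + 1) := ⟨k - (m + 1 + k₁ + 1), by omega⟩
      have h1 := (hk₁ (k₁ + i) (by omega)).1
      simp only [hidx'] at h1
      intro x hx
      refine lt_of_le_of_ne (h1 (hsub _ hx)).2 ?_
      rintro rfl
      exact hcn _ hx
    · have h1 := (hk₁ k hk).2
      simp only [hidx] at h1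
      exact h1

end

theorem lemmaB (f : ℝ → ℝ) (c ℓm ℓp : ℝ) (hf : IsUnimodal 2 f c ℓm ℓp) (hmax : IsLocalMax f c)
    (hwander : ∃ J : Set ℝ, IsWanderingInterval f J) :
    ℓm ≠ ℓp ∧
    ∀ Q : Set ℝ, IsMaximalWanderingInterval f Q → f c ∉ closure Q →
      {n : ℕ | IsClosestReturnMoment f c Q n}.Infinite ∧
      ∃ α : ℝ, 0 < α ∧
        ((ℓm < ℓp ∧
            (∀ᶠ k : ℕ in atTop, f^[closestMoment f c Q k - 1] '' Q ⊆ Ioi c) ∧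
            0 < returnLiminf f c Q α ℓp) ∨
          (ℓp < ℓm ∧
            (∀ᶠ k : ℕ in atTop, f^[closestMoment f c Q k - 1] '' Q ⊆ Iio c) ∧
            0 < returnLiminf f c Q α ℓm)) := by
  refine ⟨?_, fun Q hQ hc =>
    ⟨infinite_closestReturnMoment hf hmax hQ.1 hc, hf.closestReturns hmax hQ hc⟩⟩
  obtain ⟨J, hJ⟩ := hwander
  obtain ⟨Q, hQ, hc⟩ := hf.exists_maximal_notMem_closure hmax hJ
  obtain ⟨α, -, ⟨hlt, -⟩ | ⟨hlt, -⟩⟩ := hf.closestReturns hmax hQ hc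
  · exact hlt.ne
  · exact hlt.ne'
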